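/- **Setting.** Fix constants $C,c,K>0$. A mean-zero distribution $\mathcal X$ on $\mathbb R^d$ with finite second moments and invertible covariance $\Sigma_{\mathcal X}=\mathbb E[XX^\top]$ is called *well-behaved* (with constants $C,c,K$) if $\Pr[|\langle v,\Sigma_{\mathcal X}^{-1/2}X\rangle|>t]\le K\exp(-c\,t^{C})$ for all unit vectors $v$ and all $t>0$. Let $[n]=B_1\sqcup\dots\sqcup B_m$ be a partition into buckets (the values of a categorical feature), $n_j=|B_j|$, and let $j(i)$ be the bucket of $i$. Let $X_1,\dots,X_n\in\mathbb R^d$ be iid from $\mathcal X$ and, for some $\mu\in\mathbb R^m$, $\beta_{\rm gt}\in\mathbb R^d$, $\sigma>0$, let $$Y_i=\mu_{j(i)}+\langle X_i,\beta_{\rm gt}\rangle+\zeta_i,\qquad \zeta_i\sim\mathcal N(0,\sigma^2)\ \text{iid, independent of } X .$$ **The bounds produced by OHARE.** Put $\widetilde X_i=X_i-\frac1{n_{j(i)}}\sum_{i'\in B_{j(i)}}X_{i'}$, define $\widetilde Y_i$ in the same way, and set $\widetilde\Sigma=\sum_i\widetilde X_i\widetilde X_i^\top$, $\beta=\widetilde\Sigma^{-1}\sum_i\widetilde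 Y_i\widetilde X_i$, $R_i=\widetilde Y_i-\langle\widetilde X_i,\beta\rangle$, $Z_i=e^\top\widetilde\Sigma^{-1}\widetilde X_i$, $G_{ii'}=\widetilde X_i^\top\widetilde\Sigma^{-1}\widetilde X_{i'}$, where $e\in\mathbb R^d$ is the direction of interest. *First order part.* For $0\le l\le n_j$ let $d_j(l)=\max_T\sum_{i\in T}R_iZ_i$, $\ r^{+}=\max_T\sum_{T}R_i$, $\ r^{-}=\min_T\sum_{T}R_i$, $\ z^{+}=\max_T\sum_{T}Z_i$, $\ z^{-}=\min_T\sum_{T}Z_i$, over $T\subseteq B_j$ with $|T|=l$; let $c_j^+(l)=\max\{r^+z^+,r^-z^-\}$, $c_j^-(l)=\min\{r^-z^+,r^+z^-\}$, and $\mathrm{bound}_j^{\pm}(l)=d_j(l)+c_j^{\pm}(l)/(n_j-l)$ if $l<n_j$, $\mathrm{bound}_j^{\pm}(n_j)=d_j(n_j)$. Let $I_k^\pm=\max\sum_j\mathrm{bound}_j^\pm(k_j)$ over all $k_1+\dots+k_m=k$ with $0\le k_j\le n_j$. *Direct higher order terms.* For a function $f$ on $[n]$ and $u\le k$ let $\Phi_{k,u}(f)$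 be obtained by singling out one maximal entry of $f$ in each bucket and adding the $u$ largest of these entries and the $k-u$ largest of all the remaining entries. For an $n\times n$ matrix $H$ let $V_{k,u}(H)=\big(\Phi_{k,u}(i\mapsto\Phi_{k,u}(H_{i,\cdot}))\big)^{1/2}$. Put $\mathrm{CS}^{\rm dir}=V_{k,u}\big((G_{ii'}^2)\big)$, $\mathrm{XR}^{\rm dir}=V_{k,u}\big((R_iG_{ii'}R_{i'})\big)$, $\mathrm{XZ}^{\rm dir}=V_{k,u}\big((Z_iG_{ii'}Z_{i'})\big)$. *Indirect higher order terms.* Let $M_j(l)$ be the square root of the sum of the $l$ largest, over $i\in B_j$, of the numbers "sum of the $l$ largest entries $G_{ii'}$, $i'\in B_j$", and let $\rho_j(l)$, $\zeta_j(l)$ be the sums of the $l$ largest values of $|R_i|$, respectively $|Z_i|$, $i\in B_j$. Let $\overline M_j(l)=\min\{M_j(l),M_j(n_j-l)\}$, and define $\overline\rho_j$, $\overline\zeta_j$ in the same way. $\mathrm{CS}^{\rm ind}$, $\mathrm{XR}^{\rm ind}$, $\mathrm{XZ}^{\rm ind}$ are the maxima of $\sum_j\frac{\overline M_j(k_j)^2}{n_j-k_j}$,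 $\sum_j\frac{\overline M_j(k_j)\overline\rho_j(k_j)}{n_j-k_j}$, $\sum_j\frac{\overline M_j(k_j)\overline\zeta_j(k_j)}{n_j-k_j}$ (with $0/0=0$) over all $k_1+\dots+k_m=k$, $0\le k_j\le n_j$, with exactly $u$ nonzero $k_j$. *Output.* $$U_k,L_k=I_k^{\pm}\pm\max_u\frac{|\mathrm{XR}^{\rm dir}+\mathrm{XR}^{\rm ind}|\cdot|\mathrm{XZ}^{\rm dir}+\mathrm{XZ}^{\rm ind}|}{1-\mathrm{CS}^{\rm dir}-\mathrm{CS}^{\rm ind}},$$ the maximum being over the possible numbers $u$ of affected buckets, with the fraction read as $+\infty$ when $\mathrm{CS}^{\rm dir}+\mathrm{CS}^{\rm ind}\ge1$. **Theorem.** For every $\varepsilon>0$ and all $C,c,K>0$ there are $A,A',B\in\mathbb N$ and $M>0$ such that for every $p\in\mathbb N$ there is $n_0$ such that the following holds for all $n\ge n_0$, all $d,m$, all bucket partitions with $$n^{\varepsilon}+\nu\sqrt d<n_j<0.49\,n\quad\text{for all }j,\qquad d\le n^{4/5}/\nu,\qquad \nu=(\log n)^{A},$$ all well-behaved $\mathcal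 X$ with constants $C,c,K$, all $\sigma>0$, $\mu$, $\beta_{\rm gt}$, and all unit vectors $e\in\mathbb R^d$. With probability at least $1-n^{-p}$, simultaneously for all integers $$1\le k<\frac{1}{(\log n)^{A'}}\min\Big\{\frac n{\sqrt d},\ \frac{n^2}{d^2},\ n^{1-\varepsilon}\Big\}$$ one has $L_k>0$ and $$1\le\frac{U_k}{L_k}\le 1+M\,\frac{(\log\log n)^{B}}{\sqrt{\log n}} .$$ -/

import Mathlib

open MeasureTheory ProbabilityTheory
open scoped NNReal ENNReal

noncomputable section

namespace Ohare

/-! ### Well-behaved distributions -/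

/-- The second moment matrix `E[X Xᵀ]` of a distribution on `ℝᵈ`. -/
def covMatrix {d : ℕ} (D : Measure (EuclideanSpace ℝ (Fin d))) : Matrix (Fin d) (Fin d) ℝ :=
  Matrix.of fun a b => ∫ x, x a * x b ∂D

/-- `D` is a mean-zero probability distribution on `ℝᵈ` with finite second moments and invertible
covariance `Σ`, such that `P(|⟨v, Σ^{-1/2} X⟩| > t) ≤ K exp (-c t ^ C)` for all unit vectors `v` and
all `t > 0`. The matrix `Q` is `Σ^{-1/2}`, the unique positive definite square root of `Σ⁻¹`. -/
structure WellBehaved (C c K : ℝ) {d : ℕ} (D : Measure (EuclideanSpace ℝ (Fin d))) : Prop where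
  isProbabilityMeasure : IsProbabilityMeasure D
  memLp_two : MemLp id 2 D
  mean_zero : ∀ a, ∫ x, x a ∂D = 0
  cov_posDef : (covMatrix D).PosDef
  tail : ∀ Q : Matrix (Fin d) (Fin d) ℝ, Q.PosDef → Q * Q = (covMatrix D)⁻¹ →
    ∀ v : EuclideanSpace ℝ (Fin d), ‖v‖ = 1 → ∀ t : ℝ, 0 < t →
      D {x | t < |inner ℝ v (WithLp.toLp 2 (Matrix.mulVec Q x.ofLp))|}
        ≤ ENNReal.ofReal (K * Real.exp (-(c * t ^ C)))

/-! ### The random regression -/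

/-- Joint law of `n` iid continuous feature vectors with law `D` and, independently of them, `n` iid
`N(0, σ²)` errors. -/
def regressionLaw {d : ℕ} (n : ℕ) (D : Measure (EuclideanSpace ℝ (Fin d))) (σ : ℝ≥0) :
    Measure ((Fin n → EuclideanSpace ℝ (Fin d)) × (Fin n → ℝ)) :=
  (Measure.pi fun _ : Fin n => D).prod (Measure.pi fun _ : Fin n => gaussianReal 0 (σ ^ 2))

/-- Labels `Y_i = μ_{j(i)} + ⟨X_i, β⟩ + ζ_i`, where `j(i) = b i` is the bucket of sample `i`. -/
def labels {n d m : ℕ} (b : Fin n → Fin m) (μ : Fin m → ℝ) (β : EuclideanSpace ℝ (Fin d))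
    (X : Fin n → EuclideanSpace ℝ (Fin d)) (ζ : Fin n → ℝ) : Fin n → ℝ :=
  fun i => μ (b i) + inner ℝ (X i) β + ζ i

/-- The bucket `B_j`. -/
def bucket {n m : ℕ} (b : Fin n → Fin m) (j : Fin m) : Finset (Fin n) :=
  Finset.univ.filter fun i => b i = j

/-! ### Optimisation over finite sets -/

/-- The maximum of `f` over a finite set (`0` for the empty set). -/
def finMax {α : Type*} (s : Finset α) (f : α → ℝ) : ℝ :=
  if h : s.Nonempty then s.sup' h f else 0

/-- The minimum of `f` over a finite set (`0` for the empty set). -/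
def finMin {α : Type*} (s : Finset α) (f : α → ℝ) : ℝ :=
  if h : s.Nonempty then s.inf' h f else 0

/-- The sum of the `k` largest values of `f` on `s`, i.e. the maximum of `∑ i ∈ T, f i` over the
`k`-element subsets `T` of `s`. -/
def topSum {α : Type*} (s : Finset α) (k : ℕ) (f : α → ℝ) : ℝ :=
  finMax (s.powersetCard k) fun T => ∑ i ∈ T, f i

/-- The sum of the `k` smallest values of `f` on `s`. -/
def bottomSum {α : Type*} (s : Finset α) (k : ℕ) (f : α → ℝ) : ℝ :=
  finMin (s.powersetCard k) fun T => ∑ i ∈ T, f i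

/-! ### MSN-bounding algorithms -/

/-- Refined Triangle Inequality on the Gram matrix of the vectors indexed by `s`: take the cumulative
sum of the `k` largest entries of every row, then the sum of the `k` largest results, then the
square root. -/
def rti {n : ℕ} (s : Finset (Fin n)) (G : Matrix (Fin n) (Fin n) ℝ) (k : ℕ) : ℝ :=
  √(topSum s k fun i => topSum s k fun i' => G i i')

/-- One index per nonempty bucket, at which `f` attains its maximum over that bucket. -/
def bucketBest {n m : ℕ} (b : Fin n → Fin m) (f : Fin n → ℝ) : Finset (Fin n) :=
  Finset.univ.biUnion fun j =>
    if h : (bucket b j).Nonempty then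
      {Classical.choose (Finset.exists_max_image (bucket b j) f h)} else ∅

/-- The `u` largest of the bucket maxima of `f`, plus the `k - u` largest of all the other entries. -/
def kuSum {n m : ℕ} (b : Fin n → Fin m) (k u : ℕ) (f : Fin n → ℝ) : ℝ :=
  topSum (bucketBest b f) u f + topSum (Finset.univ \ bucketBest b f) (k - u) f

/-- KU Triangle Inequality: an upper bound on the norm of a sum of `k` vectors with Gram matrix `G`
that are taken from exactly `u` different buckets. -/
def kuBound {n m : ℕ} (b : Fin n → Fin m) (G : Matrix (Fin n) (Fin n) ℝ) (k u : ℕ) : ℝ :=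
  √(kuSum b k u fun i => kuSum b k u fun i' => G i i')

/-! ### Dynamic programming over the buckets -/

/-- All ways `(k_1, …, k_m)` of splitting `k` removals among the buckets, `k_j ≤ |B_j|`. -/
def allocs {n m : ℕ} (b : Fin n → Fin m) (k : ℕ) : Finset (Fin m → ℕ) :=
  (Fintype.piFinset fun j => Finset.range ((bucket b j).card + 1)).filter fun κ => ∑ j, κ j = k

/-- The splittings of `k` in which exactly `u` of the `k_j` are nonzero. -/
def allocsKU {n m : ℕ} (b : Fin n → Fin m) (k u : ℕ) : Finset (Fin m → ℕ) :=
  (allocs b k).filter fun κ => (Finset.univ.filter fun j => κ j ≠ 0).card = u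

/-- Value of the one-dimensional integer knapsack problem with scores `f j k_j`. -/
def knapsack {n m : ℕ} (b : Fin n → Fin m) (k : ℕ) (f : Fin m → ℕ → ℝ) : ℝ :=
  finMax (allocs b k) fun κ => ∑ j, f j (κ j)

/-- Value of the two-dimensional integer knapsack problem with scores `f j k_j`, as a function of the
budget `k` and of the number `u` of buckets used. -/
def knapsackKU {n m : ℕ} (b : Fin n → Fin m) (k u : ℕ) (f : Fin m → ℕ → ℝ) : ℝ :=
  finMax (allocsKU b k u) fun κ => ∑ j, f j (κ j)

/-! ### The regression controlled for the categorical feature -/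

section Algorithm

variable {n d m : ℕ} (b : Fin n → Fin m) (X : Fin n → EuclideanSpace ℝ (Fin d)) (Y : Fin n → ℝ)
  (e : EuclideanSpace ℝ (Fin d))

/-- Subtract from every entry the average over its bucket. -/
def reaverage (f : Fin n → ℝ) : Fin n → ℝ :=
  fun i => f i - (∑ i' ∈ bucket b (b i), f i') / ((bucket b (b i)).card : ℝ)

/-- The reaveraged features, as an `n × d` matrix. -/
def Xt : Matrix (Fin n) (Fin d) ℝ :=
  Matrix.of fun i a => reaverage b (fun i' => X i' a) i

/-- The unnormalised empirical covariance of the reaveraged features. -/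
def Sigmat : Matrix (Fin d) (Fin d) ℝ := (Xt b X).transpose * Xt b X

/-- The OLS fit of the reaveraged labels by the reaveraged features. -/
def betaHat : Fin d → ℝ :=
  Matrix.mulVec (Sigmat b X)⁻¹ (Matrix.mulVec (Xt b X).transpose (reaverage b Y))

/-- The residuals of that fit. -/
def resid : Fin n → ℝ := fun i => reaverage b Y i - Matrix.mulVec (Xt b X) (betaHat b X Y) i

/-- `Z_i = eᵀ Σ⁻¹ X_i` for the reaveraged features. -/
def Zproj : Fin n → ℝ := Matrix.mulVec (Xt b X) (Matrix.mulVec (Sigmat b X)⁻¹ e.ofLp)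

/-- Gram matrix of the reaveraged features after they are normalised to have empirical covariance
`1`: its entries are `X_iᵀ Σ⁻¹ X_i'`. -/
def gram : Matrix (Fin n) (Fin n) ℝ := Xt b X * (Sigmat b X)⁻¹ * (Xt b X).transpose

/-! ### First order terms -/

/-- Direct first order effect of `k` removals from bucket `j`. -/
def dTerm (j : Fin m) (k : ℕ) : ℝ :=
  topSum (bucket b j) k fun i => resid b X Y i * Zproj b X e i

/-- Upper bound on `(∑_{i ∈ T} R_i) (∑_{i ∈ T} Z_i)` over `k`-element `T ⊆ B_j`. -/
def cPlus (j : Fin m) (k : ℕ) : ℝ :=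
  max (topSum (bucket b j) k (resid b X Y) * topSum (bucket b j) k (Zproj b X e))
    (bottomSum (bucket b j) k (resid b X Y) * bottomSum (bucket b j) k (Zproj b X e))

/-- Lower bound on `(∑_{i ∈ T} R_i) (∑_{i ∈ T} Z_i)` over `k`-element `T ⊆ B_j`. -/
def cMinus (j : Fin m) (k : ℕ) : ℝ :=
  min (bottomSum (bucket b j) k (resid b X Y) * topSum (bucket b j) k (Zproj b X e))
    (topSum (bucket b j) k (resid b X Y) * bottomSum (bucket b j) k (Zproj b X e))

/-- The first order score `d_j(k) + c / (|B_j| - k)` of a bucket; no reaveraging effect is left when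
the whole bucket is removed. -/
def bucketBound (c : Fin m → ℕ → ℝ) (j : Fin m) (k : ℕ) : ℝ :=
  if k = (bucket b j).card then dTerm b X Y e j k
  else dTerm b X Y e j k + c j k / (((bucket b j).card : ℝ) - (k : ℝ))

/-- Upper bound on the first order effect of `k` removals. -/
def influencePlus (k : ℕ) : ℝ := knapsack b k (bucketBound b X Y e (cPlus b X Y e))

/-- Lower bound on the first order effect of `k` removals. -/
def influenceMinus (k : ℕ) : ℝ := knapsack b k (bucketBound b X Y e (cMinus b X Y e))

/-! ### Higher order terms -/

/-- Direct contribution to the covariance shift. -/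
def directCS (k u : ℕ) : ℝ :=
  kuBound b (Matrix.of fun i i' => gram b X i i' ^ 2) k u

/-- Direct contribution to the `XR` term. -/
def directXR (k u : ℕ) : ℝ :=
  kuBound b (Matrix.of fun i i' => resid b X Y i * gram b X i i' * resid b X Y i') k u

/-- Direct contribution to the `XZ` term. -/
def directXZ (k u : ℕ) : ℝ :=
  kuBound b (Matrix.of fun i i' => Zproj b X e i * gram b X i i' * Zproj b X e i') k u

/-- Replace a bound `f k` that is valid for `k` removals from a bucket of zero-sum terms by the
minimum of `f k` and `f (|B_j| - k)`. -/
def symmetrize (j : Fin m) (f : ℕ → ℝ) (k : ℕ) : ℝ := min (f k) (f ((bucket b j).card - k))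

/-- Bound on `‖∑_{i ∈ T} X_i‖` for `k`-element `T ⊆ B_j` (normalised features). -/
def Mterm (j : Fin m) (k : ℕ) : ℝ := symmetrize b j (rti (bucket b j) (gram b X)) k

/-- Bound on `|∑_{i ∈ T} R_i|` for `k`-element `T ⊆ B_j`. -/
def rhoTerm (j : Fin m) (k : ℕ) : ℝ :=
  symmetrize b j (fun l => topSum (bucket b j) l fun i => |resid b X Y i|) k

/-- Bound on `|∑_{i ∈ T} Z_i|` for `k`-element `T ⊆ B_j`. -/
def zetaTerm (j : Fin m) (k : ℕ) : ℝ :=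
  symmetrize b j (fun l => topSum (bucket b j) l fun i => |Zproj b X e i|) k

/-- Indirect contribution to the covariance shift. When a bucket is removed entirely the numerator
vanishes, and the quotient is `0`; likewise below. -/
def indirectCS (k u : ℕ) : ℝ :=
  knapsackKU b k u fun j l => Mterm b X j l ^ 2 / (((bucket b j).card : ℝ) - (l : ℝ))

/-- Indirect contribution to the `XR` term. -/
def indirectXR (k u : ℕ) : ℝ :=
  knapsackKU b k u fun j l =>
    Mterm b X j l * rhoTerm b X Y j l / (((bucket b j).card : ℝ) - (l : ℝ))

/-- Indirect contribution to the `XZ` term. -/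
def indirectXZ (k u : ℕ) : ℝ :=
  knapsackKU b k u fun j l =>
    Mterm b X j l * zetaTerm b X e j l / (((bucket b j).card : ℝ) - (l : ℝ))

/-- Bound on the higher order effect of `k` removals from exactly `u` buckets. It is infinite when
the algorithm fails to certify that the covariance of the retained samples is invertible. -/
def highOrderKU (k u : ℕ) : EReal :=
  if directCS b X k u + indirectCS b X k u < 1 then
    ((|directXR b X Y k u + indirectXR b X Y k u| * |directXZ b X e k u + indirectXZ b X e k u| /
      (1 - directCS b X k u - indirectCS b X k u) : ℝ) : EReal)
  else ⊤

/-- Bound on the higher order effect of `k` removals: the maximum over the possible numbers `u` of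
buckets that are affected. -/
def highOrder (k : ℕ) : EReal :=
  ((Finset.range (m + 1)).filter fun u => (allocsKU b k u).Nonempty).sup (highOrderKU b X Y e k)

/-- The upper bound `U_k` produced by OHARE. -/
def upper (k : ℕ) : EReal := (influencePlus b X Y e k : EReal) + highOrder b X Y e k

/-- The lower bound `L_k` produced by OHARE. -/
def lower (k : ℕ) : EReal := (influenceMinus b X Y e k : EReal) - highOrder b X Y e k

end Algorithm

end Ohare

end

noncomputable section
namespace Ohare

/-! ### Scatter matrices of centred features -/

/-! Measure everything in units of r·z, where r is the scale of the residuals and z the scale of the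
projections. The k most influential samples contribute at least s·r·z each, with s of order √(log
n). Everything that separates U_k from L_k costs only O(t²)·r·z per removed sample, with t a power
of log log n. Hence U_k/L_k - 1 is O(t²/s).

Deterministic half (`Typical.bounds_ratio`). `Typical` lists what is needed of the data. At least
n^(1-ε) samples have R_i Z_i ≥ s·r·z, so the sum of the k largest products, which both first order
values approximate, is at least s·r·z·k. The reaveraging correction of a bucket losing l samples is
at most (4t²+2)·r·z·l (`product_le`). If l and N-l are both a non-negligible part of the bucket size
N, the few exceptional entries are outweighed by the entries below the threshold t; otherwise the
crude bound P on every entry suffices. These bounds are linear in l, so the knapsack adds them up to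
a multiple of k. The higher order terms are at most r·z·k (`Typical.highOrder_eq`), because up to
polylogarithmic factors the Gram matrix has diagonal of order d/n and off-diagonal entries of order
√d/n. This is where k must be small against n/√d and n²/d².

Probabilistic half (`eventually_typical`). Whitening leaves the Gram matrix and the projections
unchanged once e is transformed too, so the features may be taken isotropic. Gram entries and
projections are coefficients ⟨w̃_i, S⁻¹v⟩ with S the scatter matrix. Deleting sample i, or its whole
bucket, changes S by an explicit term (`scatter_univ_eq_erase`, `scatter_univ_eq_sdiff`). Against
the inverse of the reduced matrix, w_i is independent of the direction it is tested on, so the inner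
product is of the order of the norm of that direction, without the factor √d of Cauchy–Schwarz. The
remaining error is at most half of the largest coefficient and is absorbed on the left. This gives
the off-diagonal bound √d/n and Z_i ≈ ⟨w_i, e⟩/n. Invertibility of all the scatter matrices comes
from a small ball estimate and a union bound over a grid of directions and bucket offsets
(`eventually_curved`); the offsets are needed because the bucket means are random.

The residuals are the noise minus its bucket means and its projection, hence within σ of the noise
(`RegularNoise.abs_resid_sub_le`). A constant fraction of samples has |⟨e, w_i⟩| ≥ 1/3, and an error
of matching sign above √(ε log n)/2·σ has probability at least of order n^(-ε/4), which supplies the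
influential samples (`eventually_large`). The threshold t need only exclude a polylogarithmically
small fraction of each bucket, so a power of log log n is enough. -/

abbrev Vec (d : ℕ) := EuclideanSpace ℝ (Fin d)

section Scatter

variable {n d m : ℕ} (b : Fin n → Fin m) (A : Finset (Fin n)) (w : Fin n → Vec d)

/-- The mean of `w` over the part of bucket `j` that lies in `A`. -/
def center (j : Fin m) : Vec d :=
  ((A.filter fun i => b i = j).card : ℝ)⁻¹ • ∑ l ∈ A.filter fun i => b i = j, w l

/-- The features, centred at the means of the buckets restricted to `A`. -/
def centered (l : Fin n) : Vec d := w l - center b A w (b l)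

/-- The matrix `∑ l ∈ A, w̃ l (w̃ l)ᵀ`, where `w̃` are the centred features. -/
def scatterMatrix : Matrix (Fin d) (Fin d) ℝ :=
  Matrix.of fun a a' => ∑ l ∈ A, centered b A w l a * centered b A w l a'

/-- The scatter matrix as a linear map. -/
def scatter : Vec d →ₗ[ℝ] Vec d := Matrix.toEuclideanLin (scatterMatrix b A w)

/-- The inverse scatter matrix as a linear map. -/
def scatterInv : Vec d →ₗ[ℝ] Vec d := Matrix.toEuclideanLin (scatterMatrix b A w)⁻¹

lemma inner_eq_sum (x y : Vec d) : inner ℝ x y = ∑ a, x a * y a := by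
  simp [PiLp.inner_apply, mul_comm]

lemma scatter_apply (v : Vec d) :
    scatter b A w v = ∑ l ∈ A, (inner ℝ (centered b A w l) v : ℝ) • centered b A w l := by
  ext a
  simp only [scatter, scatterMatrix, Matrix.toLpLin_apply, Matrix.mulVec, dotProduct, Matrix.of_apply,
    WithLp.ofLp_sum, Finset.sum_apply, WithLp.ofLp_smul, Pi.smul_apply, smul_eq_mul, inner_eq_sum,
    Finset.sum_mul]
  rw [Finset.sum_comm]
  exact Finset.sum_congr rfl fun l _ => Finset.sum_congr rfl fun c _ => by ring

lemma inner_scatter (v x : Vec d) :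
    inner ℝ v (scatter b A w x)
      = ∑ l ∈ A, inner ℝ (centered b A w l) v * (inner ℝ (centered b A w l) x : ℝ) := by
  rw [scatter_apply, inner_sum]
  refine Finset.sum_congr rfl fun l _ => ?_
  rw [inner_smul_right, real_inner_comm v, mul_comm]

lemma inner_scatter_comm (x y : Vec d) :
    inner ℝ x (scatter b A w y) = (inner ℝ (scatter b A w x) y : ℝ) := by
  rw [real_inner_comm y, inner_scatter, inner_scatter]
  exact Finset.sum_congr rfl fun l _ => mul_comm _ _

variable {b A w}

section Inverse

variable {lam : ℝ} (hlam : 0 < lam)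
  (h : ∀ v : Vec d, lam * ‖v‖ ^ 2 ≤ ∑ l ∈ A, (inner ℝ (centered b A w l) v : ℝ) ^ 2)

include hlam h in
lemma scatterMatrix_isUnit : IsUnit (scatterMatrix b A w) := by
  rw [← Matrix.mulVec_injective_iff_isUnit]
  rw [← Matrix.coe_mulVecLin, ← LinearMap.ker_eq_bot, LinearMap.ker_eq_bot']
  intro x hx
  have h0 : scatter b A w (WithLp.toLp 2 x) = 0 := by
    ext a
    simpa [scatter, Matrix.toLpLin_apply] using congrFun hx a
  have h1 : ∑ l ∈ A, (inner ℝ (centered b A w l) (WithLp.toLp 2 x : Vec d) : ℝ) ^ 2 = 0 := by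
    have := inner_scatter b A w (WithLp.toLp 2 x) (WithLp.toLp 2 x)
    rw [h0, inner_zero_right] at this
    rw [this]
    exact Finset.sum_congr rfl fun l _ => pow_two _
  have h2 := h (WithLp.toLp 2 x)
  rw [h1] at h2
  have h3 : ‖(WithLp.toLp 2 x : Vec d)‖ ^ 2 = 0 :=
    le_antisymm (nonpos_of_mul_nonpos_right h2 hlam) (sq_nonneg _)
  have h4 : (WithLp.toLp 2 x : Vec d) = 0 := by simpa using h3
  exact congrArg WithLp.ofLp h4

include hlam h in
lemma scatter_scatterInv (v : Vec d) : scatter b A w (scatterInv b A w v) = v := by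
  have hu := (Matrix.isUnit_iff_isUnit_det _).1 (scatterMatrix_isUnit hlam h)
  ext a
  simp [scatter, scatterInv, Matrix.toLpLin_apply, Matrix.mulVec_mulVec,
    Matrix.mul_nonsing_inv _ hu]

include hlam h in
lemma scatterInv_scatter (v : Vec d) : scatterInv b A w (scatter b A w v) = v := by
  have hu := (Matrix.isUnit_iff_isUnit_det _).1 (scatterMatrix_isUnit hlam h)
  ext a
  simp [scatter, scatterInv, Matrix.toLpLin_apply, Matrix.mulVec_mulVec,
    Matrix.nonsing_inv_mul _ hu]

include hlam h in
-- With y = S⁻¹v one has lam‖y‖² ≤ ⟨y, Sy⟩ = ⟨y, v⟩ ≤ ‖y‖‖v‖.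
lemma norm_scatterInv_le (v : Vec d) : ‖scatterInv b A w v‖ ≤ ‖v‖ / lam := by
  set y := scatterInv b A w v with hy
  have h1 := h y
  have h2 : inner ℝ y (scatter b A w y) = ∑ l ∈ A, (inner ℝ (centered b A w l) y : ℝ) ^ 2 := by
    rw [inner_scatter]
    exact Finset.sum_congr rfl fun l _ => (pow_two _).symm
  rw [← h2, hy, scatter_scatterInv hlam h, ← hy] at h1
  have h3 := h1.trans (real_inner_le_norm y v)
  rw [le_div_iff₀ hlam]
  rcases (norm_nonneg y).eq_or_lt with h0 | h0
  · rw [← h0, zero_mul]; exact norm_nonneg v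
  · nlinarith

include hlam h in
lemma inner_scatterInv_comm (x y : Vec d) :
    inner ℝ x (scatterInv b A w y) = (inner ℝ (scatterInv b A w x) y : ℝ) := by
  conv_lhs => rw [← scatter_scatterInv hlam h x]
  conv_rhs => rw [← scatter_scatterInv hlam h y]
  rw [inner_scatter_comm]

end Inverse

/-- The covariance identity: the centred weights sum to zero, so centring the second factor changes
nothing. For empty `s` both sides vanish. -/
lemma sum_centered_smul_centered {ι V : Type*} [AddCommGroup V] [Module ℝ V] (s : Finset ι)
    (f : ι → ℝ) (x : ι → V) :
    ∑ l ∈ s, (f l - (s.card : ℝ)⁻¹ * ∑ i ∈ s, f i) • (x l - (s.card : ℝ)⁻¹ • ∑ i ∈ s, x i)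
      = ∑ l ∈ s, f l • x l - ((s.card : ℝ)⁻¹ * ∑ i ∈ s, f i) • ∑ i ∈ s, x i := by
  rcases s.eq_empty_or_nonempty with rfl | hs
  · simp
  have hc : (s.card : ℝ) ≠ 0 := by exact_mod_cast hs.card_pos.ne'
  have h0 : ∑ l ∈ s, (f l - (s.card : ℝ)⁻¹ * ∑ i ∈ s, f i) = 0 := by
    rw [Finset.sum_sub_distrib, Finset.sum_const, nsmul_eq_mul, mul_inv_cancel_left₀ hc, sub_self]
  simp only [smul_sub, Finset.sum_sub_distrib]
  rw [← Finset.sum_smul, h0, zero_smul, sub_zero]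
  simp only [sub_smul, Finset.sum_sub_distrib, ← Finset.smul_sum]

/-- A centred feature only sees its own bucket. This gives invariance both under deleting other
buckets and under resampling samples outside `A`. -/
lemma centered_congr {A' : Finset (Fin n)} {w' : Fin n → Vec d} {l : Fin n}
    (h : A.filter (fun i => b i = b l) = A'.filter (fun i => b i = b l))
    (hw : ∀ i ∈ A.filter (fun i => b i = b l), w i = w' i) (hl : w l = w' l) :
    centered b A w l = centered b A' w' l := by
  rw [centered, centered, center, center, ← h, hl, Finset.sum_congr rfl hw]

/-- Contribution of one bucket to the scatter matrix. -/
lemma scatter_bucket (j : Fin m) (y : Vec d) :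
    ∑ l ∈ A.filter (fun i => b i = j), (inner ℝ (centered b A w l) y : ℝ) • centered b A w l
      = ∑ l ∈ A.filter (fun i => b i = j), (inner ℝ (w l) y : ℝ) • w l
        - (((A.filter (fun i => b i = j)).card : ℝ)⁻¹
            * ∑ l ∈ A.filter (fun i => b i = j), (inner ℝ (w l) y : ℝ))
          • ∑ l ∈ A.filter (fun i => b i = j), w l := by
  rw [← sum_centered_smul_centered]
  refine Finset.sum_congr rfl fun l hl => ?_
  rw [centered, (Finset.mem_filter.1 hl).2, center, inner_sub_left, real_inner_smul_left, sum_inner]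

/-- Removing a whole bucket leaves the means of all other buckets alone, so exactly the terms of
that bucket disappear. -/
lemma scatter_univ_eq_sdiff (j : Fin m) (y : Vec d) :
    scatter b Finset.univ w y = scatter b (Finset.univ \ bucket b j) w y
      + ∑ l ∈ bucket b j, (inner ℝ (centered b Finset.univ w l) y : ℝ) •
          centered b Finset.univ w l := by
  rw [scatter_apply, scatter_apply, ← Finset.sum_sdiff (Finset.subset_univ (bucket b j))]
  congr 1
  refine Finset.sum_congr rfl fun l hl => ?_
  have : centered b (Finset.univ \ bucket b j) w l = centered b Finset.univ w l := by
    refine centered_congr ?_ (fun _ _ => rfl) rfl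
    ext i
    simp only [Finset.mem_sdiff, bucket, Finset.mem_filter, Finset.mem_univ, true_and] at hl ⊢
    constructor
    · exact fun h => h.2
    · exact fun h => ⟨fun h' => hl (h ▸ h'), h⟩
  rw [this]

/-- Removing one of N points also moves the mean of the others. The two effects combine into a rank
one term in the old deviation, with factor N/(N-1), whence the need for N ≥ 2. -/
lemma scatter_univ_eq_erase (i : Fin n) (hi : 2 ≤ (bucket b (b i)).card) (y : Vec d) :
    scatter b Finset.univ w y = scatter b (Finset.univ.erase i) w y
      + (((bucket b (b i)).card : ℝ) / ((bucket b (b i)).card - 1)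
          * (inner ℝ (centered b Finset.univ w i) y : ℝ)) • centered b Finset.univ w i := by
  have hsplit : ∀ A : Finset (Fin n), scatter b A w y
      = ∑ l ∈ A.filter (fun l => b l ≠ b i), (inner ℝ (centered b A w l) y : ℝ) • centered b A w l
        + ∑ l ∈ A.filter (fun l => b l = b i),
            (inner ℝ (centered b A w l) y : ℝ) • centered b A w l := by
    intro A
    rw [scatter_apply, ← Finset.sum_filter_add_sum_filter_not A (fun l => b l = b i), add_comm]
  have h1 : ∑ l ∈ (Finset.univ.erase i).filter (fun l => b l ≠ b i),
        (inner ℝ (centered b (Finset.univ.erase i) w l) y : ℝ) • centered b (Finset.univ.erase i) w l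
      = ∑ l ∈ Finset.univ.filter (fun l => b l ≠ b i),
        (inner ℝ (centered b Finset.univ w l) y : ℝ) • centered b Finset.univ w l := by
    have hs : (Finset.univ.erase i).filter (fun l => b l ≠ b i)
        = Finset.univ.filter (fun l => b l ≠ b i) := by
      ext l
      simp only [Finset.mem_filter, Finset.mem_erase, Finset.mem_univ, and_true, true_and]
      exact ⟨fun h => h.2, fun h => ⟨fun h' => h (h' ▸ rfl), h⟩⟩
    rw [hs]
    refine Finset.sum_congr rfl fun l hl => ?_
    have : centered b (Finset.univ.erase i) w l = centered b Finset.univ w l := by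
      refine centered_congr ?_ (fun _ _ => rfl) rfl
      ext l'
      simp only [Finset.mem_filter, Finset.mem_erase, Finset.mem_univ, and_true, true_and] at hl ⊢
      exact ⟨fun h => h.2, fun h => ⟨fun h' => hl (by rw [← h, h']), h⟩⟩
    rw [this]
  rw [hsplit, hsplit (Finset.univ.erase i), h1, add_assoc, scatter_bucket, scatter_bucket]
  congr 1
  have he : (Finset.univ.erase i).filter (fun l => b l = b i) = (bucket b (b i)).erase i := by
    rw [bucket, Finset.filter_erase]
  rw [he]
  change _ - (((bucket b (b i)).card : ℝ)⁻¹ * _) • _ = _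
  change ∑ l ∈ bucket b (b i), _ - (_ * ∑ l ∈ bucket b (b i), _) • ∑ l ∈ bucket b (b i), _ = _
  have hmem : i ∈ bucket b (b i) := by simp [bucket]
  have hc : (((bucket b (b i)).erase i).card : ℝ) = (bucket b (b i)).card - 1 := by
    rw [Finset.card_erase_of_mem hmem, Nat.cast_sub (by omega), Nat.cast_one]
  rw [hc]
  have hcen : centered b Finset.univ w i
      = w i - ((bucket b (b i)).card : ℝ)⁻¹ • ∑ l ∈ bucket b (b i), w l := rfl
  rw [hcen, inner_sub_left, real_inner_smul_left, sum_inner]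
  rw [← Finset.add_sum_erase _ _ hmem, ← Finset.add_sum_erase _ _ hmem,
    ← Finset.add_sum_erase _ _ hmem]
  have hN : (2 : ℝ) ≤ (bucket b (b i)).card := by exact_mod_cast hi
  set N : ℝ := ((bucket b (b i)).card : ℝ)
  have hN0 : N ≠ 0 := by linarith
  have hN1 : N - 1 ≠ 0 := by intro h; linarith
  set F := ∑ l ∈ (bucket b (b i)).erase i, (inner ℝ (w l) y : ℝ)
  set S := ∑ l ∈ (bucket b (b i)).erase i, w l
  set f := (inner ℝ (w i) y : ℝ)
  match_scalars <;> field_simp <;> ring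

end Scatter


/-! ### Deterministic consequences of regularity of the features -/

section Regular

variable {n d m : ℕ}

/-- The part of the centred feature `i'` that does not involve the feature `i`. -/
def partialCentered (b : Fin n → Fin m) (w : Fin n → Vec d) (i i' : Fin n) : Vec d :=
  w i' - ((bucket b (b i')).card : ℝ)⁻¹ • ∑ l ∈ (bucket b (b i')).erase i, w l

/-- Features that behave like a typical isotropic sample, up to factors `T`. -/
structure Regular (T : ℝ) (b : Fin n → Fin m) (e : Vec d) (w : Fin n → Vec d) : Prop where
  curved : ∀ j : Fin m, ∀ v : Vec d, ∀ c : Fin m → ℝ, (∀ j', |c j'| ≤ n * ‖v‖) →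
    n * ‖v‖ ^ 2 ≤ T * ∑ l ∈ Finset.univ \ bucket b j, (inner ℝ (w l) v - c (b l)) ^ 2
  norm_le : ∀ i, ‖w i‖ ≤ T * √d
  norm_bucket_le : ∀ j, ‖∑ l ∈ bucket b j, w l‖ ≤ T * √(d * (bucket b j).card)
  inner_bucket_le : ∀ j, |(inner ℝ (∑ l ∈ bucket b j, w l) e : ℝ)| ≤ T * √(bucket b j).card
  norm_sum_le : ‖(∑ i, (inner ℝ (w i) e : ℝ) • w i) - (n : ℝ) • e‖ ≤ T * √(d * n)
  erase_dir : ∀ i, |(inner ℝ (w i) (scatterInv b (Finset.univ.erase i) w e) : ℝ)|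
    ≤ T * ‖scatterInv b (Finset.univ.erase i) w e‖
  erase_dev : ∀ i, |(inner ℝ (w i) (scatterInv b (Finset.univ.erase i) w
      ((n : ℝ) • e - scatter b (Finset.univ.erase i) w e)) : ℝ)|
    ≤ T * ‖scatterInv b (Finset.univ.erase i) w
      ((n : ℝ) • e - scatter b (Finset.univ.erase i) w e)‖
  erase_pair : ∀ i i', i ≠ i' →
    |(inner ℝ (w i) (scatterInv b (Finset.univ.erase i) w (partialCentered b w i i')) : ℝ)|
      ≤ T * ‖scatterInv b (Finset.univ.erase i) w (partialCentered b w i i')‖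
  bucket_dir : ∀ j,
    |(inner ℝ (∑ l ∈ bucket b j, w l) (scatterInv b (Finset.univ \ bucket b j) w e) : ℝ)|
      ≤ T * √(bucket b j).card * ‖scatterInv b (Finset.univ \ bucket b j) w e‖
  bucket_pair : ∀ j i', i' ∉ bucket b j →
    |(inner ℝ (∑ l ∈ bucket b j, w l) (scatterInv b (Finset.univ \ bucket b j) w
        (centered b (Finset.univ \ bucket b j) w i')) : ℝ)|
      ≤ T * √(bucket b j).card * ‖scatterInv b (Finset.univ \ bucket b j) w
        (centered b (Finset.univ \ bucket b j) w i')‖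
  inside_bucket : ∀ i,
    |(inner ℝ (w i) (scatterInv b (Finset.univ \ bucket b (b i)) w
        (∑ l ∈ (bucket b (b i)).erase i, w l)) : ℝ)|
      ≤ T * ‖scatterInv b (Finset.univ \ bucket b (b i)) w (∑ l ∈ (bucket b (b i)).erase i, w l)‖

variable {b : Fin n → Fin m} {e : Vec d} {w : Fin n → Vec d} {T : ℝ}

lemma mem_bucket {i : Fin n} {j : Fin m} : i ∈ bucket b j ↔ b i = j := by simp [bucket]

lemma card_bucket_le (j : Fin m) : ((bucket b j).card : ℝ) ≤ n := by
  exact_mod_cast (Finset.card_le_univ _).trans_eq (Fintype.card_fin n)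

lemma norm_center_le (A : Finset (Fin n)) {r : ℝ} (hr : 0 ≤ r) (h : ∀ i, ‖w i‖ ≤ r) (j : Fin m) :
    ‖center b A w j‖ ≤ r := by
  rw [center, norm_smul, norm_inv, Real.norm_natCast]
  rcases Nat.eq_zero_or_pos (A.filter fun i => b i = j).card with h0 | h0
  · simpa [h0] using hr
  · rw [inv_mul_le_iff₀ (by exact_mod_cast h0)]
    refine (norm_sum_le _ _).trans ((Finset.sum_le_sum fun i _ => h i).trans ?_)
    simp

/-- Standing assumptions on the sizes. -/
structure Sizes (T : ℝ) (n d m : ℕ) (b : Fin n → Fin m) : Prop where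
  four_le : 4 ≤ T
  one_le_d : 1 ≤ d
  d_le : (d : ℝ) * T ^ 20 ≤ n
  bucket_ge : ∀ j, T ^ 20 * √d ≤ (bucket b j).card

namespace Sizes

variable (hs : Sizes T n d m b)
include hs

lemma T_pos : 0 < T := by linarith [hs.four_le]

lemma one_le_pow (k : ℕ) : 1 ≤ T ^ k := one_le_pow₀ (by linarith [hs.four_le])

lemma one_le_d' : (1 : ℝ) ≤ d := by exact_mod_cast hs.one_le_d

lemma one_le_sqrt : 1 ≤ √(d : ℝ) := by rw [Real.one_le_sqrt]; exact hs.one_le_d'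

lemma sqrt_le : √(d : ℝ) ≤ d := by
  rw [Real.sqrt_le_left (by positivity)]; nlinarith [hs.one_le_d']

lemma n_pos : (0 : ℝ) < n :=
  lt_of_lt_of_le (mul_pos (by linarith [hs.one_le_d']) (by linarith [hs.one_le_pow 20])) hs.d_le

lemma d_le_n : (d : ℝ) ≤ n :=
  le_trans (le_mul_of_one_le_right (by positivity) (hs.one_le_pow 20)) hs.d_le

lemma bucket_ge' (j : Fin m) : T ^ 20 ≤ (bucket b j).card :=
  le_trans (le_mul_of_one_le_right (by linarith [hs.one_le_pow 20]) hs.one_le_sqrt)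
    (hs.bucket_ge j)

lemma sqrt_le_bucket (j : Fin m) : √(d : ℝ) ≤ (bucket b j).card :=
  le_trans (le_mul_of_one_le_left (by positivity) (hs.one_le_pow 20)) (hs.bucket_ge j)

lemma bucket_pos (j : Fin m) : (0 : ℝ) < (bucket b j).card := by
  linarith [hs.bucket_ge' j, hs.one_le_pow 20]

lemma two_le_bucket (j : Fin m) : 2 ≤ (bucket b j).card := by
  have h1 : (4 : ℝ) ≤ (bucket b j).card := by
    have := hs.bucket_ge' j
    have h2 : T ^ 1 ≤ T ^ 20 := pow_le_pow_right₀ (by linarith [hs.four_le]) (by norm_num)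
    rw [pow_one] at h2
    linarith [hs.four_le]
  have : 4 ≤ (bucket b j).card := by exact_mod_cast h1
  omega

lemma ratio_le (j : Fin m) :
    ((bucket b j).card : ℝ) / ((bucket b j).card - 1) ≤ 2 ∧
      0 ≤ ((bucket b j).card : ℝ) / ((bucket b j).card - 1) := by
  have : (2 : ℝ) ≤ (bucket b j).card := by exact_mod_cast hs.two_le_bucket j
  constructor
  · rw [div_le_iff₀ (by linarith)]; linarith
  · exact div_nonneg (by linarith) (by linarith)

/-- The ratio `√(d/n)` is small. -/
lemma sqrt_ratio_le : √((d : ℝ) / n) * T ^ 10 ≤ 1 := by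
  have h := hs.n_pos
  have h1 : √((d : ℝ) / n) ≤ √(1 / (T ^ 10) ^ 2) := by
    apply Real.sqrt_le_sqrt
    rw [div_le_div_iff₀ h (by have := hs.T_pos; positivity)]
    have := hs.d_le
    nlinarith
  rw [Real.sqrt_div zero_le_one, Real.sqrt_one, Real.sqrt_sq (by have := hs.T_pos; positivity),
    le_div_iff₀ (by have := hs.T_pos; positivity)] at h1
  exact h1

lemma sqrt_mul_n : √((d : ℝ) * n) = √((d : ℝ) / n) * n := by
  have h := hs.n_pos
  rw [show (d : ℝ) * n = (d / n) * n ^ 2 by field_simp, Real.sqrt_mul (by positivity),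
    Real.sqrt_sq h.le]

lemma d_le_sqrt_ratio : (d : ℝ) ≤ √((d : ℝ) / n) * n := by
  rw [← hs.sqrt_mul_n]
  apply Real.le_sqrt_of_sq_le
  nlinarith [hs.d_le_n, hs.one_le_d']

lemma T_sqrt_le : T * √(d : ℝ) ≤ n := by
  have h1 : T ^ 1 ≤ T ^ 20 := pow_le_pow_right₀ (by linarith [hs.four_le]) (by norm_num)
  rw [pow_one] at h1
  calc T * √(d : ℝ) ≤ T ^ 20 * d := mul_le_mul h1 hs.sqrt_le (by positivity)
        (by linarith [hs.one_le_pow 20])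
    _ ≤ n := by rw [mul_comm]; exact hs.d_le

end Sizes

variable (hs : Sizes T n d m b) (hr : Regular T b e w)
include hs hr

namespace Regular

/-- `curved` allows arbitrary offsets, so the random means, taken with respect to any `A`, may be
inserted. One hypothesis thereby covers the full sample and the samples with one index or one bucket
deleted. -/
lemma lower {A : Finset (Fin n)} {j : Fin m} (hA : Finset.univ \ bucket b j ⊆ A) (v : Vec d) :
    (n / T) * ‖v‖ ^ 2 ≤ ∑ l ∈ A, (inner ℝ (centered b A w l) v : ℝ) ^ 2 := by
  have hT := hs.T_pos
  have h := hr.curved j v (fun j' => inner ℝ (center b A w j') v) (fun j' => by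
    refine (abs_real_inner_le_norm _ _).trans ?_
    gcongr
    exact (norm_center_le A (by positivity) hr.norm_le j').trans hs.T_sqrt_le)
  have h2 : ∑ l ∈ Finset.univ \ bucket b j, (inner ℝ (w l) v - inner ℝ (center b A w (b l)) v) ^ 2
      ≤ ∑ l ∈ A, (inner ℝ (centered b A w l) v : ℝ) ^ 2 := by
    simp only [← inner_sub_left]
    exact Finset.sum_le_sum_of_subset_of_nonneg hA fun _ _ _ => sq_nonneg _
  rw [div_mul_eq_mul_div, div_le_iff₀ hT, mul_comm _ T]
  exact h.trans (by gcongr)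

omit hr in
lemma lower_pos : 0 < (n : ℝ) / T := div_pos hs.n_pos hs.T_pos

omit hs hr in
lemma sdiff_subset_erase (i : Fin n) :
    Finset.univ \ bucket b (b i) ⊆ Finset.univ.erase i := by
  intro l hl
  simp only [Finset.mem_sdiff, Finset.mem_univ, true_and, Finset.mem_erase, and_true,
    mem_bucket] at hl ⊢
  exact fun h => hl (h ▸ rfl)

lemma norm_inv_le {A : Finset (Fin n)} {j : Fin m} (hA : Finset.univ \ bucket b j ⊆ A) (v : Vec d) :
    ‖scatterInv b A w v‖ ≤ T * ‖v‖ / n := by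
  refine (norm_scatterInv_le (lower_pos hs) (hr.lower hs hA) v).trans_eq ?_
  rw [div_div_eq_mul_div, mul_comm]

/-- The coefficient of the centred feature `i` in the whitened direction `v`. -/
abbrev coeff (b : Fin n → Fin m) (w : Fin n → Vec d) (v : Vec d) (i : Fin n) : ℝ :=
  inner ℝ (centered b Finset.univ w i) (scatterInv b Finset.univ w v)

/-- Apply the inverse of the reduced scatter matrix to the rank one update evaluated at S⁻¹v. For a
fixed `v`, the leading term pairs `w i` with a vector that does not involve `w i`. -/
lemma inner_inv_eq_erase (v : Vec d) (i : Fin n) :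
    inner ℝ (w i) (scatterInv b Finset.univ w v)
      = inner ℝ (w i) (scatterInv b (Finset.univ.erase i) w v)
        - ((bucket b (b i)).card : ℝ) / ((bucket b (b i)).card - 1) * coeff b w v i
          * inner ℝ (w i) (scatterInv b (Finset.univ.erase i) w (centered b Finset.univ w i)) := by
  have h1 := scatterInv_scatter (lower_pos hs) (hr.lower hs (sdiff_subset_erase i))
    (scatterInv b Finset.univ w v)
  have h2 := scatter_univ_eq_erase (w := w) i (hs.two_le_bucket (b i)) (scatterInv b Finset.univ w v)
  rw [scatter_scatterInv (lower_pos hs)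
    (hr.lower hs (j := b i) (Finset.subset_univ _))] at h2
  rw [← h1, eq_sub_of_add_eq h2.symm, map_sub, map_smul, inner_sub_right, real_inner_smul_right]

/-- The same resolvent identity with a whole bucket deleted. It serves for the bucket mean, which is
independent of what remains. -/
lemma inner_inv_eq_sdiff (v x : Vec d) (j : Fin m) :
    inner ℝ x (scatterInv b Finset.univ w v)
      = inner ℝ x (scatterInv b (Finset.univ \ bucket b j) w v)
        - ∑ l ∈ bucket b j, coeff b w v l
          * inner ℝ x (scatterInv b (Finset.univ \ bucket b j) w (centered b Finset.univ w l)) := by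
  have h1 := scatterInv_scatter (lower_pos hs) (hr.lower hs (j := j) subset_rfl)
    (scatterInv b Finset.univ w v)
  have h2 := scatter_univ_eq_sdiff (b := b) (w := w) j (scatterInv b Finset.univ w v)
  rw [scatter_scatterInv (lower_pos hs)
    (hr.lower hs (j := j) (Finset.subset_univ _))] at h2
  rw [← h1, eq_sub_of_add_eq h2.symm, map_sub, map_sum, inner_sub_right, inner_sum]
  simp only [map_smul, real_inner_smul_right]

lemma norm_centered_le (i : Fin n) : ‖centered b Finset.univ w i‖ ≤ 2 * T * √d := by
  have hT := hs.T_pos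
  calc ‖centered b Finset.univ w i‖ ≤ ‖w i‖ + ‖center b Finset.univ w (b i)‖ := norm_sub_le _ _
    _ ≤ T * √d + T * √d := add_le_add (hr.norm_le i)
        (norm_center_le _ (by positivity) hr.norm_le _)
    _ = _ := by ring

/-- The leave-one-bucket-out bound. -/
lemma bucket_inner_le (l : Fin n) :
    |(inner ℝ (∑ i ∈ bucket b (b l), w i)
        (scatterInv b (Finset.univ \ bucket b (b l)) w (centered b Finset.univ w l)) : ℝ)|
      ≤ 2 * T ^ 3 * (√(d * (bucket b (b l)).card) + d) / n := by
  have hT := hs.T_pos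
  have hn := hs.n_pos
  have hN := hs.bucket_pos (b l)
  set N : ℝ := ((bucket b (b l)).card : ℝ) with hNdef
  set S := ∑ i ∈ bucket b (b l), w i with hS
  set P := scatterInv b (Finset.univ \ bucket b (b l)) w with hP
  have hl : l ∈ bucket b (b l) := mem_bucket.2 rfl
  have hcen : centered b Finset.univ w l = w l - N⁻¹ • S := rfl
  -- Of S = S' + w_l only S' can be paired with w_l through independence, giving √(dN)/n where
  -- Cauchy–Schwarz would give d√N/n. The pairings of w_l with itself and of S with itself, the
  -- latter divided by N, cost d/n by norms alone.
  have hSplit : S = ∑ i ∈ (bucket b (b l)).erase l, w i + w l := (Finset.sum_erase_add _ _ hl).symm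
  set S' := ∑ i ∈ (bucket b (b l)).erase l, w i with hS'
  have hcomm : ∀ x y, inner ℝ x (P y) = (inner ℝ (P x) y : ℝ) :=
    inner_scatterInv_comm (lower_pos hs) (hr.lower hs (j := b l) subset_rfl)
  have hPn : ∀ x, ‖P x‖ ≤ T * ‖x‖ / n := hr.norm_inv_le hs (j := b l) subset_rfl
  have hSn : ‖S‖ ≤ T * √(d * N) := hr.norm_bucket_le (b l)
  have hd := hs.one_le_d'
  have hdN : √(d : ℝ) ≤ √(d * N) := by
    apply Real.sqrt_le_sqrt
    have : (1 : ℝ) ≤ N := by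
      have : (2 : ℝ) ≤ N := Nat.ofNat_le_cast.2 (hs.two_le_bucket (b l))
      linarith
    nlinarith
  have hS'n : ‖S'‖ ≤ 2 * T * √(d * N) := by
    have : S' = S - w l := by rw [hSplit]; abel
    rw [this]
    refine (norm_sub_le _ _).trans ?_
    have := hr.norm_le l
    nlinarith
  have h1 : |(inner ℝ S' (P (w l)) : ℝ)| ≤ T * (T * (2 * T * √(d * N)) / n) := by
    rw [hcomm, real_inner_comm]
    refine (hr.inside_bucket l).trans ?_
    gcongr
    exact (hPn S').trans (by gcongr)
  have h2 : |(inner ℝ (w l) (P (w l)) : ℝ)| ≤ (T * √d) * (T * (T * √d) / n) := by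
    refine (abs_real_inner_le_norm _ _).trans ?_
    have := hr.norm_le l
    gcongr
    exact (hPn _).trans (by gcongr)
  have h3 : |(inner ℝ S (P S) : ℝ)| ≤ (T * √(d * N)) * (T * (T * √(d * N)) / n) := by
    refine (abs_real_inner_le_norm _ _).trans ?_
    gcongr
    exact (hPn _).trans (by gcongr)
  have hexp : (inner ℝ S (P (centered b Finset.univ w l)) : ℝ)
      = inner ℝ S' (P (w l)) + inner ℝ (w l) (P (w l)) - N⁻¹ * inner ℝ S (P S) := by
    rw [hcen, map_sub, map_smul, inner_sub_right, real_inner_smul_right]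
    conv_lhs => rw [show (inner ℝ S (P (w l)) : ℝ) = inner ℝ (S' + w l) (P (w l)) by rw [← hSplit]]
    rw [inner_add_left]
  rw [hexp]
  have hsq : √(d * N) * √(d * N) = d * N := Real.mul_self_sqrt (by positivity)
  have hsq2 : √(d : ℝ) * √d = d := Real.mul_self_sqrt (by positivity)
  have h3' : |N⁻¹ * (inner ℝ S (P S) : ℝ)| ≤ T ^ 3 * d / n := by
    rw [abs_mul, abs_of_pos (inv_pos.2 hN), inv_mul_le_iff₀ hN]
    refine h3.trans_eq ?_
    rw [show T * √(d * N) * (T * (T * √(d * N)) / n) = T ^ 3 * (√(d * N) * √(d * N)) / n by ring, hsq]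
    ring
  have h2' : |(inner ℝ (w l) (P (w l)) : ℝ)| ≤ T ^ 3 * d / n := by
    refine h2.trans_eq ?_
    rw [show T * √d * (T * (T * √d) / n) = T ^ 3 * (√(d : ℝ) * √d) / n by ring, hsq2]
  calc _ ≤ |(inner ℝ S' (P (w l)) : ℝ)| + |(inner ℝ (w l) (P (w l)) : ℝ)|
        + |N⁻¹ * (inner ℝ S (P S) : ℝ)| := (abs_sub _ _).trans (by gcongr; exact abs_add_le _ _)
    _ ≤ _ := by
      have : T * (T * (2 * T * √(d * N)) / n) + T ^ 3 * d / n + T ^ 3 * d / n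
        = 2 * T ^ 3 * (√(d * N) + d) / n := by ring
      linarith

/-- The leave-one-out expansion of the coefficients. -/
lemma abs_coeff_sub_le (v : Vec d) (i : Fin n) :
    |coeff b w v i - inner ℝ (w i) (scatterInv b (Finset.univ.erase i) w v)|
      ≤ 4 * T ^ 3 * (d / n) * |coeff b w v i|
        + ((bucket b (b i)).card : ℝ)⁻¹ * |(inner ℝ (∑ l ∈ bucket b (b i), w l)
            (scatterInv b (Finset.univ \ bucket b (b i)) w v) : ℝ)|
        + ((bucket b (b i)).card : ℝ)⁻¹ * ∑ l ∈ bucket b (b i), |coeff b w v l|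
            * (2 * T ^ 3 * (√(d * (bucket b (b i)).card) + d) / n) := by
  have hT := hs.T_pos
  have hn := hs.n_pos
  have hN := hs.bucket_pos (b i)
  have e1 : coeff b w v i = inner ℝ (w i) (scatterInv b Finset.univ w v)
      - ((bucket b (b i)).card : ℝ)⁻¹
        * inner ℝ (∑ l ∈ bucket b (b i), w l) (scatterInv b Finset.univ w v) := by
    change inner ℝ (w i - ((bucket b (b i)).card : ℝ)⁻¹ • ∑ l ∈ bucket b (b i), w l) _ = _
    rw [inner_sub_left, real_inner_smul_left]
  have e2 := hr.inner_inv_eq_erase hs v i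
  have e3 := hr.inner_inv_eq_sdiff hs v (∑ l ∈ bucket b (b i), w l) (b i)
  have ha := hs.ratio_le (b i)
  set N : ℝ := ((bucket b (b i)).card : ℝ)
  set a : ℝ := N / (N - 1)
  set S := ∑ l ∈ bucket b (b i), w l
  have h1 : |(inner ℝ (w i) (scatterInv b (Finset.univ.erase i) w (centered b Finset.univ w i)) : ℝ)|
      ≤ 2 * T ^ 3 * (d / n) := by
    refine (abs_real_inner_le_norm _ _).trans ?_
    have hsq2 : √(d : ℝ) * √d = d := Real.mul_self_sqrt (by positivity)
    calc ‖w i‖ * ‖scatterInv b (Finset.univ.erase i) w (centered b Finset.univ w i)‖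
        ≤ (T * √d) * (T * (2 * T * √d) / n) := by
          have := hr.norm_le i
          gcongr
          refine (hr.norm_inv_le hs (sdiff_subset_erase i) _).trans ?_
          have := hr.norm_centered_le hs i
          gcongr
      _ = 2 * T ^ 3 * ((√(d : ℝ) * √d) / n) := by ring
      _ = _ := by rw [hsq2]
  have h2 : |∑ l ∈ bucket b (b i), coeff b w v l
        * (inner ℝ S (scatterInv b (Finset.univ \ bucket b (b i)) w (centered b Finset.univ w l)) : ℝ)|
      ≤ ∑ l ∈ bucket b (b i), |coeff b w v l| * (2 * T ^ 3 * (√(d * N) + d) / n) := by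
    refine (Finset.abs_sum_le_sum_abs _ _).trans (Finset.sum_le_sum fun l hl => ?_)
    rw [abs_mul]
    gcongr
    have := hr.bucket_inner_le hs l
    rwa [mem_bucket.1 hl] at this
  -- The centred feature is w_i minus the bucket mean. The first part is expanded by deleting i, the
  -- second by deleting the bucket.
  have key : coeff b w v i - inner ℝ (w i) (scatterInv b (Finset.univ.erase i) w v)
      = -(a * inner ℝ (w i) (scatterInv b (Finset.univ.erase i) w (centered b Finset.univ w i))
          * coeff b w v i)
        - N⁻¹ * inner ℝ S (scatterInv b (Finset.univ \ bucket b (b i)) w v)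
        + N⁻¹ * ∑ l ∈ bucket b (b i), coeff b w v l
        * inner ℝ S (scatterInv b (Finset.univ \ bucket b (b i)) w (centered b Finset.univ w l)) := by
    rw [e3] at e1
    linear_combination e1 + e2
  rw [key]
  refine (abs_add_le _ _).trans (add_le_add ((abs_sub _ _).trans (add_le_add ?_ ?_)) ?_)
  · rw [abs_neg, abs_mul, abs_mul, abs_of_nonneg ha.2]
    have : a * |(inner ℝ (w i) (scatterInv b (Finset.univ.erase i) w
        (centered b Finset.univ w i)) : ℝ)| ≤ 2 * (2 * T ^ 3 * (d / n)) := by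
      have h2 := ha.1
      gcongr
    calc _ ≤ 2 * (2 * T ^ 3 * (d / n)) * |coeff b w v i| := by gcongr
      _ = _ := by ring
  · rw [abs_mul, abs_of_pos (inv_pos.2 hN)]
  · rw [abs_mul, abs_of_pos (inv_pos.2 hN)]
    exact mul_le_mul_of_nonneg_left h2 (inv_pos.2 hN).le

end Regular
end Regular

/-! ### Self-consistent bounds for projections and Gram entries. -/

section RegularBounds

variable {n d m : ℕ} {b : Fin n → Fin m} {e : Vec d} {w : Fin n → Vec d} {T : ℝ}

namespace Sizes

variable (hs : Sizes T n d m b)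
include hs

lemma bucket_mass_le (j : Fin m) :
    (√(d * (bucket b j).card) + d) / n ≤ 2 * √((d : ℝ) / n) := by
  rw [div_le_iff₀ hs.n_pos]
  have h1 : √((d : ℝ) * (bucket b j).card) ≤ √((d : ℝ) * n) := by
    apply Real.sqrt_le_sqrt
    have := card_bucket_le (b := b) j
    gcongr
  rw [hs.sqrt_mul_n] at h1
  linarith [hs.d_le_sqrt_ratio]

lemma bucket_mass_le' (j : Fin m) :
    ((bucket b j).card : ℝ)⁻¹ * ((√(d * (bucket b j).card) + d) / n) ≤ 2 * √(d : ℝ) / n := by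
  have hN := hs.bucket_pos j
  rw [inv_mul_le_iff₀ hN, mul_div_assoc', div_le_div_iff_of_pos_right hs.n_pos]
  have hN1 : (1 : ℝ) ≤ (bucket b j).card := by exact_mod_cast (by linarith [hs.two_le_bucket j])
  have h1 : √((d : ℝ) * (bucket b j).card) ≤ √(d : ℝ) * (bucket b j).card := by
    rw [Real.sqrt_mul (by positivity)]
    gcongr
    rw [Real.sqrt_le_left (by positivity)]
    nlinarith
  have h2 : (d : ℝ) ≤ √(d : ℝ) * (bucket b j).card := by
    calc (d : ℝ) = √(d : ℝ) * √d := (Real.mul_self_sqrt (by positivity)).symm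
      _ ≤ _ := by gcongr; exact hs.sqrt_le_bucket j
  linarith

/-- The contraction constant: error terms proportional to the largest coefficient can be moved to
the left side at the cost of a factor 2. -/
lemma cube_ratio_le : 8 * T ^ 3 * √((d : ℝ) / n) ≤ 1 / 2 := by
  have hT := hs.T_pos
  have h := hs.sqrt_ratio_le
  have h7 : (4 : ℝ) ^ 7 ≤ T ^ 7 := pow_le_pow_left₀ (by norm_num) hs.four_le 7
  have h2 : T ^ 3 * √((d : ℝ) / n) * T ^ 7 ≤ 1 := by
    calc _ = √((d : ℝ) / n) * T ^ 10 := by ring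
      _ ≤ 1 := h
  have h3 : 0 ≤ T ^ 3 * √((d : ℝ) / n) := by positivity
  nlinarith

lemma ratio_le_sqrt : (d : ℝ) / n ≤ √((d : ℝ) / n) := by
  apply Real.le_sqrt_of_sq_le
  have : (d : ℝ) / n ≤ 1 := by rw [div_le_one hs.n_pos]; exact hs.d_le_n
  have : 0 ≤ (d : ℝ) / n := by positivity
  nlinarith

lemma inv_mul_sqrt_le (j : Fin m) :
    ((bucket b j).card : ℝ)⁻¹ * √(bucket b j).card * T ^ 10 ≤ 1 := by
  have hT := hs.T_pos
  have hN := hs.bucket_pos j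
  have h1 : T ^ 10 ≤ √((bucket b j).card : ℝ) := by
    apply Real.le_sqrt_of_sq_le
    calc (T ^ 10) ^ 2 = T ^ 20 := by ring
      _ ≤ _ := hs.bucket_ge' j
  calc _ ≤ ((bucket b j).card : ℝ)⁻¹ * √(bucket b j).card * √((bucket b j).card : ℝ) := by gcongr
    _ = ((bucket b j).card : ℝ)⁻¹ * (√(bucket b j).card * √((bucket b j).card : ℝ)) := by ring
    _ = 1 := by rw [Real.mul_self_sqrt hN.le, inv_mul_cancel₀ hN.ne']

end Sizes

namespace Regular

variable (hs : Sizes T n d m b) (hr : Regular T b e w)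
include hs hr

lemma abs_coeff_diag_le (i : Fin n) :
    |coeff b w (centered b Finset.univ w i) i| ≤ 4 * T ^ 3 * (d / n) := by
  have hT := hs.T_pos
  refine (abs_real_inner_le_norm _ _).trans ?_
  have h1 := hr.norm_centered_le hs i
  have hsq2 : √(d : ℝ) * √d = d := Real.mul_self_sqrt (by positivity)
  calc _ ≤ (2 * T * √d) * (T * (2 * T * √d) / n) := by
        gcongr
        refine (hr.norm_inv_le hs (j := b i) (Finset.subset_univ _) _).trans ?_
        gcongr
    _ = 4 * T ^ 3 * ((√(d : ℝ) * √d) / n) := by ring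
    _ = _ := by rw [hsq2]

/-- A uniform bound `z` turns the leave-one-out expansion into a bucket term plus a small multiple
of `z`, so it can be used both for absorption and for refining a bound already known. -/
lemma abs_coeff_sub_le_of_bound (v : Vec d) {z : ℝ} (hz : ∀ l, |coeff b w v l| ≤ z) (i : Fin n) :
    |coeff b w v i - inner ℝ (w i) (scatterInv b (Finset.univ.erase i) w v)|
      ≤ ((bucket b (b i)).card : ℝ)⁻¹ * |(inner ℝ (∑ l ∈ bucket b (b i), w l)
            (scatterInv b (Finset.univ \ bucket b (b i)) w v) : ℝ)|
        + 8 * T ^ 3 * √((d : ℝ) / n) * z := by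
  have hT := hs.T_pos
  have hN := hs.bucket_pos (b i)
  have hz0 : 0 ≤ z := (abs_nonneg _).trans (hz i)
  have h1 := hr.abs_coeff_sub_le hs v i
  have h2 : 4 * T ^ 3 * (d / n) * |coeff b w v i| ≤ 4 * T ^ 3 * √((d : ℝ) / n) * z := by
    have := hz i
    have := hs.ratio_le_sqrt
    gcongr
  have h3 : ((bucket b (b i)).card : ℝ)⁻¹ * ∑ l ∈ bucket b (b i), |coeff b w v l|
            * (2 * T ^ 3 * (√(d * (bucket b (b i)).card) + d) / n)
      ≤ 4 * T ^ 3 * √((d : ℝ) / n) * z := by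
    rw [inv_mul_le_iff₀ hN]
    have h4 := hs.bucket_mass_le (b i)
    calc _ ≤ ∑ l ∈ bucket b (b i), z * (2 * T ^ 3 * (2 * √((d : ℝ) / n))) := by
          refine Finset.sum_le_sum fun l _ => ?_
          rw [mul_div_assoc]
          have := hz l
          gcongr
      _ = _ := by rw [Finset.sum_const, nsmul_eq_mul]; ring
  linarith

/-- At an index where the coefficient is largest, the expansion reads z ≤ T²/n + T²/n + z/2. -/
lemma abs_coeff_dir_le (he : ‖e‖ = 1) (i : Fin n) : |coeff b w e i| ≤ 4 * T ^ 2 / n := by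
  have hT := hs.T_pos
  have hn := hs.n_pos
  obtain ⟨i₀, -, hi₀⟩ := Finset.exists_max_image Finset.univ (fun l => |coeff b w e l|)
    ⟨i, Finset.mem_univ i⟩
  set z := |coeff b w e i₀| with hz
  have hmax : ∀ l, |coeff b w e l| ≤ z := fun l => hi₀ l (Finset.mem_univ l)
  have h1 := hr.abs_coeff_sub_le_of_bound hs e hmax i₀
  have hN := hs.bucket_pos (b i₀)
  have h2 : |(inner ℝ (w i₀) (scatterInv b (Finset.univ.erase i₀) w e) : ℝ)| ≤ T ^ 2 / n := by
    refine (hr.erase_dir i₀).trans ?_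
    have := hr.norm_inv_le hs (sdiff_subset_erase i₀) e
    rw [he] at this
    calc _ ≤ T * (T * 1 / n) := by gcongr
      _ = _ := by ring
  have h3 : ((bucket b (b i₀)).card : ℝ)⁻¹ * |(inner ℝ (∑ l ∈ bucket b (b i₀), w l)
            (scatterInv b (Finset.univ \ bucket b (b i₀)) w e) : ℝ)| ≤ T ^ 2 / n := by
    have := hr.norm_inv_le hs (j := b i₀) subset_rfl e
    rw [he] at this
    have h5 := hs.inv_mul_sqrt_le (b i₀)
    have h6 := hs.one_le_pow 10
    have h7 : ((bucket b (b i₀)).card : ℝ)⁻¹ * √(bucket b (b i₀)).card ≤ 1 := by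
      refine le_trans (le_mul_of_one_le_right (by positivity) h6) h5
    calc _ ≤ ((bucket b (b i₀)).card : ℝ)⁻¹ * (T * √(bucket b (b i₀)).card * (T * 1 / n)) := by
          refine mul_le_mul_of_nonneg_left ((hr.bucket_dir (b i₀)).trans ?_) (by positivity)
          gcongr
      _ = (((bucket b (b i₀)).card : ℝ)⁻¹ * √(bucket b (b i₀)).card) * (T ^ 2 / n) := by ring
      _ ≤ 1 * (T ^ 2 / n) := by gcongr
      _ = _ := one_mul _
  have h4 := hs.cube_ratio_le
  have hz0 : 0 ≤ z := abs_nonneg _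
  have h5 : 8 * T ^ 3 * √((d : ℝ) / n) * z ≤ 1 / 2 * z := by gcongr
  have h6 : z ≤ |coeff b w e i₀ - inner ℝ (w i₀) (scatterInv b (Finset.univ.erase i₀) w e)|
      + |(inner ℝ (w i₀) (scatterInv b (Finset.univ.erase i₀) w e) : ℝ)| := by
    have := abs_add_le (coeff b w e i₀ - inner ℝ (w i₀) (scatterInv b (Finset.univ.erase i₀) w e))
      (inner ℝ (w i₀) (scatterInv b (Finset.univ.erase i₀) w e))
    rwa [sub_add_cancel] at this
  refine (hmax i).trans ?_
  have : 4 * T ^ 2 / n = 4 * (T ^ 2 / n) := by ring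
  rw [this]
  linarith

/-- Three sources of error: fluctuation of the uncentred second moment, one rank one correction for
each of the m bucket means, and the deleted sample. -/
lemma norm_dev_le (i : Fin n) :
    ‖(n : ℝ) • e - scatter b (Finset.univ.erase i) w e‖
      ≤ T * √(d * n) + m * (T ^ 2 * √d) + 8 * T ^ 2 * d * ‖e‖ := by
  have hT := hs.T_pos
  have hn := hs.n_pos
  have e1 := scatter_univ_eq_erase (w := w) i (hs.two_le_bucket (b i)) e
  have ha := hs.ratio_le (b i)
  have e2 : scatter b Finset.univ w e = ∑ l, (inner ℝ (w l) e : ℝ) • w l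
      - ∑ j, (((bucket b j).card : ℝ)⁻¹ * ∑ l ∈ bucket b j, (inner ℝ (w l) e : ℝ))
          • ∑ l ∈ bucket b j, w l := by
    rw [scatter_apply, ← Finset.sum_fiberwise Finset.univ b,
      ← Finset.sum_fiberwise Finset.univ b (fun l => (inner ℝ (w l) e : ℝ) • w l),
      ← Finset.sum_sub_distrib]
    exact Finset.sum_congr rfl fun j _ => scatter_bucket j e
  have h1 := hr.norm_sum_le
  have h2 : ‖∑ j, (((bucket b j).card : ℝ)⁻¹ * ∑ l ∈ bucket b j, (inner ℝ (w l) e : ℝ))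
          • ∑ l ∈ bucket b j, w l‖ ≤ m * (T ^ 2 * √d) := by
    refine (_root_.norm_sum_le _ _).trans ((Finset.sum_le_sum (g := fun _ => T ^ 2 * √(d : ℝ))
      fun j _ => ?_).trans_eq (by simp))
    have hN := hs.bucket_pos j
    have h3 := hr.norm_bucket_le j
    have h4 := hr.inner_bucket_le j
    rw [sum_inner] at h4
    rw [norm_smul, Real.norm_eq_abs, abs_mul, abs_of_pos (inv_pos.2 hN)]
    calc _ ≤ ((bucket b j).card : ℝ)⁻¹ * (T * √(bucket b j).card) * (T * √(d * (bucket b j).card)) := by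
          gcongr
      _ = T ^ 2 * √d * (((bucket b j).card : ℝ)⁻¹ * (√(bucket b j).card * √(bucket b j).card)) := by
          rw [Real.sqrt_mul (by positivity)]; ring
      _ = _ := by rw [Real.mul_self_sqrt hN.le, inv_mul_cancel₀ hN.ne', mul_one]
  have h5 : ‖(((bucket b (b i)).card : ℝ) / ((bucket b (b i)).card - 1)
          * (inner ℝ (centered b Finset.univ w i) e : ℝ)) • centered b Finset.univ w i‖
      ≤ 8 * T ^ 2 * d * ‖e‖ := by
    have h6 := hr.norm_centered_le hs i
    have hsq2 : √(d : ℝ) * √d = d := Real.mul_self_sqrt (by positivity)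
    rw [norm_smul, Real.norm_eq_abs, abs_mul, abs_of_nonneg ha.2]
    calc _ ≤ 2 * (‖centered b Finset.univ w i‖ * ‖e‖) * ‖centered b Finset.univ w i‖ := by
          have := abs_real_inner_le_norm (centered b Finset.univ w i) e
          have := ha.1
          gcongr
      _ ≤ 2 * ((2 * T * √d) * ‖e‖) * (2 * T * √d) := by gcongr
      _ = 8 * T ^ 2 * (√(d : ℝ) * √d) * ‖e‖ := by ring
      _ = _ := by rw [hsq2]
  have e3 : (n : ℝ) • e - scatter b (Finset.univ.erase i) w e
      = -((∑ l, (inner ℝ (w l) e : ℝ) • w l) - (n : ℝ) • e)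
        + (∑ j, (((bucket b j).card : ℝ)⁻¹ * ∑ l ∈ bucket b j, (inner ℝ (w l) e : ℝ))
          • ∑ l ∈ bucket b j, w l)
        + (((bucket b (b i)).card : ℝ) / ((bucket b (b i)).card - 1)
          * (inner ℝ (centered b Finset.univ w i) e : ℝ)) • centered b Finset.univ w i := by
    rw [eq_sub_of_add_eq e1.symm, e2]; abel
  rw [e3]
  refine (norm_add₃_le).trans ?_
  rw [norm_neg]
  gcongr

omit hr in
lemma m_mul_le : (m : ℝ) * (T ^ 20 * √d) ≤ n := by
  have h : ∑ _j : Fin m, T ^ 20 * √(d : ℝ) ≤ ∑ j : Fin m, ((bucket b j).card : ℝ) :=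
    Finset.sum_le_sum fun j _ => hs.bucket_ge j
  have h2 : ∑ j : Fin m, (bucket b j).card = n := by
    have := Finset.card_eq_sum_card_fiberwise (f := b) (s := Finset.univ) (t := Finset.univ)
      (fun _ _ => Finset.mem_coe.2 (Finset.mem_univ _))
    rw [Finset.card_univ, Fintype.card_fin] at this
    exact this.symm
  rw [← Nat.cast_sum, h2] at h
  simpa using h

/-- The order bound T²/n, fed back into the expansion, makes all errors small. It remains to compare
n times the reduced inverse with the identity, in the direction `e`. -/
lemma abs_coeff_dir_sub_le (he : ‖e‖ = 1) (i : Fin n) :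
    |n * coeff b w e i - inner ℝ (w i) e| ≤ 1 / T := by
  have hT := hs.T_pos
  have h4 := hs.four_le
  have hn := hs.n_pos
  have h1 := hr.abs_coeff_sub_le_of_bound hs e (hr.abs_coeff_dir_le hs he) i
  have hρ := hs.sqrt_ratio_le
  set ρ := √((d : ℝ) / n) with hρdef
  have hρ' : ρ ≤ 1 / T ^ 10 := by rwa [le_div_iff₀ (by positivity)]
  have h2 : ((bucket b (b i)).card : ℝ)⁻¹ * |(inner ℝ (∑ l ∈ bucket b (b i), w l)
            (scatterInv b (Finset.univ \ bucket b (b i)) w e) : ℝ)| ≤ (1 / T ^ 10) * (T ^ 2 / n) := by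
    have := hr.norm_inv_le hs (j := b i) subset_rfl e
    rw [he] at this
    have h5 := hs.inv_mul_sqrt_le (b i)
    rw [← le_div_iff₀ (by positivity)] at h5
    have hN := hs.bucket_pos (b i)
    calc _ ≤ ((bucket b (b i)).card : ℝ)⁻¹ * (T * √(bucket b (b i)).card * (T * 1 / n)) := by
          refine mul_le_mul_of_nonneg_left ((hr.bucket_dir (b i)).trans ?_) (by positivity)
          gcongr
      _ = (((bucket b (b i)).card : ℝ)⁻¹ * √(bucket b (b i)).card) * (T ^ 2 / n) := by ring
      _ ≤ _ := by gcongr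
  have h3 : 8 * T ^ 3 * ρ * (4 * T ^ 2 / n) ≤ 8 * T ^ 3 * (1 / T ^ 10) * (4 * T ^ 2 / n) := by gcongr
  have hdev : ‖(n : ℝ) • e - scatter b (Finset.univ.erase i) w e‖ ≤ n * (2 / T ^ 9) := by
    refine (hr.norm_dev_le hs i).trans ?_
    rw [he, hs.sqrt_mul_n, ← hρdef]
    have a1 : T * (ρ * n) ≤ n * (1 / T ^ 9) := by
      calc T * (ρ * n) ≤ T * (1 / T ^ 10 * n) := by gcongr
        _ = _ := by field_simp
    have a2 : (m : ℝ) * (T ^ 2 * √d) ≤ n * (1 / T ^ 18) := by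
      rw [mul_one_div, le_div_iff₀ (by positivity)]
      calc _ = (m : ℝ) * (T ^ 20 * √d) := by ring
        _ ≤ n := m_mul_le hs
    have a3 : 8 * T ^ 2 * d * 1 ≤ n * (8 / T ^ 18) := by
      rw [mul_div_assoc', le_div_iff₀ (by positivity)]
      have := hs.d_le
      nlinarith
    have a4 : (1 : ℝ) / T ^ 18 + 8 / T ^ 18 ≤ 1 / T ^ 9 := by
      rw [← add_div, div_le_div_iff₀ (by positivity) (by positivity)]
      have : (4 : ℝ) ^ 9 ≤ T ^ 9 := pow_le_pow_left₀ (by norm_num) h4 9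
      have h6 : T ^ 18 = T ^ 9 * T ^ 9 := by ring
      rw [h6]
      nlinarith
    have a5 : n * (1 / T ^ 18) + n * (8 / T ^ 18) ≤ n * (1 / T ^ 9) := by
      rw [← mul_add]; gcongr
    have a6 : (n : ℝ) * (2 / T ^ 9) = n * (1 / T ^ 9) + n * (1 / T ^ 9) := by ring
    linarith
  have h5 : |n * (inner ℝ (w i) (scatterInv b (Finset.univ.erase i) w e) : ℝ) - inner ℝ (w i) e|
      ≤ T ^ 2 * (2 / T ^ 9) := by
    have h6 := scatterInv_scatter (lower_pos hs)
      (hr.lower hs (sdiff_subset_erase i)) e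
    -- n S⁻¹e - e = S⁻¹(ne - Se) for the reduced matrix S, a vector independent of w_i, so
    -- `erase_dev` avoids losing √d.
    have h7 : n * (inner ℝ (w i) (scatterInv b (Finset.univ.erase i) w e) : ℝ) - inner ℝ (w i) e
        = inner ℝ (w i) (scatterInv b (Finset.univ.erase i) w
            ((n : ℝ) • e - scatter b (Finset.univ.erase i) w e)) := by
      rw [map_sub, map_smul, h6, inner_sub_right, real_inner_smul_right]
    rw [h7]
    refine (hr.erase_dev i).trans ?_
    calc _ ≤ T * (T * (n * (2 / T ^ 9)) / n) := by
          gcongr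
          exact (hr.norm_inv_le hs (sdiff_subset_erase i) _).trans (by gcongr)
      _ = _ := by field_simp
  have h6 : |n * (coeff b w e i - inner ℝ (w i) (scatterInv b (Finset.univ.erase i) w e))|
      ≤ 33 / T ^ 5 := by
    rw [abs_mul, abs_of_pos hn]
    calc _ ≤ n * ((1 / T ^ 10) * (T ^ 2 / n) + 8 * T ^ 3 * (1 / T ^ 10) * (4 * T ^ 2 / n)) := by
          gcongr; linarith
      _ = 1 / T ^ 8 + 32 / T ^ 5 := by field_simp; ring
      _ ≤ 1 / T ^ 5 + 32 / T ^ 5 := by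
          gcongr
          · linarith
          · norm_num
      _ = _ := by ring
  have h7 : T ^ 2 * (2 / T ^ 9) ≤ 2 / T ^ 5 := by
    rw [mul_div_assoc', div_le_div_iff₀ (by positivity) (by positivity)]
    have : T ^ 2 * 2 * T ^ 5 = 2 * T ^ 7 := by ring
    rw [this]
    gcongr <;> linarith
  have h8 : n * coeff b w e i - inner ℝ (w i) e
      = n * (coeff b w e i - inner ℝ (w i) (scatterInv b (Finset.univ.erase i) w e))
        + (n * (inner ℝ (w i) (scatterInv b (Finset.univ.erase i) w e) : ℝ) - inner ℝ (w i) e) := by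
    ring
  rw [h8]
  refine (abs_add_le _ _).trans ((add_le_add h6 (h5.trans h7)).trans ?_)
  rw [← add_div, div_le_div_iff₀ (by positivity) hT]
  have : (4 : ℝ) ^ 4 ≤ T ^ 4 := pow_le_pow_left₀ (by norm_num) h4 4
  have h9 : T ^ 5 = T ^ 4 * T := by ring
  rw [h9]
  nlinarith

lemma norm_partialCentered_le (i i' : Fin n) : ‖partialCentered b w i i'‖ ≤ 2 * T * √d := by
  have hT := hs.T_pos
  have hN := hs.bucket_pos (b i')
  refine (norm_sub_le _ _).trans ?_
  have h1 : ‖((bucket b (b i')).card : ℝ)⁻¹ • ∑ l ∈ (bucket b (b i')).erase i, w l‖ ≤ T * √d := by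
    rw [norm_smul, norm_inv, Real.norm_natCast, inv_mul_le_iff₀ hN]
    refine (_root_.norm_sum_le _ _).trans ((Finset.sum_le_sum fun l _ => hr.norm_le l).trans ?_)
    rw [Finset.sum_const, nsmul_eq_mul]
    gcongr
    exact Finset.erase_subset _ _
  have := hr.norm_le i'
  linarith

/-- Maximise over off-diagonal pairs. With x = T³√d/n, the main term costs 3x, the bucket term 4x
and the diagonal contribution 4x; absorbing half of the maximum doubles 11 to 22. -/
lemma abs_coeff_offdiag_le {i i' : Fin n} (hne : i ≠ i') :
    |coeff b w (centered b Finset.univ w i') i| ≤ 22 * T ^ 3 * √d / n := by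
  classical
  have hT := hs.T_pos
  have hn := hs.n_pos
  obtain ⟨⟨i₀, i₁⟩, hi₀, hmax⟩ := Finset.exists_max_image
    (Finset.univ.filter fun p : Fin n × Fin n => p.1 ≠ p.2)
    (fun p => |coeff b w (centered b Finset.univ w p.2) p.1|) ⟨(i, i'), by simpa using hne⟩
  have hne₀ : i₀ ≠ i₁ := by simpa using hi₀
  set v := centered b Finset.univ w i₁ with hv
  set g := |coeff b w v i₀| with hg
  have hg' : ∀ l, l ≠ i₁ → |coeff b w v l| ≤ g := fun l hl =>
    hmax (l, i₁) (by simpa using hl)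
  have hN := hs.bucket_pos (b i₀)
  have hN1 : (1 : ℝ) ≤ (bucket b (b i₀)).card := by
    exact_mod_cast (by linarith [hs.two_le_bucket (b i₀)])
  have hdiag : |coeff b w v i₁| ≤ 1 := by
    refine (hr.abs_coeff_diag_le hs i₁).trans ?_
    have := hs.cube_ratio_le
    have h2 := hs.ratio_le_sqrt
    have : 4 * T ^ 3 * ((d : ℝ) / n) ≤ 4 * T ^ 3 * √((d : ℝ) / n) := by gcongr
    nlinarith [show 0 ≤ T ^ 3 * √((d : ℝ) / n) by positivity]
  have h1 := hr.abs_coeff_sub_le hs v i₀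
  have hvn : ‖v‖ ≤ 2 * T * √d := hr.norm_centered_le hs i₁

  have hmain : |(inner ℝ (w i₀) (scatterInv b (Finset.univ.erase i₀) w v) : ℝ)| ≤ 3 * (T ^ 3 * √d / n) := by
    have hq := hr.erase_pair i₀ i₁ hne₀
    have hq2 : T * ‖scatterInv b (Finset.univ.erase i₀) w (partialCentered b w i₀ i₁)‖
        ≤ 2 * (T ^ 3 * √d / n) := by
      calc _ ≤ T * (T * (2 * T * √d) / n) := by
            gcongr
            refine (hr.norm_inv_le hs (sdiff_subset_erase i₀) _).trans ?_
            have := hr.norm_partialCentered_le hs i₀ i₁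
            gcongr
        _ = _ := by ring
    by_cases hb : b i₁ = b i₀
    -- In a common bucket, the centred feature i₁ contains -w_{i₀}/N and is not independent of
    -- w_{i₀}. The split-off piece costs d/(nN), up to powers of T, which is at most √d/n because N
    -- ≥ √d.
    · have hdec : v = partialCentered b w i₀ i₁ - ((bucket b (b i₀)).card : ℝ)⁻¹ • w i₀ := by
        have hmem : i₀ ∈ bucket b (b i₁) := mem_bucket.2 hb.symm
        rw [hv, partialCentered, centered]
        change w i₁ - ((bucket b (b i₁)).card : ℝ)⁻¹ • ∑ l ∈ bucket b (b i₁), w l = _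
        rw [← Finset.add_sum_erase _ _ hmem, smul_add, hb]
        abel
      rw [hdec, map_sub, map_smul, inner_sub_right, real_inner_smul_right]
      have h5 : |((bucket b (b i₀)).card : ℝ)⁻¹ *
          (inner ℝ (w i₀) (scatterInv b (Finset.univ.erase i₀) w (w i₀)) : ℝ)| ≤ T ^ 3 * √d / n := by
        rw [abs_mul, abs_of_pos (inv_pos.2 hN), inv_mul_le_iff₀ hN]
        refine (abs_real_inner_le_norm _ _).trans ?_
        have h6 := hr.norm_le i₀
        calc _ ≤ (T * √d) * (T * (T * √d) / n) := by
              gcongr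
              exact (hr.norm_inv_le hs (sdiff_subset_erase i₀) _).trans (by gcongr)
          _ = √d * (T ^ 3 * √d / n) := by ring
          _ ≤ _ := by gcongr; exact hs.sqrt_le_bucket _
      refine (abs_sub _ _).trans ?_
      linarith
    · have hdec : v = partialCentered b w i₀ i₁ := by
        rw [hv, partialCentered, centered, Finset.erase_eq_of_notMem]
        · rfl
        · rw [mem_bucket]; exact fun h => hb h.symm
      rw [hdec]
      have : 0 ≤ T ^ 3 * √d / n := by positivity
      linarith

  have hbuck : ((bucket b (b i₀)).card : ℝ)⁻¹ * |(inner ℝ (∑ l ∈ bucket b (b i₀), w l)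
            (scatterInv b (Finset.univ \ bucket b (b i₀)) w v) : ℝ)| ≤ 4 * (T ^ 3 * √d / n) := by
    by_cases hb : b i₁ = b i₀
    · have h5 := hr.bucket_inner_le hs i₁
      rw [hb] at h5
      calc _ ≤ ((bucket b (b i₀)).card : ℝ)⁻¹
            * (2 * T ^ 3 * (√(d * (bucket b (b i₀)).card) + d) / n) := by gcongr
        _ = 2 * T ^ 3 * (((bucket b (b i₀)).card : ℝ)⁻¹
            * ((√(d * (bucket b (b i₀)).card) + d) / n)) := by ring
        _ ≤ 2 * T ^ 3 * (2 * √d / n) := by gcongr; exact hs.bucket_mass_le' _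
        _ = _ := by ring
    · have hnot : i₁ ∉ bucket b (b i₀) := by rwa [mem_bucket]
      have h5 := hr.bucket_pair (b i₀) i₁ hnot
      have hcv : centered b (Finset.univ \ bucket b (b i₀)) w i₁ = v := by
        refine centered_congr ?_ (fun _ _ => rfl) rfl
        ext l
        simp only [Finset.mem_filter, Finset.mem_sdiff, Finset.mem_univ, true_and, mem_bucket]
        exact ⟨fun h => h.2, fun h => ⟨fun h' => hb (by rw [← h, h']), h⟩⟩
      rw [hcv] at h5
      have hsq : √((bucket b (b i₀)).card : ℝ) ≤ (bucket b (b i₀)).card := by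
        rw [Real.sqrt_le_left (by positivity)]; nlinarith
      rw [inv_mul_le_iff₀ hN]
      calc _ ≤ T * (bucket b (b i₀)).card * (T * (2 * T * √d) / n) := by
            refine h5.trans ?_
            gcongr
            exact (hr.norm_inv_le hs (j := b i₀) subset_rfl _).trans (by gcongr)
        _ = 2 * ((bucket b (b i₀)).card * (T ^ 3 * √d / n)) := by ring
        _ ≤ _ := by
          have : 0 ≤ (bucket b (b i₀)).card * (T ^ 3 * √d / n) := by positivity
          linarith
  have hsum : ((bucket b (b i₀)).card : ℝ)⁻¹ * ∑ l ∈ bucket b (b i₀), |coeff b w v l|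
            * (2 * T ^ 3 * (√(d * (bucket b (b i₀)).card) + d) / n)
      ≤ 4 * T ^ 3 * √((d : ℝ) / n) * g + 4 * (T ^ 3 * √d / n) := by
    -- The maximum g controls off-diagonal coefficients only. The index l = i₁, present when the
    -- buckets coincide, is charged its bound 1 and contributes order √d/n, up to powers of T, after
    -- division by the bucket size.
    have hpt : ∀ l ∈ bucket b (b i₀), |coeff b w v l|
            * (2 * T ^ 3 * (√(d * (bucket b (b i₀)).card) + d) / n)
        ≤ g * (2 * T ^ 3 * (√(d * (bucket b (b i₀)).card) + d) / n)
          + if l = i₁ then 2 * T ^ 3 * (√(d * (bucket b (b i₀)).card) + d) / n else 0 := by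
      intro l _
      split_ifs with hl
      · rw [hl]
        calc _ ≤ 1 * (2 * T ^ 3 * (√(d * (bucket b (b i₀)).card) + d) / n) := by gcongr
          _ ≤ _ := by
            rw [one_mul]
            have : 0 ≤ g * (2 * T ^ 3 * (√(d * (bucket b (b i₀)).card) + d) / n) := by positivity
            linarith
      · rw [add_zero]
        have := hg' l hl
        gcongr
    have hX : (0 : ℝ) ≤ 2 * T ^ 3 * (√(d * (bucket b (b i₀)).card) + d) / n := by positivity
    have hif : ∑ l ∈ bucket b (b i₀), (if l = i₁ then
          2 * T ^ 3 * (√(d * (bucket b (b i₀)).card) + d) / n else 0)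
        ≤ 2 * T ^ 3 * (√(d * (bucket b (b i₀)).card) + d) / n := by
      rw [Finset.sum_ite_eq']
      split_ifs
      · exact le_rfl
      · exact hX
    have h8 := Finset.sum_le_sum hpt
    rw [Finset.sum_add_distrib, Finset.sum_const, nsmul_eq_mul] at h8
    have h9 := hs.bucket_mass_le (b i₀)
    have h10 := hs.bucket_mass_le' (b i₀)
    calc _ ≤ ((bucket b (b i₀)).card : ℝ)⁻¹
            * ((bucket b (b i₀)).card * (g * (2 * T ^ 3 * (√(d * (bucket b (b i₀)).card) + d) / n))
              + 2 * T ^ 3 * (√(d * (bucket b (b i₀)).card) + d) / n) := by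
          gcongr; linarith
      _ = 2 * T ^ 3 * ((√(d * (bucket b (b i₀)).card) + d) / n) * g
          + 2 * T ^ 3 * (((bucket b (b i₀)).card : ℝ)⁻¹
            * ((√(d * (bucket b (b i₀)).card) + d) / n)) := by
          field_simp
      _ ≤ 2 * T ^ 3 * (2 * √((d : ℝ) / n)) * g + 2 * T ^ 3 * (2 * √d / n) := by gcongr
      _ = _ := by ring
  have h2 : 4 * T ^ 3 * (d / n) * |coeff b w v i₀| ≤ 4 * T ^ 3 * √((d : ℝ) / n) * g := by
    have := hs.ratio_le_sqrt
    gcongr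
  have h4 := hs.cube_ratio_le
  have h5 : 8 * T ^ 3 * √((d : ℝ) / n) * g ≤ 1 / 2 * g := by gcongr
  have h6 : g ≤ |coeff b w v i₀ - inner ℝ (w i₀) (scatterInv b (Finset.univ.erase i₀) w v)|
      + |(inner ℝ (w i₀) (scatterInv b (Finset.univ.erase i₀) w v) : ℝ)| := by
    have := abs_add_le (coeff b w v i₀ - inner ℝ (w i₀) (scatterInv b (Finset.univ.erase i₀) w v))
      (inner ℝ (w i₀) (scatterInv b (Finset.univ.erase i₀) w v))
    rwa [sub_add_cancel] at this
  refine (hmax (i, i') (by simpa using hne)).trans ?_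
  have : 22 * T ^ 3 * √d / n = 22 * (T ^ 3 * √d / n) := by ring
  rw [this]
  change g ≤ _
  linarith

end Regular
end RegularBounds

/-! ### Concentration in product spaces -/

section Concentration

variable {α : Type*} [MeasurableSpace α] (P : Measure α) [IsProbabilityMeasure P]

/-- Resampling the coordinates in `A` does not change a product law. -/
lemma map_piecewise_pi {ι : Type*} [Fintype ι] [DecidableEq ι] (A : Finset ι) :
    ((Measure.pi fun _ : ι => P).prod (Measure.pi fun _ : ι => P)).map
      (fun z : (ι → α) × (ι → α) => A.piecewise z.2 z.1) = Measure.pi fun _ : ι => P := by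
  have hm : Measurable (fun z : (ι → α) × (ι → α) => A.piecewise z.2 z.1) := by
    refine measurable_pi_lambda _ fun i => ?_
    by_cases hi : i ∈ A
    · simp only [Finset.piecewise_eq_of_mem _ _ _ hi]; fun_prop
    · simp only [Finset.piecewise_eq_of_notMem _ _ _ hi]; fun_prop
  refine (Measure.pi_eq fun s hs => ?_).symm
  rw [Measure.map_apply hm (MeasurableSet.univ_pi hs)]
  have : (fun z : (ι → α) × (ι → α) => A.piecewise z.2 z.1) ⁻¹' (Set.univ.pi s)
      = (Set.univ.pi fun i => if i ∈ A then Set.univ else s i)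
        ×ˢ (Set.univ.pi fun i => if i ∈ A then s i else Set.univ) := by
    ext z
    simp only [Set.mem_preimage, Set.mem_pi, Set.mem_univ, forall_true_left, Set.mem_prod,
      ← forall_and]
    refine forall_congr' fun i => ?_
    by_cases hi : i ∈ A <;> simp [hi, Finset.piecewise]
  rw [this, Measure.prod_prod, Measure.pi_pi, Measure.pi_pi, ← Finset.prod_mul_distrib]
  refine Finset.prod_congr rfl fun i _ => ?_
  by_cases hi : i ∈ A <;> simp [hi]

/-- Conditioning on the coordinates outside `A`: resampling those in `A` preserves the law, so by
Fubini a bound uniform in the frozen coordinates carries over. -/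
lemma measure_pi_le_of_resample {ι : Type*} [Fintype ι] [DecidableEq ι] (A : Finset ι)
    {S : Set (ι → α)} (hS : MeasurableSet S) {η : ℝ≥0∞}
    (h : ∀ x : ι → α, (Measure.pi fun _ : ι => P) {y | A.piecewise y x ∈ S} ≤ η) :
    (Measure.pi fun _ : ι => P) S ≤ η := by
  have hm : Measurable (fun z : (ι → α) × (ι → α) => A.piecewise z.2 z.1) := by
    refine measurable_pi_lambda _ fun i => ?_
    by_cases hi : i ∈ A
    · simp only [Finset.piecewise_eq_of_mem _ _ _ hi]; fun_prop
    · simp only [Finset.piecewise_eq_of_notMem _ _ _ hi]; fun_prop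
  calc (Measure.pi fun _ : ι => P) S
      = ((Measure.pi fun _ : ι => P).prod (Measure.pi fun _ : ι => P))
          ((fun z : (ι → α) × (ι → α) => A.piecewise z.2 z.1) ⁻¹' S) := by
        rw [← Measure.map_apply hm hS, map_piecewise_pi]
    _ = ∫⁻ x, (Measure.pi fun _ : ι => P) {y | A.piecewise y x ∈ S} ∂Measure.pi fun _ : ι => P := by
        rw [Measure.prod_apply (hm hS)]; rfl
    _ ≤ ∫⁻ _, η ∂Measure.pi fun _ : ι => P := lintegral_mono h
    _ = η := by simp

lemma measure_prod_le_of_forall {β : Type*} [MeasurableSpace β] (Q : Measure β)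
    [IsProbabilityMeasure Q] {S : Set (α × β)} (hS : MeasurableSet S) {η : ℝ≥0∞}
    (h : ∀ x, Q {y | (x, y) ∈ S} ≤ η) : (P.prod Q) S ≤ η := by
  rw [Measure.prod_apply hS]
  calc _ ≤ ∫⁻ _, η ∂P := lintegral_mono h
    _ = η := by simp

/-- **Hoeffding's inequality** for a product law. -/
lemma measure_pi_sum_ge_le {n : ℕ} (A : Finset (Fin n)) {f : Fin n → α → ℝ} {B : ℝ}
    (hf : ∀ i, Measurable (f i)) (hB : ∀ i x, |f i x| ≤ B) {s : ℝ} (hs : 0 ≤ s) :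
    (Measure.pi fun _ : Fin n => P) {ω | s ≤ ∑ i ∈ A, (f i (ω i) - ∫ x, f i x ∂P)}
      ≤ ENNReal.ofReal (Real.exp (-s ^ 2 / (2 * (A.card * B ^ 2)))) := by
  have hind : iIndepFun (fun i (ω : Fin n → α) => f i (ω i) - ∫ x, f i x ∂P)
      (Measure.pi fun _ : Fin n => P) :=
    iIndepFun_pi (X := fun i x => f i x - ∫ x, f i x ∂P) fun i => ((hf i).sub_const _).aemeasurable
  have hsub : ∀ i ∈ A, HasSubgaussianMGF (fun (ω : Fin n → α) => f i (ω i) - ∫ x, f i x ∂P)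
      ((‖B - (-B)‖₊ / 2) ^ 2) (Measure.pi fun _ : Fin n => P) := by
    intro i _
    have hmp := measurePreserving_eval (fun _ : Fin n => P) i
    have h1 := hasSubgaussianMGF_of_mem_Icc (μ := Measure.pi fun _ : Fin n => P)
      (X := fun ω => f i (ω i)) (a := -B) (b := B)
      ((hf i).comp (measurable_pi_apply i)).aemeasurable
      (Filter.Eventually.of_forall fun ω => abs_le.1 (hB i (ω i)))
    have h2 : ∫ ω, f i (ω i) ∂(Measure.pi fun _ : Fin n => P) = ∫ x, f i x ∂P := by
      rw [← integral_map (φ := fun ω : Fin n → α => ω i) (measurable_pi_apply i).aemeasurable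
        (hf i).aestronglyMeasurable]
      congr 1
      exact hmp.map_eq
    rwa [h2] at h1
  have h := HasSubgaussianMGF.measure_sum_ge_le_of_iIndepFun hind hsub hs
  rw [← ofReal_measureReal]
  refine ENNReal.ofReal_le_ofReal (h.trans_eq ?_)
  congr 3
  rw [Finset.sum_const, nsmul_eq_mul]
  push_cast
  congr 1
  rw [Real.norm_eq_abs, div_pow, sq_abs]
  ring

lemma measure_pi_abs_sum_ge_le {n : ℕ} (A : Finset (Fin n)) {f : Fin n → α → ℝ} {B : ℝ}
    (hf : ∀ i, Measurable (f i)) (hB : ∀ i x, |f i x| ≤ B) {s : ℝ} (hs : 0 ≤ s) :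
    (Measure.pi fun _ : Fin n => P) {ω | s ≤ |∑ i ∈ A, (f i (ω i) - ∫ x, f i x ∂P)|}
      ≤ ENNReal.ofReal (2 * Real.exp (-s ^ 2 / (2 * (A.card * B ^ 2)))) := by
  have h1 := measure_pi_sum_ge_le P A hf hB hs
  have h2 := measure_pi_sum_ge_le P A (f := fun i x => -f i x) (fun i => (hf i).neg)
    (fun i x => by rw [abs_neg]; exact hB i x) hs
  have hsub : {ω : Fin n → α | s ≤ |∑ i ∈ A, (f i (ω i) - ∫ x, f i x ∂P)|}
      ⊆ {ω | s ≤ ∑ i ∈ A, (f i (ω i) - ∫ x, f i x ∂P)}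
        ∪ {ω | s ≤ ∑ i ∈ A, (-f i (ω i) - ∫ x, -f i x ∂P)} := by
    intro ω hω
    rcases le_abs'.1 (show s ≤ |_| from hω) with h | h
    · right
      simp only [integral_neg, Set.mem_ofPred_eq]
      have : ∑ i ∈ A, (-f i (ω i) - -∫ x, f i x ∂P) = -∑ i ∈ A, (f i (ω i) - ∫ x, f i x ∂P) := by
        rw [← Finset.sum_neg_distrib]; exact Finset.sum_congr rfl fun i _ => by ring
      rw [this]; linarith
    · exact Or.inl h
  refine (measure_mono hsub).trans ((measure_union_le _ _).trans ((add_le_add h1 h2).trans_eq ?_))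
  rw [← ENNReal.ofReal_add (by positivity) (by positivity), ← two_mul (Real.exp _)]

/-- Concentration of sums of iid variables with bounded second moment that are rarely large. -/
lemma measure_pi_sum_truncated_le {n : ℕ} (A : Finset (Fin n)) {f : α → ℝ} (hf : Measurable f)
    (hf2 : Integrable (fun x => f x ^ 2) P) {V B η lam s : ℝ} (hV : ∫ x, f x ^ 2 ∂P ≤ V)
    (hη0 : 0 ≤ η) (hη : P {x | B < |f x|} ≤ ENNReal.ofReal η) (hB : 0 ≤ B) (hlam : 0 < lam)
    (hs : 0 ≤ s) :
    (Measure.pi fun _ : Fin n => P)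
        {ω | s + A.card * (V / lam + lam * η) ≤ |∑ i ∈ A, (f (ω i) - ∫ x, f x ∂P)|}
      ≤ ENNReal.ofReal (2 * Real.exp (-s ^ 2 / (2 * (A.card * B ^ 2))) + A.card * η) := by
  set S : Set α := {x | B < |f x|} with hSdef
  have hSm : MeasurableSet S := measurableSet_lt measurable_const hf.abs
  -- Hoeffding is applied to the truncation g. Off an event of probability at most |A|η no sample is
  -- truncated, and the change of mean enters the threshold.
  set g : α → ℝ := Sᶜ.indicator f with hg
  have hgm : Measurable g := hf.indicator hSm.compl
  have hgB : ∀ x, |g x| ≤ B := by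
    intro x
    rw [hg]
    by_cases hx : x ∈ S
    · simp [Set.indicator, hx, hB]
    · rw [Set.indicator_of_mem (show x ∈ Sᶜ from hx)]
      exact not_lt.1 hx
  have hfi : Integrable f P := by
    refine (((integrable_const (1 : ℝ)).add hf2)).mono' hf.aestronglyMeasurable
      (Filter.Eventually.of_forall fun x => ?_)
    simp only [Real.norm_eq_abs, Pi.add_apply]
    nlinarith [sq_abs (f x), sq_nonneg (|f x| - 1)]
  have hgi : Integrable g P := hfi.indicator hSm.compl
  have hshift : |∫ x, f x ∂P - ∫ x, g x ∂P| ≤ V / lam + lam * η := by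
    rw [← integral_sub hfi hgi]
    refine (abs_integral_le_integral_abs).trans ?_
    -- The difference lives on the tail set, where |f| ≤ f²/lam + lam by the arithmetic–geometric
    -- mean inequality. The free parameter balances second moment against rarity.
    have hpt : ∀ x, |f x - g x| ≤ f x ^ 2 / lam + lam * S.indicator (fun _ => (1 : ℝ)) x := by
      intro x
      by_cases hx : x ∈ S
      · have : g x = 0 := by rw [hg]; simp [Set.indicator, hx]
        rw [this, sub_zero, Set.indicator_of_mem hx, mul_one, div_add' _ _ _ hlam.ne',
          le_div_iff₀ hlam]
        nlinarith [sq_abs (f x), sq_nonneg (|f x| - lam), abs_nonneg (f x)]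
      · have : g x = f x := by rw [hg, Set.indicator_of_mem (show x ∈ Sᶜ from hx)]
        rw [this, sub_self, abs_zero]
        refine add_nonneg (by positivity) (mul_nonneg hlam.le ?_)
        exact Set.indicator_nonneg (fun _ _ => zero_le_one) x
    have hi1 : Integrable (fun x => f x ^ 2 / lam) P := hf2.div_const _
    have hi2 : Integrable (fun x => lam * S.indicator (fun _ => (1 : ℝ)) x) P :=
      ((integrable_const (1 : ℝ)).indicator hSm).const_mul _
    refine (integral_mono (hfi.sub hgi).abs (hi1.add hi2) hpt).trans ?_
    rw [integral_add' hi1 hi2, integral_div, integral_const_mul, integral_indicator_const _ hSm]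
    have : P.real S ≤ η := by
      rw [measureReal_def]
      exact ENNReal.toReal_le_of_le_ofReal hη0 hη
    simp only [smul_eq_mul, mul_one]
    gcongr
  have h1 := measure_pi_abs_sum_ge_le P A (f := fun _ => g) (fun _ => hgm) (fun _ => hgB) hs
  have hsub : {ω : Fin n → α | s + A.card * (V / lam + lam * η) ≤ |∑ i ∈ A, (f (ω i) - ∫ x, f x ∂P)|}
      ⊆ {ω | s ≤ |∑ i ∈ A, (g (ω i) - ∫ x, g x ∂P)|} ∪ ⋃ i ∈ A, (fun ω => ω i) ⁻¹' S := by
    intro ω hω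
    by_cases hall : ∃ i ∈ A, ω i ∈ S
    · right
      obtain ⟨i, hi, hiS⟩ := hall
      exact Set.mem_biUnion hi hiS
    · left
      push Not at hall
      have he : ∑ i ∈ A, (f (ω i) - ∫ x, f x ∂P)
          = ∑ i ∈ A, (g (ω i) - ∫ x, g x ∂P) - A.card * (∫ x, f x ∂P - ∫ x, g x ∂P) := by
        rw [← nsmul_eq_mul, ← Finset.sum_const, ← Finset.sum_sub_distrib]
        refine Finset.sum_congr rfl fun i hi => ?_
        rw [hg, Set.indicator_of_mem (show ω i ∈ Sᶜ from hall i hi)]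
        ring
      have h2 : s + A.card * (V / lam + lam * η) ≤ |∑ i ∈ A, (f (ω i) - ∫ x, f x ∂P)| := hω
      rw [he] at h2
      have h3 := abs_sub (∑ i ∈ A, (g (ω i) - ∫ x, g x ∂P)) (A.card * (∫ x, f x ∂P - ∫ x, g x ∂P))
      rw [abs_mul, Nat.abs_cast] at h3
      have h4 : (A.card : ℝ) * |∫ x, f x ∂P - ∫ x, g x ∂P| ≤ A.card * (V / lam + lam * η) := by
        gcongr
      change s ≤ |_|
      linarith
  refine (measure_mono hsub).trans ((measure_union_le _ _).trans ?_)
  rw [ENNReal.ofReal_add (by positivity) (by positivity)]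
  refine add_le_add h1 ((measure_biUnion_finset_le _ _).trans ?_)
  have : ∀ i ∈ A, (Measure.pi fun _ : Fin n => P) ((fun ω => ω i) ⁻¹' S) ≤ ENNReal.ofReal η := by
    intro i _
    rw [(measurePreserving_eval (fun _ : Fin n => P) i).measure_preimage hSm.nullMeasurableSet]
    exact hη
  refine (Finset.sum_le_sum this).trans_eq ?_
  rw [Finset.sum_const, nsmul_eq_mul, ENNReal.ofReal_mul (by positivity), ENNReal.ofReal_natCast]

/-- The fourth moment of a variable with stretched exponential tails. -/
lemma exists_fourth_moment_bound {C c : ℝ} (K : ℝ) (hC : 0 < C) (hc : 0 < c) :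
    ∃ M : ℝ, 1 ≤ M ∧ ∀ {α : Type} [MeasurableSpace α] (P : Measure α) [IsProbabilityMeasure P]
      (f : α → ℝ), Measurable f →
      (∀ t : ℝ, 0 < t → P {x | t < |f x|} ≤ ENNReal.ofReal (K * Real.exp (-(c * t ^ C)))) →
      Integrable (fun x => f x ^ 4) P ∧ ∫ x, f x ^ 4 ∂P ≤ M := by
  -- The layer cake integral of the fourth moment with the tail replaced by its bound; it depends on
  -- C, c, K only.
  set J : ℝ≥0∞ := ENNReal.ofReal 4 * ∫⁻ t in Set.Ioi (0 : ℝ),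
    ENNReal.ofReal (K * Real.exp (-(c * t ^ C))) * ENNReal.ofReal (t ^ ((4 : ℝ) - 1)) with hJ
  have hJfin : J ≠ ∞ := by
    rw [hJ]
    refine ENNReal.mul_ne_top ENNReal.ofReal_ne_top ?_
    have hint : IntegrableOn (fun t : ℝ => |K| * (t ^ (3 : ℝ) * Real.exp (-c * t ^ C))) (Set.Ioi 0) :=
      (integrableOn_rpow_mul_exp_neg_mul_rpow (by norm_num) hC hc).const_mul _
    refine ne_top_of_le_ne_top hint.hasFiniteIntegral.ne ?_
    refine setLIntegral_mono' measurableSet_Ioi fun t ht => ?_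
    have ht : 0 < t := ht
    rw [← ENNReal.ofReal_mul' (by positivity), ← ofReal_norm]
    refine ENNReal.ofReal_le_ofReal ?_
    rw [norm_mul, norm_mul, Real.norm_eq_abs, abs_abs, Real.norm_of_nonneg (by positivity),
      Real.norm_of_nonneg (by positivity)]
    have h3 : (4 : ℝ) - 1 = 3 := by norm_num
    rw [h3, neg_mul]
    have := le_abs_self K
    calc K * Real.exp (-(c * t ^ C)) * t ^ (3 : ℝ)
        ≤ |K| * Real.exp (-(c * t ^ C)) * t ^ (3 : ℝ) := by gcongr
      _ = _ := by ring
  refine ⟨max 1 J.toReal, le_max_left _ _, fun {α} _ P _ f hf ht => ?_⟩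
  have h1 : ∫⁻ x, ENNReal.ofReal (|f x| ^ (4 : ℝ)) ∂P ≤ J := by
    rw [lintegral_rpow_eq_lintegral_meas_lt_mul P
      (Filter.Eventually.of_forall fun x => abs_nonneg (f x)) hf.abs.aemeasurable (by norm_num), hJ]
    refine mul_le_mul_right ?_ _
    refine setLIntegral_mono' measurableSet_Ioi fun t ht0 => ?_
    gcongr
    exact ht t ht0
  have h2 : ∀ x, |f x| ^ (4 : ℝ) = f x ^ 4 := by
    intro x
    rw [show (4 : ℝ) = ((4 : ℕ) : ℝ) by norm_num, Real.rpow_natCast]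
    exact (even_two_mul 2).pow_abs (f x)
  simp only [h2] at h1
  have hm : AEStronglyMeasurable (fun x => f x ^ 4) P := (hf.pow_const 4).aestronglyMeasurable
  have hnn : 0 ≤ᵐ[P] fun x => f x ^ 4 := Filter.Eventually.of_forall fun x => by positivity
  refine ⟨⟨hm, ?_⟩, ?_⟩
  · rw [hasFiniteIntegral_iff_ofReal hnn]
    exact h1.trans_lt hJfin.lt_top
  · rw [integral_eq_lintegral_of_nonneg_ae hnn hm]
    exact (ENNReal.toReal_mono hJfin h1).trans (le_max_right _ _)

end Concentration

/-! ### Isotropic features -/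

section Isotropic

open Filter

/-- Isotropic distributions with stretched exponential tails. -/
structure Isotropic (C c K : ℝ) {d : ℕ} (D : Measure (Vec d)) : Prop where
  isProbabilityMeasure : IsProbabilityMeasure D
  mean_zero : ∀ u : Vec d, ∫ x, (inner ℝ u x : ℝ) ∂D = 0
  second_moment : ∀ u v : Vec d, ∫ x, (inner ℝ u x : ℝ) * inner ℝ v x ∂D = inner ℝ u v
  tail : ∀ v : Vec d, ‖v‖ = 1 → ∀ t : ℝ, 0 < t →
    D {x | t < |(inner ℝ v x : ℝ)|} ≤ ENNReal.ofReal (K * Real.exp (-(c * t ^ C)))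

lemma tendsto_log_natCast : Tendsto (fun n : ℕ => Real.log n) atTop atTop :=
  Real.tendsto_log_atTop.comp tendsto_natCast_atTop_atTop

lemma eventually_le_log (x : ℝ) : ∀ᶠ n : ℕ in atTop, x ≤ Real.log n :=
  tendsto_log_natCast.eventually_ge_atTop x

lemma inv_pow_eq_exp {n : ℕ} (hn : 0 < n) (q : ℕ) :
    ((n : ℝ) ^ q)⁻¹ = Real.exp (-(q * Real.log n)) := by
  rw [Real.exp_neg, mul_comm, Real.exp_mul, Real.exp_log (by exact_mod_cast hn), Real.rpow_natCast]

/-- Since aC ≥ 2, the exponent is at least c(log x)², which beats q·log x for every q. -/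
lemma eventually_tail_le_atTop {C c : ℝ} (K : ℝ) (hc : 0 < c) {a : ℕ} (ha : 2 ≤ a * C) (q : ℕ) :
    ∀ᶠ x : ℝ in atTop, K * Real.exp (-(c * (Real.log x ^ a) ^ C)) ≤ (x ^ q)⁻¹ := by
  filter_upwards [Real.tendsto_log_atTop.eventually_ge_atTop 1,
    Real.tendsto_log_atTop.eventually_ge_atTop ((q + |K|) / c), eventually_gt_atTop 0]
    with x h1 h2 hx
  rw [← Real.rpow_natCast x q, ← Real.rpow_neg hx.le, Real.rpow_def_of_pos hx]
  set L := Real.log x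
  have hL : (L ^ a) ^ C = L ^ (a * C) := by
    rw [← Real.rpow_natCast, ← Real.rpow_mul (by linarith)]
  have h3 : L ^ 2 ≤ L ^ (a * C) := by
    rw [← Real.rpow_natCast]
    exact Real.rpow_le_rpow_of_exponent_le h1 (by exact_mod_cast ha)
  rw [hL]
  have h4 : q + |K| ≤ c * L := by rwa [div_le_iff₀' hc] at h2
  have hK : K ≤ Real.exp |K| := by
    linarith [Real.add_one_le_exp |K|, le_abs_self K]
  calc K * Real.exp (-(c * L ^ (a * C))) ≤ Real.exp |K| * Real.exp (-(c * L ^ 2)) := by gcongr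
    _ = Real.exp (|K| - c * L ^ 2) := by rw [← Real.exp_add]; ring_nf
    _ ≤ _ := by
      apply Real.exp_le_exp.2
      have : 0 ≤ |K| := abs_nonneg K
      nlinarith

lemma eventually_tail_le {C c : ℝ} (K : ℝ) (hc : 0 < c) {a : ℕ} (ha : 2 ≤ a * C) (q : ℕ) :
    ∀ᶠ n : ℕ in atTop, K * Real.exp (-(c * (Real.log n ^ a) ^ C)) ≤ ((n : ℝ) ^ q)⁻¹ :=
  tendsto_natCast_atTop_atTop.eventually (eventually_tail_le_atTop K hc ha q)

/-- The truncated inequality with half of the threshold for the Hoeffding deviation and half for the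
shift of the mean. -/
lemma eventually_sum_tail (V : ℝ) (q : ℕ) :
    ∀ᶠ n : ℕ in atTop, ∀ {α : Type} [MeasurableSpace α] (P : Measure α) [IsProbabilityMeasure P]
      (f : α → ℝ) (B : ℝ), Measurable f → Integrable (fun x => f x ^ 2) P → ∫ x, f x ^ 2 ∂P ≤ V →
      1 ≤ B → P {x | B < |f x|} ≤ ENNReal.ofReal ((n : ℝ) ^ (q + 2))⁻¹ → ∀ A : Finset (Fin n),
      (Measure.pi fun _ : Fin n => P)
        {ω | 2 * B * Real.log n * √(A.card : ℝ) < |∑ i ∈ A, (f (ω i) - ∫ x, f x ∂P)|}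
        ≤ ENNReal.ofReal ((n : ℝ) ^ q)⁻¹ := by
  filter_upwards [eventually_le_log (|V| + 1), eventually_le_log (2 * (q + 2)), eventually_ge_atTop 2]
    with n h1 h2 hn α _ P _ f B hf hf2 hV hB hη A
  set L := Real.log n
  have hV0 := abs_nonneg V
  have hn0 : (0 : ℝ) < n := by positivity
  have hn2 : (2 : ℝ) ≤ n := by exact_mod_cast hn
  rcases Finset.eq_empty_or_nonempty A with rfl | hA
  · simp
  have hAc : (1 : ℝ) ≤ A.card := by exact_mod_cast hA.card_pos
  have hAn : (A.card : ℝ) ≤ n := by exact_mod_cast (Finset.card_le_univ A).trans_eq (Fintype.card_fin n)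
  -- With lam = n and tails n^(-(q+2)), the shift is at most |A|(|V|+1)/n ≤ √|A|(|V|+1), which log n
  -- ≥ |V|+1 dominates.
  have h := measure_pi_sum_truncated_le P A hf hf2 (hV.trans (le_abs_self V)) (lam := n)
    (s := B * L * √A.card) (by positivity) hη (by linarith) hn0 (by positivity)
  refine (measure_mono fun ω hω => ?_).trans (h.trans (ENNReal.ofReal_le_ofReal ?_))
  · have hω' : 2 * B * L * √(A.card : ℝ) < |∑ i ∈ A, (f (ω i) - ∫ x, f x ∂P)| := hω
    refine le_trans ?_ hω'.le
    have hsh : (A.card : ℝ) * (|V| / n + n * ((n : ℝ) ^ (q + 2))⁻¹) ≤ √A.card * (|V| + 1) := by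
      have h3 : (n : ℝ) * ((n : ℝ) ^ (q + 2))⁻¹ ≤ 1 / n := by
        rw [← div_eq_mul_inv, div_le_div_iff₀ (by positivity) hn0]
        have : (1 : ℝ) ≤ (n : ℝ) ^ q := one_le_pow₀ (by linarith)
        rw [pow_add]
        nlinarith [sq_nonneg (n : ℝ)]
      calc (A.card : ℝ) * (|V| / n + n * ((n : ℝ) ^ (q + 2))⁻¹)
          ≤ A.card * (|V| / n + 1 / n) := by gcongr
        _ = √A.card * (|V| + 1) * (√A.card / n) := by
            rw [← add_div]
            nth_rewrite 1 [← Real.mul_self_sqrt (show (0 : ℝ) ≤ A.card by positivity)]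
            ring
        _ ≤ √A.card * (|V| + 1) * 1 := by
            gcongr
            rw [div_le_one hn0, Real.sqrt_le_left (by positivity)]
            nlinarith
        _ = _ := mul_one _
    have : √(A.card : ℝ) * (|V| + 1) ≤ B * L * √A.card := by
      calc _ ≤ √(A.card : ℝ) * (B * L) := by gcongr; nlinarith
        _ = _ := by ring
    linarith
  · have e1 : -(B * L * √A.card) ^ 2 / (2 * (A.card * B ^ 2)) = -(L ^ 2 / 2) := by
      rw [mul_pow, mul_pow, Real.sq_sqrt (by positivity)]
      field_simp
    rw [e1]
    have h3 : (A.card : ℝ) * ((n : ℝ) ^ (q + 2))⁻¹ ≤ ((n : ℝ) ^ (q + 1))⁻¹ := by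
      calc _ ≤ (n : ℝ) * ((n : ℝ) ^ (q + 2))⁻¹ := by gcongr
        _ = _ := by field_simp; ring
    have h4 : Real.exp (-(L ^ 2 / 2)) ≤ ((n : ℝ) ^ (q + 2))⁻¹ := by
      rw [inv_pow_eq_exp (by omega)]
      apply Real.exp_le_exp.2
      push_cast
      change -(L ^ 2 / 2) ≤ -((q + 2) * L)
      nlinarith
    have h5 : 2 * ((n : ℝ) ^ (q + 2))⁻¹ + ((n : ℝ) ^ (q + 1))⁻¹ ≤ ((n : ℝ) ^ q)⁻¹ := by
      have e2 : ((n : ℝ) ^ (q + 2))⁻¹ = ((n : ℝ) ^ q)⁻¹ * ((n : ℝ)⁻¹ * (n : ℝ)⁻¹) := by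
        rw [pow_add, mul_inv, pow_two, mul_inv]
      have e3 : ((n : ℝ) ^ (q + 1))⁻¹ = ((n : ℝ) ^ q)⁻¹ * (n : ℝ)⁻¹ := by
        rw [pow_add, mul_inv, pow_one]
      have h6 : (n : ℝ)⁻¹ ≤ 1 / 2 := by rw [one_div]; gcongr
      have h7 : 0 ≤ (n : ℝ)⁻¹ := by positivity
      rw [e2, e3]
      have h8 : 0 ≤ ((n : ℝ) ^ q)⁻¹ := by positivity
      nlinarith [mul_nonneg h8 h7]
    linarith

/-! ### Fourth moments of one-dimensional marginals. -/

section Moments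

variable {C c K : ℝ} {d : ℕ} {D : Measure (Vec d)}

lemma measurable_inner_left (u : Vec d) : Measurable fun x : Vec d => (inner ℝ u x : ℝ) := by
  fun_prop

/-- A bound for fourth moments of one-dimensional marginals. -/
def FourthMoment (M : ℝ) {d : ℕ} (D : Measure (Vec d)) : Prop :=
  ∀ u : Vec d, Integrable (fun x => (inner ℝ u x : ℝ) ^ 4) D ∧
    ∫ x, (inner ℝ u x : ℝ) ^ 4 ∂D ≤ M * ‖u‖ ^ 4

/-- Scale u to a unit vector. The constant comes from the tail alone and is uniform in the
dimension. -/
lemma exists_fourthMoment (K : ℝ) (hC : 0 < C) (hc : 0 < c) :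
    ∃ M : ℝ, 1 ≤ M ∧ ∀ {d : ℕ} (D : Measure (Vec d)), Isotropic C c K D → FourthMoment M D := by
  obtain ⟨M, hM1, hM⟩ := exists_fourth_moment_bound K hC hc
  refine ⟨M, hM1, fun {d} D hD u => ?_⟩
  have := hD.isProbabilityMeasure
  rcases eq_or_ne u 0 with rfl | hu
  · simp
  have hu0 : 0 < ‖u‖ := norm_pos_iff.2 hu
  obtain ⟨h1, h2⟩ := hM D (fun x => inner ℝ (‖u‖⁻¹ • u) x) (measurable_inner_left _)
    (hD.tail _ (by rw [norm_smul, norm_inv, norm_norm, inv_mul_cancel₀ hu0.ne']))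
  have e1 : ∀ x, (inner ℝ u x : ℝ) ^ 4 = ‖u‖ ^ 4 * (inner ℝ (‖u‖⁻¹ • u) x : ℝ) ^ 4 := by
    intro x
    rw [real_inner_smul_left, mul_pow, ← mul_assoc, ← mul_pow, mul_inv_cancel₀ hu0.ne', one_pow, one_mul]
  constructor
  · simp_rw [e1]; exact h1.const_mul _
  · simp_rw [e1]
    rw [integral_const_mul, mul_comm M]
    gcongr

lemma FourthMoment.integrable_mul_sq {M : ℝ} (h : FourthMoment M D) [IsProbabilityMeasure D]
    (u v : Vec d) : Integrable (fun x => ((inner ℝ u x : ℝ) * inner ℝ v x) ^ 2) D := by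
  refine ((h u).1.add (h v).1).mono' (by fun_prop) (Eventually.of_forall fun x => ?_)
  simp only [Real.norm_eq_abs, Pi.add_apply]
  rw [abs_of_nonneg (by positivity), mul_pow]
  nlinarith [sq_nonneg ((inner ℝ u x : ℝ) ^ 2 - (inner ℝ v x : ℝ) ^ 2),
    sq_nonneg ((inner ℝ u x : ℝ) ^ 2), sq_nonneg ((inner ℝ v x : ℝ) ^ 2)]

lemma FourthMoment.integral_mul_sq_le {M : ℝ} (h : FourthMoment M D) [IsProbabilityMeasure D]
    {u v : Vec d} (hu : ‖u‖ = 1) (hv : ‖v‖ = 1) :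
    ∫ x, ((inner ℝ u x : ℝ) * inner ℝ v x) ^ 2 ∂D ≤ M := by
  have h1 : ∫ x, ((inner ℝ u x : ℝ) * inner ℝ v x) ^ 2 ∂D
      ≤ ∫ x, (1 / 2 * (inner ℝ u x : ℝ) ^ 4 + 1 / 2 * (inner ℝ v x : ℝ) ^ 4) ∂D := by
    refine integral_mono (h.integrable_mul_sq u v)
      (((h u).1.const_mul _).add ((h v).1.const_mul _)) fun x => ?_
    simp only
    nlinarith [sq_nonneg ((inner ℝ u x : ℝ) ^ 2 - (inner ℝ v x : ℝ) ^ 2)]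
  rw [integral_add ((h u).1.const_mul _) ((h v).1.const_mul _), integral_const_mul,
    integral_const_mul] at h1
  have h2 := (h u).2
  have h3 := (h v).2
  rw [hu] at h2
  rw [hv] at h3
  linarith

lemma FourthMoment.integrable_sq {M : ℝ} (h : FourthMoment M D) [IsProbabilityMeasure D]
    (u : Vec d) : Integrable (fun x => (inner ℝ u x : ℝ) ^ 2) D := by
  refine ((integrable_const (1 : ℝ)).add (h u).1).mono' (by fun_prop) (Eventually.of_forall fun x => ?_)
  simp only [Real.norm_eq_abs, Pi.add_apply]
  rw [abs_of_nonneg (by positivity)]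
  nlinarith [sq_nonneg ((inner ℝ u x : ℝ) ^ 2 - 1), sq_nonneg ((inner ℝ u x : ℝ) ^ 2)]

end Moments

/-- Linear functionals of partial sums are typically of the order of their standard deviation. -/
lemma eventually_linear {C c : ℝ} (K : ℝ) (hC : 0 < C) (hc : 0 < c) {a : ℕ} (ha : 2 ≤ a * C)
    (q : ℕ) :
    ∀ᶠ n : ℕ in atTop, ∀ {d : ℕ} (D : Measure (Vec d)), Isotropic C c K D →
      ∀ (A : Finset (Fin n)) (u : Vec d), (Measure.pi fun _ : Fin n => D)
        {w | Real.log n ^ (2 * a + 2) * √(A.card : ℝ) * ‖u‖ < |(inner ℝ (∑ i ∈ A, w i) u : ℝ)|}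
        ≤ ENNReal.ofReal ((n : ℝ) ^ q)⁻¹ := by
  filter_upwards [eventually_sum_tail 1 q, eventually_tail_le K hc ha (q + 2), eventually_le_log 2]
    with n h1 h2 h3 d D hD A u
  have := hD.isProbabilityMeasure
  obtain ⟨M, -, hM⟩ := exists_fourthMoment K hC hc
  rcases eq_or_ne u 0 with rfl | hu
  · simp
  have hu0 : 0 < ‖u‖ := norm_pos_iff.2 hu
  set v := ‖u‖⁻¹ • u with hv
  have hv1 : ‖v‖ = 1 := by rw [hv, norm_smul, norm_inv, norm_norm, inv_mul_cancel₀ hu0.ne']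
  have huv : u = ‖u‖ • v := by rw [hv, smul_smul, mul_inv_cancel₀ hu0.ne', one_smul]
  set L := Real.log n
  have hLa : 1 ≤ L ^ a := one_le_pow₀ (by linarith)
  have h4 := h1 D (fun x => inner ℝ v x) (L ^ a) (measurable_inner_left v)
    ((hM D hD).integrable_sq v)
    (by simp_rw [pow_two]; rw [hD.second_moment, real_inner_self_eq_norm_sq, hv1]; norm_num)
    hLa ((hD.tail v hv1 _ (by positivity)).trans (ENNReal.ofReal_le_ofReal h2)) A
  refine (measure_mono fun w hw => ?_).trans h4
  have hw' : L ^ (2 * a + 2) * √(A.card : ℝ) * ‖u‖ < |(inner ℝ (∑ i ∈ A, w i) u : ℝ)| := hw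
  change 2 * L ^ a * L * √(A.card : ℝ) < |∑ i ∈ A, (inner ℝ v (w i) - ∫ x, inner ℝ v x ∂D)|
  rw [hD.mean_zero]
  simp only [sub_zero]
  rw [← inner_sum]
  nth_rewrite 2 [huv] at hw'
  rw [real_inner_smul_right, abs_mul, abs_norm, mul_comm, mul_lt_mul_iff_right₀ hu0,
    real_inner_comm] at hw'
  refine lt_of_le_of_lt (mul_le_mul_of_nonneg_right ?_ (Real.sqrt_nonneg _)) hw'
  calc 2 * L ^ a * L ≤ L * L ^ a * L := by gcongr
    _ = 1 * L ^ (a + 2) := by ring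
    _ ≤ L ^ a * L ^ (a + 2) := by gcongr
    _ = _ := by ring

/-- Products of linear functionals. -/
lemma eventually_bilinear {C c : ℝ} (K : ℝ) (hC : 0 < C) (hc : 0 < c) {a : ℕ} (ha : 2 ≤ a * C)
    (q : ℕ) :
    ∀ᶠ n : ℕ in atTop, ∀ {d : ℕ} (D : Measure (Vec d)), Isotropic C c K D →
      ∀ (u v : Vec d), ‖u‖ = 1 → ‖v‖ = 1 → (Measure.pi fun _ : Fin n => D)
        {w | Real.log n ^ (2 * a + 2) * √(n : ℝ)
          < |∑ i, (inner ℝ u (w i) : ℝ) * inner ℝ v (w i) - n * inner ℝ u v|}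
        ≤ ENNReal.ofReal ((n : ℝ) ^ q)⁻¹ := by
  obtain ⟨M, -, hM⟩ := exists_fourthMoment K hC hc
  filter_upwards [eventually_sum_tail M q, eventually_tail_le K hc ha (q + 3), eventually_le_log 2,
    eventually_ge_atTop 2] with n h1 h2 h3 hn d D hD u v hu hv
  have := hD.isProbabilityMeasure
  set L := Real.log n
  have hLa : 1 ≤ L ^ (2 * a) := one_le_pow₀ (by linarith)
  have hLa0 : 0 < L ^ a := by positivity
  have ht : D {x | L ^ (2 * a) < |(inner ℝ u x : ℝ) * inner ℝ v x|}
      ≤ ENNReal.ofReal ((n : ℝ) ^ (q + 2))⁻¹ := by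
    have hsub : {x | L ^ (2 * a) < |(inner ℝ u x : ℝ) * inner ℝ v x|}
        ⊆ {x | L ^ a < |(inner ℝ u x : ℝ)|} ∪ {x | L ^ a < |(inner ℝ v x : ℝ)|} := by
      intro x hx
      by_contra hcon
      simp only [Set.mem_union, Set.mem_ofPred_eq, not_or, not_lt] at hcon hx
      rw [abs_mul, two_mul, pow_add] at hx
      exact absurd hx (not_lt.2 (mul_le_mul hcon.1 hcon.2 (abs_nonneg _) hLa0.le))
    refine (measure_mono hsub).trans ((measure_union_le _ _).trans
      ((add_le_add (hD.tail u hu _ hLa0) (hD.tail v hv _ hLa0)).trans ?_))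
    rw [← two_mul, ← ENNReal.ofReal_ofNat, ← ENNReal.ofReal_mul (by norm_num)]
    refine ENNReal.ofReal_le_ofReal ?_
    have hn2 : (2 : ℝ) ≤ n := by exact_mod_cast hn
    calc _ ≤ 2 * ((n : ℝ) ^ (q + 3))⁻¹ := by gcongr
      _ ≤ (n : ℝ) * ((n : ℝ) ^ (q + 3))⁻¹ := by gcongr
      _ = _ := by field_simp; ring
  have h4 := h1 D (fun x => (inner ℝ u x : ℝ) * inner ℝ v x) (L ^ (2 * a)) (by fun_prop)
    ((hM D hD).integrable_mul_sq u v) ((hM D hD).integral_mul_sq_le hu hv) hLa ht Finset.univ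
  refine (measure_mono fun w hw => ?_).trans h4
  have hw' : L ^ (2 * a + 2) * √(n : ℝ)
      < |∑ i, (inner ℝ u (w i) : ℝ) * inner ℝ v (w i) - n * inner ℝ u v| := hw
  change 2 * L ^ (2 * a) * L * √((Finset.univ : Finset (Fin n)).card : ℝ)
    < |∑ i, ((inner ℝ u (w i) : ℝ) * inner ℝ v (w i) - ∫ x, (inner ℝ u x : ℝ) * inner ℝ v x ∂D)|
  rw [hD.second_moment, Finset.sum_sub_distrib, Finset.sum_const, Finset.card_univ, Fintype.card_fin,
    nsmul_eq_mul]
  refine lt_of_le_of_lt (mul_le_mul_of_nonneg_right ?_ (Real.sqrt_nonneg _)) hw'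
  calc 2 * L ^ (2 * a) * L ≤ L * L ^ (2 * a) * L := by gcongr
    _ = _ := by ring

end Isotropic

/-! ### Lower bounds for scatter matrices -/

section Curvature

open Filter

variable {C c K : ℝ} {n d m : ℕ} {D : Measure (Vec d)}

/-- Marginals of isotropic laws put mass outside every short interval. -/
lemma small_ball (hD : Isotropic C c K D) {M : ℝ} (hM1 : 1 ≤ M) (hM : FourthMoment M D)
    {u : Vec d} (hu : 1 / 2 ≤ ‖u‖) (r : ℝ) :
    1 / (32 * M) ≤ D.real {x | 1 / 3 ≤ |(inner ℝ u x : ℝ) - r|} := by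
  have := hD.isProbabilityMeasure
  set s : ℝ := ‖u‖ ^ 2 + r ^ 2 with hs
  have hs4 : 1 / 4 ≤ s := by nlinarith [sq_nonneg r]
  have hs0 : 0 < s := by linarith
  set S : Set (Vec d) := {x | 1 / 3 ≤ |(inner ℝ u x : ℝ) - r|} with hS
  have hSm : MeasurableSet S := measurableSet_le measurable_const (by fun_prop)
  have hI2 := hM.integrable_sq u
  have hI1 : Integrable (fun x => (inner ℝ u x : ℝ)) D := by
    refine ((integrable_const (1 : ℝ)).add hI2).mono' (by fun_prop) (Eventually.of_forall fun x => ?_)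
    simp only [Real.norm_eq_abs, Pi.add_apply]
    nlinarith [sq_abs (inner ℝ u x : ℝ), sq_nonneg (|(inner ℝ u x : ℝ)| - 1)]
  have hE : ∫ x, ((inner ℝ u x : ℝ) - r) ^ 2 ∂D = s := by
    have e1 : ∀ x, ((inner ℝ u x : ℝ) - r) ^ 2
        = (inner ℝ u x : ℝ) ^ 2 - 2 * r * inner ℝ u x + r ^ 2 := fun x => by ring
    have hI3 : Integrable (fun x => (inner ℝ u x : ℝ) ^ 2 - 2 * r * inner ℝ u x) D :=
      hI2.sub (hI1.const_mul _)
    simp_rw [e1]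
    rw [integral_add hI3 (integrable_const _),
      integral_sub hI2 (hI1.const_mul _), integral_const_mul, hD.mean_zero]
    simp_rw [pow_two (inner ℝ u _ : ℝ)]
    rw [hD.second_moment, real_inner_self_eq_norm_sq]
    simp [hs]
  have hI4 : Integrable (fun x => 8 * (inner ℝ u x : ℝ) ^ 4 + 8 * r ^ 4) D :=
    ((hM u).1.const_mul _).add (integrable_const _)
  -- A Paley–Zygmund argument. Off S the square is at most 1/9 ≤ s/2, since s ≥ 1/4; on S the
  -- arithmetic–geometric mean inequality trades it for a fourth power and a multiple of the
  -- indicator. Integrating gives s ≤ s/2 + s/4 + 8Ms·P(S), uniformly in the offset r.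
  have hpt : ∀ x, ((inner ℝ u x : ℝ) - r) ^ 2
      ≤ (s / 2 + (8 * (inner ℝ u x : ℝ) ^ 4 + 8 * r ^ 4) / (32 * M * s))
        + 8 * M * s * S.indicator (fun _ => (1 : ℝ)) x := by
    intro x
    set y : ℝ := inner ℝ u x
    have h4 : ((y - r) ^ 2) ^ 2 ≤ 8 * y ^ 4 + 8 * r ^ 4 := by
      nlinarith [sq_nonneg ((y - r) * (y + r)), sq_nonneg (y + r), sq_nonneg ((y + r) ^ 2),
        sq_nonneg (y ^ 2 - r ^ 2), sq_nonneg (y * r)]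
    by_cases hx : x ∈ S
    · rw [Set.indicator_of_mem hx, mul_one]
      have h5 : (y - r) ^ 2 ≤ (8 * y ^ 4 + 8 * r ^ 4) / (32 * M * s) + 8 * M * s := by
        rw [div_add' _ _ _ (by positivity), le_div_iff₀ (by positivity)]
        nlinarith [sq_nonneg ((y - r) ^ 2 - 16 * M * s)]
      linarith
    · rw [Set.indicator_of_notMem hx, mul_zero, add_zero]
      have h5 : |y - r| < 1 / 3 := not_le.1 hx
      have h6 : (y - r) ^ 2 ≤ 1 / 9 := by
        rw [← sq_abs]; nlinarith [abs_nonneg (y - r)]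
      have h7 : 0 ≤ (8 * y ^ 4 + 8 * r ^ 4) / (32 * M * s) := by positivity
      linarith
  have hi1 : Integrable (fun x => s / 2 + (8 * (inner ℝ u x : ℝ) ^ 4 + 8 * r ^ 4) / (32 * M * s)) D :=
    (integrable_const _).add (hI4.div_const _)
  have hi2 : Integrable (fun x => 8 * M * s * S.indicator (fun _ => (1 : ℝ)) x) D :=
    ((integrable_const (1 : ℝ)).indicator hSm).const_mul _
  have hi0 : Integrable (fun x => ((inner ℝ u x : ℝ) - r) ^ 2) D := by
    have e1 : (fun x => ((inner ℝ u x : ℝ) - r) ^ 2)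
        = fun x => (inner ℝ u x : ℝ) ^ 2 - 2 * r * inner ℝ u x + r ^ 2 := by ext x; ring
    rw [e1]
    exact (hI2.sub (hI1.const_mul _)).add (integrable_const _)
  have h1 := integral_mono hi0 (hi1.add hi2) hpt
  rw [hE, integral_add' hi1 hi2, integral_add (integrable_const _) (hI4.div_const _),
    integral_div (32 * M * s), integral_add ((hM u).1.const_mul _) (integrable_const _), integral_const_mul,
    integral_const_mul, integral_const_mul, integral_indicator_const _ hSm] at h1
  simp only [integral_const, probReal_univ, smul_eq_mul, one_mul, mul_one] at h1
  have h2 := (hM u).2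
  have h3 : (8 * ∫ x, (inner ℝ u x : ℝ) ^ 4 ∂D + 8 * r ^ 4) / (32 * M * s) ≤ s / 4 := by
    rw [div_le_iff₀ (by positivity)]
    have : r ^ 4 ≤ M * r ^ 4 := le_mul_of_one_le_left (by positivity) hM1
    have e2 : s ^ 2 = ‖u‖ ^ 4 + r ^ 4 + 2 * (‖u‖ ^ 2 * r ^ 2) := by rw [hs]; ring
    have e3 : s / 4 * (32 * M * s) = 8 * M * s ^ 2 := by ring
    rw [e3, e2]
    have : 0 ≤ M * (‖u‖ ^ 2 * r ^ 2) := by positivity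
    linarith
  rw [div_le_iff₀ (by positivity)]
  have h4 : s / 4 ≤ 8 * M * s * D.real S := by linarith
  have h5 : s * 1 ≤ s * (D.real S * (32 * M)) := by linarith
  exact le_of_mul_le_mul_left h5 hs0

/-- The number of `l ∈ A` at which the functional `u` is far from the offset `r (b l)`. -/
def farCount (b : Fin n → Fin m) (A : Finset (Fin n)) (u : Vec d) (r : Fin m → ℝ)
    (w : Fin n → Vec d) : ℝ :=
  ∑ l ∈ A, ({x : Vec d | 1 / 3 ≤ |(inner ℝ u x : ℝ) - r (b l)|}).indicator (fun _ => (1 : ℝ)) (w l)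

/-- Hoeffding for indicators of mean at least 1/(32M), asked to fall below half of that mean. -/
lemma farCount_tail (hD : Isotropic C c K D) {M : ℝ} (hM1 : 1 ≤ M) (hM : FourthMoment M D)
    (b : Fin n → Fin m) (A : Finset (Fin n)) {u : Vec d} (hu : 1 / 2 ≤ ‖u‖) (r : Fin m → ℝ) :
    (Measure.pi fun _ : Fin n => D) {w | farCount b A u r w ≤ A.card / (64 * M)}
      ≤ ENNReal.ofReal (Real.exp (-(A.card / (2 * (64 * M) ^ 2)))) := by
  have := hD.isProbabilityMeasure
  rcases A.eq_empty_or_nonempty with rfl | hA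
  · simpa using prob_le_one
  have hAc : (0 : ℝ) < A.card := by exact_mod_cast hA.card_pos
  set S : Fin n → Set (Vec d) := fun l => {x : Vec d | 1 / 3 ≤ |(inner ℝ u x : ℝ) - r (b l)|} with hS
  have hSm : ∀ l, MeasurableSet (S l) := fun l => measurableSet_le measurable_const (by fun_prop)
  have h := measure_pi_sum_ge_le D A (f := fun l x => -(S l).indicator (fun _ => (1 : ℝ)) x) (B := 1)
    (fun l => (measurable_const.indicator (hSm l)).neg)
    (fun l x => by
      rw [abs_neg]
      by_cases hx : x ∈ S l <;> simp [hx]) (s := A.card / (64 * M)) (by positivity)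
  refine (measure_mono fun w hw => ?_).trans (h.trans_eq ?_)
  · have hw' : ∑ l ∈ A, (S l).indicator (fun _ => (1 : ℝ)) (w l) ≤ A.card / (64 * M) := hw
    change A.card / (64 * M)
      ≤ ∑ l ∈ A, (-(S l).indicator (fun _ => (1 : ℝ)) (w l)
        - ∫ x, -(S l).indicator (fun _ => (1 : ℝ)) x ∂D)
    have hint : ∀ l, ∫ x, -(S l).indicator (fun _ => (1 : ℝ)) x ∂D = -D.real (S l) := by
      intro l
      rw [integral_neg, integral_indicator_const _ (hSm l)]
      simp
    simp only [hint]
    have h2 : ∑ l ∈ A, 1 / (32 * M) ≤ ∑ l ∈ A, D.real (S l) :=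
      Finset.sum_le_sum fun l _ => small_ball hD hM1 hM hu (r (b l))
    rw [Finset.sum_const, nsmul_eq_mul] at h2
    have h3 : (A.card : ℝ) * (1 / (32 * M)) = A.card / (64 * M) + A.card / (64 * M) := by
      field_simp; norm_num
    have h4 : ∑ l ∈ A, (-(S l).indicator (fun _ => (1 : ℝ)) (w l) - -D.real (S l))
        = ∑ l ∈ A, D.real (S l) - ∑ l ∈ A, (S l).indicator (fun _ => (1 : ℝ)) (w l) := by
      rw [← Finset.sum_sub_distrib]
      exact Finset.sum_congr rfl fun l _ => by ring
    rw [h4]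
    linarith
  · congr 2
    field_simp

/-- Grid points for directions and offsets. -/
def gridVec (N : ℕ) (z : Fin d → ℤ) : Vec d := WithLp.toLp 2 fun a => (z a : ℝ) / N

def gridOff (N : ℕ) (z : Fin m → ℤ) : Fin m → ℝ := fun j => (z j : ℝ) / N

/-- Curvature of the scatter matrix follows from counts at grid points. -/
lemma curved_of_grid {b : Fin n → Fin m} {A : Finset (Fin n)} {w : Fin n → Vec d} {κ : ℝ}
    (hn : 24 ≤ n) (hd : d ≤ n) (hw : ∀ l, 24 * ‖w l‖ ≤ n)
    (h : ∀ z ∈ Fintype.piFinset fun _ : Fin d => Finset.Icc (-(n : ℤ) ^ 3) (n ^ 3),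
      ∀ z' ∈ Fintype.piFinset fun _ : Fin m => Finset.Icc (-(n : ℤ) ^ 3) (n ^ 3),
      1 / 2 ≤ ‖(gridVec (n ^ 2) z : Vec d)‖ →
        κ ≤ farCount b A (gridVec (n ^ 2) z) (gridOff (n ^ 2) z') w)
    (v : Vec d) (r : Fin m → ℝ) (hr : ∀ j, |r j| ≤ n * ‖v‖) :
    κ * ‖v‖ ^ 2 ≤ 16 * ∑ l ∈ A, ((inner ℝ (w l) v : ℝ) - r (b l)) ^ 2 := by
  have hn0 : (24 : ℝ) ≤ n := by exact_mod_cast hn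
  have hnp : (0 : ℝ) < n := by linarith
  rcases eq_or_ne v 0 with rfl | hv
  · simp only [norm_zero, ne_eq, OfNat.ofNat_ne_zero, not_false_eq_true, zero_pow, mul_zero]
    positivity
  have hv0 : 0 < ‖v‖ := norm_pos_iff.2 hv
  set v₁ := ‖v‖⁻¹ • v with hv₁
  have hv1 : ‖v₁‖ = 1 := by rw [hv₁, norm_smul, norm_inv, norm_norm, inv_mul_cancel₀ hv0.ne']
  set r₁ : Fin m → ℝ := fun j => r j / ‖v‖ with hr₁
  have hr1 : ∀ j, |r₁ j| ≤ n := fun j => by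
    rw [hr₁, abs_div, abs_norm, div_le_iff₀ hv0]; exact hr j
  set z : Fin d → ℤ := fun a => ⌊v₁ a * (n ^ 2 : ℕ)⌋ with hz
  set z' : Fin m → ℤ := fun j => ⌊r₁ j * (n ^ 2 : ℕ)⌋ with hz'
  have hN : (0 : ℝ) < ((n ^ 2 : ℕ) : ℝ) := by positivity
  have hfloor : ∀ y : ℝ, |y - (⌊y * (n ^ 2 : ℕ)⌋ : ℝ) / (n ^ 2 : ℕ)| ≤ 1 / (n ^ 2 : ℕ) := by
    intro y
    have h1 := Int.floor_le (y * (n ^ 2 : ℕ))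
    have h2 := Int.lt_floor_add_one (y * (n ^ 2 : ℕ))
    have e : y - (⌊y * (n ^ 2 : ℕ)⌋ : ℝ) / (n ^ 2 : ℕ)
        = (y * (n ^ 2 : ℕ) - ⌊y * (n ^ 2 : ℕ)⌋) / (n ^ 2 : ℕ) := by
      field_simp
    rw [e, abs_of_nonneg (div_nonneg (by linarith) hN.le)]
    gcongr
    linarith
  have hrange : ∀ y : ℝ, |y| ≤ n → ⌊y * (n ^ 2 : ℕ)⌋ ∈ Finset.Icc (-(n : ℤ) ^ 3) (n ^ 3) := by
    intro y hy
    rw [abs_le] at hy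
    rw [Finset.mem_Icc, Int.le_floor]
    constructor
    · push_cast
      nlinarith [sq_nonneg (n : ℝ)]
    · rw [← Int.cast_le (R := ℝ)]
      refine (Int.floor_le _).trans ?_
      push_cast
      nlinarith [sq_nonneg (n : ℝ)]
  set u : Vec d := gridVec (n ^ 2) z with hu
  have hua : ∀ a, |v₁ a - u a| ≤ 1 / (n ^ 2 : ℕ) := fun a => hfloor (v₁ a)
  have huv : ‖v₁ - u‖ ≤ 1 / n := by
    rw [EuclideanSpace.norm_eq]
    rw [Real.sqrt_le_left (by positivity)]
    have hdn : (d : ℝ) ≤ n := by exact_mod_cast hd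
    calc ∑ a, ‖(v₁ - u) a‖ ^ 2 ≤ ∑ _a : Fin d, (1 / ((n ^ 2 : ℕ) : ℝ)) ^ 2 := by
          refine Finset.sum_le_sum fun a _ => ?_
          have := hua a
          rw [Real.norm_eq_abs]
          gcongr
          exact this
      _ = d * (1 / (n : ℝ) ^ 4) := by
          rw [Finset.sum_const, Finset.card_univ, Fintype.card_fin, nsmul_eq_mul]
          push_cast
          field_simp
      _ ≤ n * (1 / (n : ℝ) ^ 4) := by gcongr
      _ = (1 / n) * (1 / (n : ℝ) ^ 2) := by field_simp
      _ ≤ 1 * (1 / (n : ℝ) ^ 2) := by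
          gcongr
          rw [div_le_one hnp]; linarith
      _ = (1 / (n : ℝ)) ^ 2 := by field_simp
  have hinv : (1 : ℝ) / n ≤ 1 / 24 := by gcongr
  have hunorm : 1 / 2 ≤ ‖u‖ := by
    have := norm_sub_norm_le v₁ u
    rw [hv1] at this
    linarith
  have hza : ∀ a, |v₁ a| ≤ n := fun a => by
    have := PiLp.norm_apply_le v₁ a
    rw [hv1, Real.norm_eq_abs] at this
    linarith
  have hcount := h z (Fintype.mem_piFinset.2 fun a => hrange _ (hza a)) z'
    (Fintype.mem_piFinset.2 fun j => hrange _ (hr1 j)) hunorm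
  have hpt : ∀ l ∈ A, ({x : Vec d | 1 / 3 ≤ |(inner ℝ u x : ℝ) - gridOff (n ^ 2) z' (b l)|}).indicator
      (fun _ => (1 : ℝ)) (w l) ≤ 16 * ((inner ℝ (w l) v₁ : ℝ) - r₁ (b l)) ^ 2 := by
    intro l _
    by_cases hl : 1 / 3 ≤ |(inner ℝ u (w l) : ℝ) - gridOff (n ^ 2) z' (b l)|
    · have hmem : w l ∈ {x : Vec d | 1 / 3 ≤ |(inner ℝ u x : ℝ) - gridOff (n ^ 2) z' (b l)|} := hl
      rw [Set.indicator_of_mem hmem]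
      have h1 : |(inner ℝ (v₁ - u) (w l) : ℝ)| ≤ 1 / 24 := by
        refine (abs_real_inner_le_norm _ _).trans ?_
        calc ‖v₁ - u‖ * ‖w l‖ ≤ (1 / n) * (n / 24) := by
              have := hw l
              gcongr
              linarith
          _ = _ := by field_simp
      have h2 : |r₁ (b l) - gridOff (n ^ 2) z' (b l)| ≤ 1 / 24 := by
        refine (hfloor _).trans ?_
        gcongr
        push_cast
        nlinarith
      rw [inner_sub_left] at h1
      rw [real_inner_comm v₁]
      -- Rounding to multiples of 1/n² moves the direction by at most 1/n, hence the inner product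
      -- by 1/24 as ‖w l‖ ≤ n/24, and the offset by at most 1/24. What is left is 1/3 - 2/24 = 1/4,
      -- whose square explains the factor 16.
      have h3 : 1 / 4 ≤ |(inner ℝ v₁ (w l) : ℝ) - r₁ (b l)| := by
        have e : (inner ℝ u (w l) : ℝ) - gridOff (n ^ 2) z' (b l)
            = ((inner ℝ v₁ (w l) : ℝ) - r₁ (b l)) - (inner ℝ v₁ (w l) - inner ℝ u (w l))
              + (r₁ (b l) - gridOff (n ^ 2) z' (b l)) := by ring
        have h4 := abs_add_le (((inner ℝ v₁ (w l) : ℝ) - r₁ (b l))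
          - (inner ℝ v₁ (w l) - inner ℝ u (w l))) (r₁ (b l) - gridOff (n ^ 2) z' (b l))
        have h5 := abs_sub ((inner ℝ v₁ (w l) : ℝ) - r₁ (b l))
          (inner ℝ v₁ (w l) - inner ℝ u (w l))
        rw [← e] at h4
        linarith
      rw [← sq_abs]
      nlinarith
    · have hmem : w l ∉ {x : Vec d | 1 / 3 ≤ |(inner ℝ u x : ℝ) - gridOff (n ^ 2) z' (b l)|} := hl
      rw [Set.indicator_of_notMem hmem]
      positivity
  have hsum := hcount.trans (Finset.sum_le_sum hpt)
  rw [← Finset.mul_sum] at hsum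
  have hscale : ∀ l, ((inner ℝ (w l) v : ℝ) - r (b l)) ^ 2
      = ‖v‖ ^ 2 * ((inner ℝ (w l) v₁ : ℝ) - r₁ (b l)) ^ 2 := by
    intro l
    rw [← mul_pow, hv₁, real_inner_smul_right, hr₁]
    congr 1
    field_simp
  simp only [hscale]
  rw [← Finset.mul_sum]
  calc κ * ‖v‖ ^ 2 ≤ (16 * ∑ l ∈ A, ((inner ℝ (w l) v₁ : ℝ) - r₁ (b l)) ^ 2) * ‖v‖ ^ 2 := by gcongr
    _ = _ := by ring

/-- With high probability, the scatter matrices of large sets are well conditioned. -/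
lemma eventually_curved {C c : ℝ} (K : ℝ) (hC : 0 < C) (hc : 0 < c) (q : ℕ) :
    ∀ᶠ n : ℕ in atTop, ∀ {d m : ℕ} (b : Fin n → Fin m) (D : Measure (Vec d)), Isotropic C c K D →
      ((d : ℝ) + m) * Real.log n ^ 2 ≤ 2 * n → d ≤ n →
      ∀ A : Finset (Fin n), (n : ℝ) ≤ 2 * A.card → (Measure.pi fun _ : Fin n => D)
        {w | ¬ ((∀ l, 24 * ‖w l‖ ≤ n) → ∀ v : Vec d, ∀ r : Fin m → ℝ, (∀ j, |r j| ≤ n * ‖v‖) →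
          n * ‖v‖ ^ 2 ≤ Real.log n * ∑ l ∈ A, ((inner ℝ (w l) v : ℝ) - r (b l)) ^ 2)}
        ≤ ENNReal.ofReal ((n : ℝ) ^ q)⁻¹ := by
  obtain ⟨M, hM1, hM⟩ := exists_fourthMoment K hC hc
  set g : ℝ := 8 * (64 * M) ^ 2 with hg
  have hg1 : 1 ≤ g := by rw [hg]; nlinarith
  have hlogn : ∀ᶠ n : ℕ in atTop, q * Real.log n * g ≤ n := by
    have h := (Real.isLittleO_log_id_atTop.comp_tendsto tendsto_natCast_atTop_atTop)
    have h2 := h.bound (show 0 < 1 / ((q + 1) * g) by positivity)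
    filter_upwards [h2, eventually_le_log 0] with n hn hl
    simp only [Function.comp, id, Real.norm_eq_abs, Nat.abs_cast] at hn
    rw [abs_of_nonneg hl, div_mul_eq_mul_div, one_mul, le_div_iff₀ (by positivity)] at hn
    calc _ ≤ (q + 1) * Real.log n * g := by gcongr; linarith
      _ = Real.log n * ((q + 1) * g) := by ring
      _ ≤ n := hn
  filter_upwards [eventually_le_log (16 * g), eventually_le_log (2048 * M), eventually_ge_atTop 24,
    hlogn] with n h1 h2 hn h3 d m b D hD hdm hd A hA
  have := hD.isProbabilityMeasure
  set L := Real.log n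
  have hn0 : (24 : ℝ) ≤ n := by exact_mod_cast hn
  set Gd := Fintype.piFinset fun _ : Fin d => Finset.Icc (-(n : ℤ) ^ 3) (n ^ 3)
  set Gm := Fintype.piFinset fun _ : Fin m => Finset.Icc (-(n : ℤ) ^ 3) (n ^ 3)
  have hsub : {w : Fin n → Vec d | ¬ ((∀ l, 24 * ‖w l‖ ≤ n) → ∀ v : Vec d, ∀ r : Fin m → ℝ,
        (∀ j, |r j| ≤ n * ‖v‖) →
          n * ‖v‖ ^ 2 ≤ L * ∑ l ∈ A, ((inner ℝ (w l) v : ℝ) - r (b l)) ^ 2)}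
      ⊆ ⋃ p ∈ Gd ×ˢ Gm, {w | 1 / 2 ≤ ‖(gridVec (n ^ 2) p.1 : Vec d)‖ ∧
          farCount b A (gridVec (n ^ 2) p.1) (gridOff (n ^ 2) p.2) w ≤ A.card / (64 * M)} := by
    intro w hw
    by_contra hcon
    refine hw fun hwn v r hr => ?_
    have h4 := curved_of_grid (b := b) (A := A) (κ := A.card / (64 * M)) hn hd hwn (fun z hz z' hz' hu => by
      by_contra hlt
      refine hcon (Set.mem_biUnion (Finset.mem_product.2 ⟨hz, hz'⟩ : (z, z') ∈ Gd ×ˢ Gm) ⟨hu, ?_⟩)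
      exact (not_le.1 hlt).le) v r hr
    have h5 : 0 ≤ ∑ l ∈ A, ((inner ℝ (w l) v : ℝ) - r (b l)) ^ 2 := by positivity
    have h6 : (n : ℝ) / (128 * M) ≤ A.card / (64 * M) := by
      rw [div_le_div_iff₀ (by positivity) (by positivity)]
      nlinarith
    have h7 : (n : ℝ) / (128 * M) * ‖v‖ ^ 2 ≤ 16 * ∑ l ∈ A, ((inner ℝ (w l) v : ℝ) - r (b l)) ^ 2 :=
      le_trans (by gcongr) h4
    calc (n : ℝ) * ‖v‖ ^ 2 = 128 * M * ((n : ℝ) / (128 * M) * ‖v‖ ^ 2) := by field_simp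
      _ ≤ 128 * M * (16 * ∑ l ∈ A, ((inner ℝ (w l) v : ℝ) - r (b l)) ^ 2) := by gcongr
      _ = 2048 * M * ∑ l ∈ A, ((inner ℝ (w l) v : ℝ) - r (b l)) ^ 2 := by ring
      _ ≤ _ := by gcongr
  have hpt : ∀ p ∈ Gd ×ˢ Gm, (Measure.pi fun _ : Fin n => D)
      {w | 1 / 2 ≤ ‖(gridVec (n ^ 2) p.1 : Vec d)‖ ∧
          farCount b A (gridVec (n ^ 2) p.1) (gridOff (n ^ 2) p.2) w ≤ A.card / (64 * M)}
      ≤ ENNReal.ofReal (Real.exp (-(2 * (n / g)))) := by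
    intro p _
    by_cases hp : 1 / 2 ≤ ‖(gridVec (n ^ 2) p.1 : Vec d)‖
    · refine (measure_mono fun w hw => hw.2).trans
        ((farCount_tail hD hM1 (hM D hD) b A hp _).trans (ENNReal.ofReal_le_ofReal ?_))
      apply Real.exp_le_exp.2
      rw [neg_le_neg_iff, mul_div_assoc', div_le_div_iff₀ (by positivity) (by positivity)]
      have : 0 < (64 * M) ^ 2 := by positivity
      rw [hg]
      nlinarith
    · rw [show {w : Fin n → Vec d | 1 / 2 ≤ ‖(gridVec (n ^ 2) p.1 : Vec d)‖ ∧
          farCount b A (gridVec (n ^ 2) p.1) (gridOff (n ^ 2) p.2) w ≤ A.card / (64 * M)} = ∅ from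
        Set.eq_empty_of_forall_notMem fun w hw => hp hw.1]
      simp
  refine (measure_mono hsub).trans ((measure_biUnion_finset_le _ _).trans
    ((Finset.sum_le_sum hpt).trans ?_))
  rw [Finset.sum_const, nsmul_eq_mul, ← ENNReal.ofReal_natCast, ← ENNReal.ofReal_mul (by positivity)]
  refine ENNReal.ofReal_le_ofReal ?_
  have hcard : (((Gd ×ˢ Gm).card : ℕ) : ℝ) ≤ Real.exp (4 * (d + m) * L) := by
    have e1 : (Gd ×ˢ Gm).card = (2 * n ^ 3 + 1) ^ (d + m) := by
      rw [Finset.card_product, Fintype.card_piFinset, Fintype.card_piFinset]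
      simp only [Int.card_Icc, Finset.prod_const, Finset.card_univ, Fintype.card_fin]
      have : ((n : ℤ) ^ 3 + 1 - -(n : ℤ) ^ 3).toNat = 2 * n ^ 3 + 1 := by
        have : (n : ℤ) ^ 3 + 1 - -(n : ℤ) ^ 3 = ((2 * n ^ 3 + 1 : ℕ) : ℤ) := by push_cast; ring
        rw [this, Int.toNat_natCast]
      rw [this, ← pow_add]
    rw [e1]
    push_cast
    have e2 : (2 * (n : ℝ) ^ 3 + 1) ≤ (n : ℝ) ^ 4 := by
      have : (1 : ℝ) ≤ (n : ℝ) ^ 3 := one_le_pow₀ (by linarith)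
      nlinarith
    calc (2 * (n : ℝ) ^ 3 + 1) ^ (d + m) ≤ ((n : ℝ) ^ 4) ^ (d + m) := by gcongr
      _ = Real.exp (4 * (d + m) * L) := by
        rw [← pow_mul, ← Real.rpow_natCast, Real.rpow_def_of_pos (by linarith)]
        congr 1
        push_cast
        ring
  -- Each grid point fails with probability at most exp(-2n/g). Half of the exponent pays for the
  -- n^(4(d+m)) grid points, the other half beats n^(-q).
  have hexp : 4 * ((d : ℝ) + m) * L ≤ n / g := by
    rw [le_div_iff₀ (by linarith)]
    have hL : 0 < L := by linarith
    have h5 : 4 * ((d : ℝ) + m) * L * g * L ≤ n * L := by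
      calc _ = 4 * g * (((d : ℝ) + m) * L ^ 2) := by ring
        _ ≤ 4 * g * (2 * n) := by gcongr
        _ = n * (8 * g) := by ring
        _ ≤ n * L := by gcongr; linarith
    exact le_of_mul_le_mul_right h5 hL
  calc ((Gd ×ˢ Gm).card : ℝ) * Real.exp (-(2 * (n / g)))
      ≤ Real.exp (n / g) * Real.exp (-(2 * (n / g))) := by
        gcongr
        exact hcard.trans (Real.exp_le_exp.2 hexp)
    _ = Real.exp (-(n / g)) := by rw [← Real.exp_add]; ring_nf
    _ ≤ _ := by
      rw [inv_pow_eq_exp (by omega)]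
      apply Real.exp_le_exp.2
      rw [neg_le_neg_iff, le_div_iff₀ (by linarith)]
      exact h3

end Curvature

/-! ### Regularity holds with high probability -/

section Whp

variable {Ω : Type*} [MeasurableSpace Ω] {μ : Measure Ω}

/-- The property `Q` fails with probability at most `η`. -/
def Whp (μ : Measure Ω) (η : ℝ) (Q : Ω → Prop) : Prop := μ {ω | ¬ Q ω} ≤ ENNReal.ofReal η

lemma Whp.mono {η η' : ℝ} {Q R : Ω → Prop} (h : Whp μ η Q) (hη : η ≤ η') (hQR : ∀ ω, Q ω → R ω) :
    Whp μ η' R :=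
  (measure_mono (t := {ω | ¬ Q ω}) fun ω (hω : ¬ R ω) => fun hQ => hω (hQR ω hQ)).trans (h.trans (ENNReal.ofReal_le_ofReal hη))

lemma Whp.and {η η' : ℝ} {Q R : Ω → Prop} (h : Whp μ η Q) (h' : Whp μ η' R) (hη : 0 ≤ η)
    (hη' : 0 ≤ η') : Whp μ (η + η') fun ω => Q ω ∧ R ω := by
  rw [Whp, ENNReal.ofReal_add hη hη']
  refine (measure_mono (t := {ω | ¬ Q ω} ∪ {ω | ¬ R ω}) fun ω hω => ?_).trans
    ((measure_union_le _ _).trans (add_le_add h h'))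
  by_cases hq : Q ω
  · exact Or.inr fun hr => hω ⟨hq, hr⟩
  · exact Or.inl hq

lemma Whp.forall {ι : Type*} [Fintype ι] {η N : ℝ} {Q : ι → Ω → Prop} (h : ∀ i, Whp μ η (Q i))
    (hη : 0 ≤ η) (hN : (Fintype.card ι : ℝ) ≤ N) : Whp μ (N * η) fun ω => ∀ i, Q i ω := by
  rw [Whp]
  refine (measure_mono (t := ⋃ i ∈ Finset.univ, {ω | ¬ Q i ω}) fun ω hω => ?_).trans
    ((measure_biUnion_finset_le _ _).trans ((Finset.sum_le_sum fun i _ => h i).trans ?_))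
  · have hω' : ¬ ∀ i, Q i ω := hω
    push Not at hω'
    obtain ⟨i, hi⟩ := hω'
    exact Set.mem_biUnion (Finset.mem_univ i) hi
  · rw [Finset.sum_const, nsmul_eq_mul, Finset.card_univ, ← ENNReal.ofReal_natCast,
      ← ENNReal.ofReal_mul (by positivity)]
    exact ENNReal.ofReal_le_ofReal (by gcongr)

end Whp

/-! ### Measurability, independence and the union bound for regularity. -/

section RegularWhp

open Filter

variable {n d m : ℕ}

/-- This is the independence behind the leave-one-out events: resampling features outside `A` does
not change the matrix. -/
lemma scatterMatrix_congr {b : Fin n → Fin m} {A : Finset (Fin n)} {w w' : Fin n → Vec d}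
    (h : ∀ l ∈ A, w l = w' l) : scatterMatrix b A w = scatterMatrix b A w' := by
  ext a a'
  refine Finset.sum_congr rfl fun l hl => ?_
  rw [centered_congr rfl (fun i hi => h i (Finset.mem_filter.1 hi).1) (h l hl)]

lemma measurable_centered (b : Fin n → Fin m) (A : Finset (Fin n)) (l : Fin n) :
    Measurable fun w : Fin n → Vec d => centered b A w l := by
  unfold centered center
  fun_prop

instance : MeasurableSpace (Matrix (Fin d) (Fin d) ℝ) := MeasurableSpace.pi

instance : OpensMeasurableSpace (Matrix (Fin d) (Fin d) ℝ) :=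
  inferInstanceAs (OpensMeasurableSpace (Fin d → Fin d → ℝ))

lemma measurable_scatterMatrix (b : Fin n → Fin m) (A : Finset (Fin n)) :
    Measurable fun w : Fin n → Vec d => scatterMatrix b A w := by
  refine measurable_pi_lambda _ fun a => measurable_pi_lambda _ fun a' => ?_
  simp only [scatterMatrix, Matrix.of_apply]
  have h : ∀ l (c : Fin d), Measurable fun w : Fin n → Vec d => centered b A w l c := fun l c =>
    (EuclideanSpace.proj (𝕜 := ℝ) c).continuous.measurable.comp (measurable_centered b A l)
  exact Finset.measurable_sum _ fun l _ => (h l a).mul (h l a')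

/-- Entrywise the inverse is det⁻¹ times the adjugate. With 0⁻¹ = 0 this also covers singular
matrices. -/
lemma measurable_matrix_inv : Measurable fun M : Matrix (Fin d) (Fin d) ℝ => M⁻¹ := by
  have h1 : Measurable fun M : Matrix (Fin d) (Fin d) ℝ => M.det :=
    (Continuous.matrix_det continuous_id).measurable
  refine measurable_pi_lambda _ fun a => measurable_pi_lambda _ fun a' => ?_
  have h2 : Measurable fun M : Matrix (Fin d) (Fin d) ℝ => M.adjugate a a' :=
    ((Continuous.matrix_adjugate continuous_id).matrix_elem a a').measurable
  have : (fun M : Matrix (Fin d) (Fin d) ℝ => M⁻¹ a a') = fun M => M.det⁻¹ * M.adjugate a a' := by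
    ext M
    rw [Matrix.inv_def, Matrix.smul_apply, Ring.inverse_eq_inv', smul_eq_mul]
  rw [this]
  exact h1.inv.mul h2

lemma measurable_toEuclideanLin {Ω : Type*} [MeasurableSpace Ω] {M : Ω → Matrix (Fin d) (Fin d) ℝ}
    {v : Ω → Vec d} (hM : Measurable M) (hv : Measurable v) :
    Measurable fun ω => Matrix.toEuclideanLin (M ω) (v ω) := by
  have : (fun ω => Matrix.toEuclideanLin (M ω) (v ω))
      = fun ω => WithLp.toLp 2 (Matrix.mulVec (M ω) (v ω).ofLp) := by
    ext ω; rfl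
  rw [this]
  refine (PiLp.continuous_toLp 2 _).measurable.comp (measurable_pi_lambda _ fun a => ?_)
  simp only [Matrix.mulVec, dotProduct]
  refine Finset.measurable_sum _ fun c _ => Measurable.mul ?_ ?_
  · exact (measurable_pi_apply c).comp ((measurable_pi_apply a).comp hM)
  · exact (EuclideanSpace.proj (𝕜 := ℝ) c).continuous.measurable.comp hv

lemma measurable_scatter (b : Fin n → Fin m) (A : Finset (Fin n)) {g : (Fin n → Vec d) → Vec d}
    (hg : Measurable g) : Measurable fun w => scatter b A w (g w) :=
  measurable_toEuclideanLin (measurable_scatterMatrix b A) hg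

lemma measurable_scatterInv (b : Fin n → Fin m) (A : Finset (Fin n)) {g : (Fin n → Vec d) → Vec d}
    (hg : Measurable g) : Measurable fun w => scatterInv b A w (g w) :=
  measurable_toEuclideanLin (measurable_matrix_inv.comp (measurable_scatterMatrix b A)) hg

lemma norm_le_of_coord {x : Vec d} {r : ℝ} (hr : 0 ≤ r)
    (h : ∀ a, |(inner ℝ x (EuclideanSpace.single a (1 : ℝ)) : ℝ)| ≤ r) : ‖x‖ ≤ r * √d := by
  rw [EuclideanSpace.norm_eq, Real.sqrt_le_left (by positivity), mul_pow, Real.sq_sqrt (by positivity)]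
  calc ∑ a, ‖x a‖ ^ 2 ≤ ∑ _a : Fin d, r ^ 2 := by
        refine Finset.sum_le_sum fun a _ => ?_
        have := h a
        rw [EuclideanSpace.inner_single_right] at this
        simp only [one_mul, conj_trivial] at this
        rw [Real.norm_eq_abs]
        gcongr
    _ = r ^ 2 * d := by simp [mul_comm]

/-- A random direction that does not depend on the features in `A` behaves like a fixed one. -/
lemma whp_linear_random {D : Measure (Vec d)} [IsProbabilityMeasure D] {t η : ℝ}
    (A : Finset (Fin n))
    (h : ∀ u : Vec d, Whp (Measure.pi fun _ : Fin n => D) η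
      fun w => |(inner ℝ (∑ i ∈ A, w i) u : ℝ)| ≤ t * ‖u‖)
    {g : (Fin n → Vec d) → Vec d} (hg : Measurable g) (hinv : ∀ x y, g (A.piecewise y x) = g x) :
    Whp (Measure.pi fun _ : Fin n => D) η
      fun w => |(inner ℝ (∑ i ∈ A, w i) (g w) : ℝ)| ≤ t * ‖g w‖ := by
  have hm : MeasurableSet {w : Fin n → Vec d | ¬ |(inner ℝ (∑ i ∈ A, w i) (g w) : ℝ)| ≤ t * ‖g w‖} := by
    have h1 : Measurable fun w : Fin n → Vec d => ∑ i ∈ A, w i := by fun_prop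
    have h2 : Measurable fun w : Fin n → Vec d => |(inner ℝ (∑ i ∈ A, w i) (g w) : ℝ)| := by
      fun_prop
    exact (measurableSet_le h2 (hg.norm.const_mul t)).compl
  refine measure_pi_le_of_resample D A hm fun x => ?_
  refine (measure_mono fun y hy => ?_).trans (h (g x))
  have hy' : ¬ |(inner ℝ (∑ i ∈ A, A.piecewise y x i) (g (A.piecewise y x)) : ℝ)|
      ≤ t * ‖g (A.piecewise y x)‖ := hy
  rw [hinv, Finset.sum_congr rfl fun i hi => A.piecewise_eq_of_mem y x hi] at hy'
  exact hy'

set_option maxHeartbeats 1000000 in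
-- Every field is a union over at most n² events failing with probability n^(-(q+3)), and there are
-- eleven such families. In the leave-one-out fields the test vector does not involve the features
-- it is tested on, so it may be treated as fixed.
lemma eventually_regular {C c : ℝ} (K : ℝ) (hC : 0 < C) (hc : 0 < c) {a : ℕ} (ha : 2 ≤ a * C)
    (q : ℕ) :
    ∀ᶠ n : ℕ in atTop, ∀ {d m : ℕ} (b : Fin n → Fin m) (D : Measure (Vec d)), Isotropic C c K D →
      Sizes (Real.log n ^ (2 * a + 2)) n d m b → (∀ j, 2 * ((bucket b j).card : ℝ) ≤ n) →
      ∀ e : Vec d, ‖e‖ = 1 →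
      Whp (Measure.pi fun _ : Fin n => D) ((n : ℝ) ^ q)⁻¹
        (Regular (Real.log n ^ (2 * a + 2)) b e) := by
  filter_upwards [eventually_linear K hC hc ha (q + 3), eventually_bilinear K hC hc ha (q + 3),
    eventually_curved K hC hc (q + 3), eventually_le_log 1, eventually_ge_atTop 12]
    with n hlin hbil hcur hL hn d m b D hD hs hhalf e he
  have := hD.isProbabilityMeasure
  have hT := hs.T_pos
  have hn0 := hs.n_pos
  set L := Real.log n
  set T := L ^ (2 * a + 2) with hTdef
  set P := Measure.pi fun _ : Fin n => D
  set η : ℝ := ((n : ℝ) ^ (q + 3))⁻¹ with hη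
  have hη0 : 0 ≤ η := by positivity
  have hLT : L ^ 2 ≤ T ^ 20 := by
    rw [hTdef, ← pow_mul]
    exact pow_le_pow_right₀ hL (by omega)
  have hlin' : ∀ (A : Finset (Fin n)) (u : Vec d), Whp P η
      fun w => |(inner ℝ (∑ i ∈ A, w i) u : ℝ)| ≤ T * √(A.card : ℝ) * ‖u‖ := by
    intro A u
    have := hlin D hD A u
    simpa only [Whp, not_le] using this
  have hrand : ∀ (A : Finset (Fin n)) {g : (Fin n → Vec d) → Vec d}, Measurable g →
      (∀ x y, g (A.piecewise y x) = g x) → Whp P η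
      fun w => |(inner ℝ (∑ i ∈ A, w i) (g w) : ℝ)| ≤ T * √(A.card : ℝ) * ‖g w‖ := fun A g hg hinv =>
    whp_linear_random A (hlin' A) hg hinv
  have hsing : ∀ (i : Fin n) {g : (Fin n → Vec d) → Vec d}, Measurable g →
      (∀ x y, g (({i} : Finset (Fin n)).piecewise y x) = g x) → Whp P η
      fun w => |(inner ℝ (w i) (g w) : ℝ)| ≤ T * ‖g w‖ := fun i g hg hinv => by
    have := hrand {i} hg hinv
    simpa using this
  have hdn : (d : ℝ) ≤ n := hs.d_le_n
  have hmn : (m : ℝ) ≤ n := by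
    have h1 : (1 : ℝ) ≤ T ^ 20 * √d := by nlinarith [hs.one_le_pow 20, hs.one_le_sqrt]
    exact le_trans (le_mul_of_one_le_right (by positivity) h1) (Regular.m_mul_le hs)
  have hn1 : (1 : ℝ) ≤ n := by exact_mod_cast (by omega : 1 ≤ n)
  have hnn : (n : ℝ) ≤ n ^ 2 := by nlinarith
  have hpe : ∀ (i : Fin n) (x y : Fin n → Vec d), ∀ l ∈ Finset.univ.erase i,
      ({i} : Finset (Fin n)).piecewise y x l = x l := fun i x y l hl =>
    Finset.piecewise_eq_of_notMem _ _ _ (by simpa using (Finset.mem_erase.1 hl).1)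
  have hpb : ∀ (j : Fin m) (x y : Fin n → Vec d), ∀ l ∈ Finset.univ \ bucket b j,
      (bucket b j).piecewise y x l = x l := fun j x y l hl =>
    Finset.piecewise_eq_of_notMem _ _ _ (Finset.mem_sdiff.1 hl).2
  have ev_coord_i : Whp P ((n : ℝ) ^ 2 * η) fun w => ∀ p : Fin n × Fin d,
      |(inner ℝ (w p.1) (EuclideanSpace.single p.2 (1 : ℝ)) : ℝ)| ≤ T := by
    refine Whp.forall (fun p => ?_) hη0 ?_
    · have := hlin' {p.1} (EuclideanSpace.single p.2 (1 : ℝ))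
      simpa using this
    · simp only [Fintype.card_prod, Fintype.card_fin]; push_cast; nlinarith
  have ev_coord_j : Whp P ((n : ℝ) ^ 2 * η) fun w => ∀ p : Fin m × Fin d,
      |(inner ℝ (∑ l ∈ bucket b p.1, w l) (EuclideanSpace.single p.2 (1 : ℝ)) : ℝ)|
        ≤ T * √((bucket b p.1).card : ℝ) := by
    refine Whp.forall (fun p => ?_) hη0 ?_
    · have := hlin' (bucket b p.1) (EuclideanSpace.single p.2 (1 : ℝ))
      simpa using this
    · simp only [Fintype.card_prod, Fintype.card_fin]; push_cast; nlinarith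
  have ev_inner_j : Whp P ((n : ℝ) ^ 2 * η) fun w => ∀ j : Fin m,
      |(inner ℝ (∑ l ∈ bucket b j, w l) e : ℝ)| ≤ T * √((bucket b j).card : ℝ) := by
    refine Whp.forall (fun j => ?_) hη0 (by rw [Fintype.card_fin]; linarith)
    have := hlin' (bucket b j) e
    rwa [he, mul_one] at this
  have ev_bil : Whp P ((n : ℝ) ^ 2 * η) fun w => ∀ c : Fin d,
      |∑ i, (inner ℝ (EuclideanSpace.single c (1 : ℝ)) (w i) : ℝ) * inner ℝ e (w i)
        - n * inner ℝ (EuclideanSpace.single c (1 : ℝ)) e| ≤ T * √(n : ℝ) := by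
    refine Whp.forall (fun c => ?_) hη0 (by rw [Fintype.card_fin]; linarith)
    have := hbil D hD (EuclideanSpace.single c (1 : ℝ)) e (by simp) he
    simpa only [Whp, not_le] using this
  have ev_dir : Whp P ((n : ℝ) ^ 2 * η) fun w => ∀ i : Fin n,
      |(inner ℝ (w i) (scatterInv b (Finset.univ.erase i) w e) : ℝ)|
        ≤ T * ‖scatterInv b (Finset.univ.erase i) w e‖ := by
    refine Whp.forall (fun i => ?_) hη0 (by simpa using hnn)
    refine hsing i (measurable_scatterInv b _ measurable_const) fun x y => ?_
    rw [scatterInv, scatterMatrix_congr (hpe i x y), scatterInv]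
  have ev_dev : Whp P ((n : ℝ) ^ 2 * η) fun w => ∀ i : Fin n,
      |(inner ℝ (w i) (scatterInv b (Finset.univ.erase i) w
        ((n : ℝ) • e - scatter b (Finset.univ.erase i) w e)) : ℝ)|
      ≤ T * ‖scatterInv b (Finset.univ.erase i) w
        ((n : ℝ) • e - scatter b (Finset.univ.erase i) w e)‖ := by
    refine Whp.forall (fun i => ?_) hη0 (by simpa using hnn)
    refine hsing i (measurable_scatterInv b _
      (measurable_const.sub (measurable_scatter b _ measurable_const))) fun x y => ?_
    simp only [scatterInv, scatter, scatterMatrix_congr (hpe i x y)]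
  have ev_pair : Whp P ((n : ℝ) ^ 2 * η) fun w => ∀ p : Fin n × Fin n, p.1 ≠ p.2 →
      |(inner ℝ (w p.1) (scatterInv b (Finset.univ.erase p.1) w
          (partialCentered b w p.1 p.2)) : ℝ)|
        ≤ T * ‖scatterInv b (Finset.univ.erase p.1) w (partialCentered b w p.1 p.2)‖ := by
    refine Whp.forall (fun p => ?_) hη0 (by
      simp only [Fintype.card_prod, Fintype.card_fin]; push_cast; nlinarith)
    by_cases hp : p.1 = p.2
    -- Diagonal pairs carry no claim; they are kept so that the union runs over a full product type.
    · refine Whp.mono (η := 0) (Q := fun _ => True) ?_ hη0 fun w _ h => absurd hp h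
      simp [Whp]
    · refine (hsing p.1 (g := fun w => scatterInv b (Finset.univ.erase p.1) w
        (partialCentered b w p.1 p.2)) (measurable_scatterInv b _ ?_) fun x y => ?_).mono le_rfl
          fun w h _ => h
      · unfold partialCentered; fun_prop
      · simp only [scatterInv, scatterMatrix_congr (hpe p.1 x y)]
        congr 1
        rw [partialCentered, partialCentered, hpe p.1 x y p.2 (by simpa using fun h => hp h.symm)]
        congr 2
        exact Finset.sum_congr rfl fun l hl => hpe p.1 x y l (by simpa using (Finset.mem_erase.1 hl).1)
  have ev_bdir : Whp P ((n : ℝ) ^ 2 * η) fun w => ∀ j : Fin m,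
      |(inner ℝ (∑ l ∈ bucket b j, w l) (scatterInv b (Finset.univ \ bucket b j) w e) : ℝ)|
        ≤ T * √(bucket b j).card * ‖scatterInv b (Finset.univ \ bucket b j) w e‖ := by
    refine Whp.forall (fun j => ?_) hη0 (by rw [Fintype.card_fin]; linarith)
    refine hrand (bucket b j) (measurable_scatterInv b _ measurable_const) fun x y => ?_
    simp only [scatterInv, scatterMatrix_congr (hpb j x y)]
  have ev_bpair : Whp P ((n : ℝ) ^ 2 * η) fun w => ∀ p : Fin m × Fin n, p.2 ∉ bucket b p.1 →
      |(inner ℝ (∑ l ∈ bucket b p.1, w l) (scatterInv b (Finset.univ \ bucket b p.1) w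
        (centered b (Finset.univ \ bucket b p.1) w p.2)) : ℝ)|
      ≤ T * √(bucket b p.1).card * ‖scatterInv b (Finset.univ \ bucket b p.1) w
        (centered b (Finset.univ \ bucket b p.1) w p.2)‖ := by
    refine Whp.forall (fun p => ?_) hη0 (by
      simp only [Fintype.card_prod, Fintype.card_fin]; push_cast; nlinarith)
    by_cases hp : p.2 ∈ bucket b p.1
    · refine Whp.mono (η := 0) (Q := fun _ => True) ?_ hη0 fun w _ h => absurd hp h
      simp [Whp]
    · refine (hrand (bucket b p.1) (g := fun w => scatterInv b (Finset.univ \ bucket b p.1) w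
        (centered b (Finset.univ \ bucket b p.1) w p.2))
        (measurable_scatterInv b _ (measurable_centered b _ _)) fun x y => ?_).mono le_rfl
          fun w h _ => h
      simp only [scatterInv, scatterMatrix_congr (hpb p.1 x y)]
      congr 1
      exact centered_congr rfl (fun i hi => hpb p.1 x y i (Finset.mem_filter.1 hi).1)
        (hpb p.1 x y p.2 (by simpa using hp))
  have ev_inside : Whp P ((n : ℝ) ^ 2 * η) fun w => ∀ i : Fin n,
      |(inner ℝ (w i) (scatterInv b (Finset.univ \ bucket b (b i)) w
        (∑ l ∈ (bucket b (b i)).erase i, w l)) : ℝ)|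
      ≤ T * ‖scatterInv b (Finset.univ \ bucket b (b i)) w
        (∑ l ∈ (bucket b (b i)).erase i, w l)‖ := by
    refine Whp.forall (fun i => ?_) hη0 (by simpa using hnn)
    -- Only w_i is resampled. The matrix omits the whole bucket of i, and the vector it acts on
    -- omits i, so neither moves.
    refine hsing i (measurable_scatterInv b _ (by fun_prop)) fun x y => ?_
    have h1 : ∀ l ∈ Finset.univ \ bucket b (b i), ({i} : Finset (Fin n)).piecewise y x l = x l :=
      fun l hl => hpe i x y l (Regular.sdiff_subset_erase i hl)
    simp only [scatterInv, scatterMatrix_congr h1]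
    congr 1
    exact Finset.sum_congr rfl fun l hl => hpe i x y l (by simpa using (Finset.mem_erase.1 hl).1)
  have ev_cur : Whp P ((n : ℝ) ^ 2 * η) fun w => ∀ j : Fin m, (∀ l, 24 * ‖w l‖ ≤ n) →
      ∀ v : Vec d, ∀ r : Fin m → ℝ, (∀ j, |r j| ≤ n * ‖v‖) →
          n * ‖v‖ ^ 2 ≤ L * ∑ l ∈ Finset.univ \ bucket b j, ((inner ℝ (w l) v : ℝ) - r (b l)) ^ 2 := by
    refine Whp.forall (fun j => ?_) hη0 (by rw [Fintype.card_fin]; linarith)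
    refine hcur b D hD ?_ (by exact_mod_cast hdn) _ ?_
    · have h1 : (d : ℝ) * L ^ 2 ≤ n := le_trans (by gcongr) hs.d_le
      have h2 : (m : ℝ) * L ^ 2 ≤ n := by
        refine le_trans ?_ (Regular.m_mul_le hs)
        gcongr
        exact le_trans hLT (le_mul_of_one_le_right (by positivity) hs.one_le_sqrt)
      linarith
    · rw [Finset.card_sdiff_of_subset (Finset.subset_univ _), Finset.card_univ, Fintype.card_fin,
        Nat.cast_sub ((Finset.card_le_univ _).trans_eq (Fintype.card_fin n))]
      have := hhalf j
      linarith
  have hη2 : 0 ≤ (n : ℝ) ^ 2 * η := by positivity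
  have hall := (((((((((ev_coord_i.and ev_coord_j hη2 hη2).and
    ev_inner_j (by positivity) hη2).and ev_bil (by positivity) hη2).and ev_dir (by positivity) hη2).and
    ev_dev (by positivity) hη2).and ev_pair (by positivity) hη2).and ev_bdir (by positivity) hη2).and
    ev_bpair (by positivity) hη2).and ev_inside (by positivity) hη2).and ev_cur (by positivity) hη2
  refine hall.mono ?_ ?_
  · have h12 : (12 : ℝ) ≤ n := by exact_mod_cast hn
    calc _ = 11 * ((n : ℝ) ^ 2 * η) := by ring
      _ ≤ n * ((n : ℝ) ^ 2 * η) := by gcongr; linarith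
      _ = _ := by rw [hη]; field_simp; ring
  · rintro w ⟨⟨⟨⟨⟨⟨⟨⟨⟨⟨h1, h2⟩, h4⟩, h5⟩, h6⟩, h7⟩, h8⟩, h9⟩, h10⟩, h11⟩, h12⟩
    have hnorm : ∀ i, ‖w i‖ ≤ T * √d := fun i => norm_le_of_coord hT.le fun c => h1 (i, c)
    have hTL : L ≤ T := by
      rw [hTdef]; exact le_self_pow₀ hL (by omega)
    refine ⟨fun j v r hr => ?_, hnorm, fun j => ?_, h4, ?_, h6, h7,
      fun i i' hne => h8 (i, i') hne, h9, fun j i' hi' => h10 (j, i') hi', h11⟩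
    · refine (h12 j (fun l => ?_) v r hr).trans (by gcongr)
      have h13 := hnorm l
      have h14 : 24 * (T * √(d : ℝ)) ≤ n := by
        refine le_trans ?_ hs.d_le
        have h15 : (4 : ℝ) ^ 19 ≤ T ^ 19 := pow_le_pow_left₀ (by norm_num) hs.four_le 19
        calc 24 * (T * √(d : ℝ)) ≤ T ^ 19 * (T * d) := by
              have := hs.sqrt_le
              gcongr
              linarith
          _ = _ := by ring
      linarith
    · refine (norm_le_of_coord (r := T * √((bucket b j).card : ℝ)) (by positivity)
        fun c => h2 (j, c)).trans_eq ?_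
      rw [Real.sqrt_mul (by positivity)]
      ring
    · refine (norm_le_of_coord (r := T * √(n : ℝ)) (by positivity) fun c => ?_).trans_eq ?_
      · have := h5 c
        rw [inner_sub_left, sum_inner, real_inner_smul_left]
        simp only [real_inner_smul_left]
        convert this using 3
        · refine Finset.sum_congr rfl fun i _ => ?_
          rw [real_inner_comm e (w i), real_inner_comm (EuclideanSpace.single c (1 : ℝ)) (w i),
            mul_comm]
        · rw [real_inner_comm]
      · rw [Real.sqrt_mul (by positivity)]
        ring

end RegularWhp

/-! ### Bounds for the combinatorial optimisation problems -/

section Optimisation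

variable {α : Type*} {s : Finset α} {k : ℕ} {f : α → ℝ}

/-- The condition 0 ≤ B accounts for the default value on the empty set. -/
lemma finMax_le {B : ℝ} (hB : 0 ≤ B) (h : ∀ x ∈ s, f x ≤ B) : finMax s f ≤ B := by
  rw [finMax]
  split_ifs with hs
  · exact Finset.sup'_le hs f h
  · exact hB

lemma le_finMax {x : α} (hx : x ∈ s) : f x ≤ finMax s f := by
  rw [finMax, dif_pos ⟨x, hx⟩]
  exact Finset.le_sup' f hx

lemma finMax_nonneg (h : ∀ x ∈ s, 0 ≤ f x) : 0 ≤ finMax s f := by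
  rcases s.eq_empty_or_nonempty with rfl | ⟨x, hx⟩
  · simp [finMax]
  · exact (h x hx).trans (le_finMax hx)

lemma exists_eq_finMax (hs : s.Nonempty) : ∃ x ∈ s, finMax s f = f x := by
  rw [finMax, dif_pos hs]
  exact Finset.exists_mem_eq_sup' hs f

lemma exists_eq_finMin (hs : s.Nonempty) : ∃ x ∈ s, finMin s f = f x := by
  rw [finMin, dif_pos hs]
  exact Finset.exists_mem_eq_inf' hs f

lemma finMin_le_finMax : finMin s f ≤ finMax s f := by
  rcases s.eq_empty_or_nonempty with rfl | ⟨x, hx⟩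
  · simp [finMin, finMax]
  · refine le_trans ?_ (le_finMax hx)
    rw [finMin, dif_pos ⟨x, hx⟩]
    exact Finset.inf'_le f hx

lemma exists_eq_topSum (hk : k ≤ s.card) :
    ∃ T ⊆ s, T.card = k ∧ topSum s k f = ∑ i ∈ T, f i := by
  obtain ⟨T, hT, h⟩ := exists_eq_finMax (f := fun T => ∑ i ∈ T, f i)
    (Finset.powersetCard_nonempty.2 hk)
  rw [Finset.mem_powersetCard] at hT
  exact ⟨T, hT.1, hT.2, h⟩

lemma exists_eq_bottomSum (hk : k ≤ s.card) :
    ∃ T ⊆ s, T.card = k ∧ bottomSum s k f = ∑ i ∈ T, f i := by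
  obtain ⟨T, hT, h⟩ := exists_eq_finMin (f := fun T => ∑ i ∈ T, f i)
    (Finset.powersetCard_nonempty.2 hk)
  rw [Finset.mem_powersetCard] at hT
  exact ⟨T, hT.1, hT.2, h⟩

lemma bottomSum_le_topSum : bottomSum s k f ≤ topSum s k f := finMin_le_finMax

lemma sum_le_topSum {T : Finset α} (hT : T ⊆ s) : ∑ i ∈ T, f i ≤ topSum s T.card f :=
  le_finMax (f := fun T => ∑ i ∈ T, f i) (Finset.mem_powersetCard.2 ⟨hT, rfl⟩)

/-- The part `a` is paid once per selected index, the part `h` once in total. This suits rows with a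
few large entries, such as the diagonal of a Gram matrix. -/
lemma topSum_le {a : ℝ} {h : α → ℝ} (ha : 0 ≤ a) (hh : ∀ i ∈ s, 0 ≤ h i)
    (hf : ∀ i ∈ s, f i ≤ a + h i) : topSum s k f ≤ k * a + ∑ i ∈ s, h i := by
  have h0 : 0 ≤ ∑ i ∈ s, h i := Finset.sum_nonneg hh
  refine finMax_le (by positivity) fun T hT => ?_
  rw [Finset.mem_powersetCard] at hT
  calc ∑ i ∈ T, f i ≤ ∑ i ∈ T, (a + h i) := Finset.sum_le_sum fun i hi => hf i (hT.1 hi)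
    _ = k * a + ∑ i ∈ T, h i := by
        rw [Finset.sum_add_distrib, Finset.sum_const, nsmul_eq_mul, hT.2]
    _ ≤ _ := add_le_add le_rfl
        (Finset.sum_le_sum_of_subset_of_nonneg hT.1 fun i hi _ => hh i hi)

lemma topSum_le_mul {a : ℝ} (ha : 0 ≤ a) (hf : ∀ i ∈ s, f i ≤ a) : topSum s k f ≤ k * a := by
  simpa using topSum_le (h := fun _ => 0) ha (fun _ _ => le_rfl) (by simpa using hf)

lemma topSum_nonneg (hf : ∀ i ∈ s, 0 ≤ f i) : 0 ≤ topSum s k f :=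
  finMax_nonneg fun _ hT => Finset.sum_nonneg fun i hi => hf i ((Finset.mem_powersetCard.1 hT).1 hi)

/-- A partial sum of a zero-sum family, in absolute value. -/
lemma abs_sum_le_topSum [DecidableEq α] {T : Finset α} (hT : T ⊆ s) :
    |∑ i ∈ T, f i| ≤ topSum s T.card fun i => |f i| :=
  (Finset.abs_sum_le_sum_abs _ _).trans (sum_le_topSum hT)

/-- In a zero-sum family a set and its complement have opposite sums, so the smaller of the two may
be used. -/
lemma abs_sum_le_min [DecidableEq α] (h0 : ∑ i ∈ s, f i = 0) {T : Finset α} (hT : T ⊆ s) :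
    |∑ i ∈ T, f i| ≤ topSum s (min T.card (s.card - T.card)) fun i => |f i| := by
  rcases min_choice T.card (s.card - T.card) with h | h
  · rw [h]; exact abs_sum_le_topSum hT
  · rw [h, ← Finset.card_sdiff_of_subset hT]
    have : ∑ i ∈ T, f i = -∑ i ∈ s \ T, f i := by
      have := Finset.sum_sdiff (f := f) hT
      rw [h0] at this
      linarith
    rw [this, abs_neg]
    exact abs_sum_le_topSum Finset.sdiff_subset

lemma abs_topSum_le_min [DecidableEq α] (h0 : ∑ i ∈ s, f i = 0) (hk : k ≤ s.card) :
    |topSum s k f| ≤ topSum s (min k (s.card - k)) fun i => |f i| := by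
  obtain ⟨T, hT, rfl, h⟩ := exists_eq_topSum (f := f) hk
  rw [h]
  exact abs_sum_le_min h0 hT

lemma abs_bottomSum_le_min [DecidableEq α] (h0 : ∑ i ∈ s, f i = 0) (hk : k ≤ s.card) :
    |bottomSum s k f| ≤ topSum s (min k (s.card - k)) fun i => |f i| := by
  obtain ⟨T, hT, rfl, h⟩ := exists_eq_bottomSum (f := f) hk
  rw [h]
  exact abs_sum_le_min h0 hT

end Optimisation

/-! ### KU sums and the splitting of removals among buckets. -/

section Ku

variable {n m : ℕ} {b : Fin n → Fin m} {k u : ℕ} {f : Fin n → ℝ}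

/-- The bucket maxima and the remaining indices are disjoint, so `h` is paid only once, and u + (k -
u) = k since u ≤ k. -/
lemma kuSum_le (hu : u ≤ k) {a : ℝ} {h : Fin n → ℝ} (ha : 0 ≤ a) (hh : ∀ i, 0 ≤ h i)
    (hf : ∀ i, f i ≤ a + h i) : kuSum b k u f ≤ k * a + ∑ i, h i := by
  have h1 := topSum_le (s := bucketBest b f) (k := u) ha (fun i _ => hh i) (fun i _ => hf i)
  have h2 := topSum_le (s := Finset.univ \ bucketBest b f) (k := k - u) ha (fun i _ => hh i)
    (fun i _ => hf i)
  have h3 := Finset.sum_sdiff (f := h) (Finset.subset_univ (bucketBest b f))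
  rw [Nat.cast_sub hu] at h2
  rw [kuSum, ← h3]
  linarith

/-- The bound for the norm of a sum of `k` vectors in terms of bounds for Gram matrix entries. -/
lemma kuBound_le (hu : u ≤ k) {G : Matrix (Fin n) (Fin n) ℝ} {a D : ℝ} (ha : 0 ≤ a) (hD : 0 ≤ D)
    (hoff : ∀ i i', i ≠ i' → G i i' ≤ a) (hdiag : ∀ i, G i i ≤ D) :
    kuBound b G k u ≤ √(k * (k * a + D)) := by
  refine Real.sqrt_le_sqrt ?_
  have hrow : ∀ i, kuSum b k u (fun i' => G i i') ≤ k * a + D := by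
    intro i
    have := kuSum_le (b := b) (f := fun i' => G i i') hu ha
      (h := fun i' => if i' = i then D else 0) (fun i' => by split_ifs <;> simp [hD]) fun i' => by
        split_ifs with h
        · rw [h]; linarith [hdiag i]
        · rw [add_zero]; exact hoff i i' fun h' => h h'.symm
    simpa using this
  have := kuSum_le (b := b) hu (a := k * a + D) (h := fun _ => 0) (by positivity) (fun _ => le_rfl)
    (f := fun i => kuSum b k u fun i' => G i i') (by simpa using hrow)
  simpa using this

lemma rti_le {s : Finset (Fin n)} {G : Matrix (Fin n) (Fin n) ℝ} {a D : ℝ} (ha : 0 ≤ a)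
    (hD : 0 ≤ D) (hoff : ∀ i i', i ≠ i' → G i i' ≤ a) (hdiag : ∀ i, G i i ≤ D) (l : ℕ) :
    rti s G l ≤ √(l * (l * a + D)) := by
  refine Real.sqrt_le_sqrt (topSum_le_mul (by positivity) fun i _ => ?_)
  have := topSum_le (s := s) (k := l) (f := fun i' => G i i') ha
      (h := fun i' => if i' = i then D else 0) (fun i' _ => by split_ifs <;> simp [hD]) fun i' _ => by
        split_ifs with h
        · rw [h]; linarith [hdiag i]
        · rw [add_zero]; exact hoff i i' fun h' => h h'.symm
  refine this.trans ?_
  gcongr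
  rw [Finset.sum_ite_eq']
  split_ifs
  exact le_rfl

lemma mem_allocs {κ : Fin m → ℕ} :
    κ ∈ allocs b k ↔ (∀ j, κ j ≤ (bucket b j).card) ∧ ∑ j, κ j = k := by
  simp [allocs, Fintype.mem_piFinset]

lemma mem_allocsKU {κ : Fin m → ℕ} :
    κ ∈ allocsKU b k u ↔ ((∀ j, κ j ≤ (bucket b j).card) ∧ ∑ j, κ j = k) ∧
      (Finset.univ.filter fun j => κ j ≠ 0).card = u := by
  rw [allocsKU, Finset.mem_filter, mem_allocs]

lemma le_of_mem_allocsKU {κ : Fin m → ℕ} (h : κ ∈ allocsKU b k u) : u ≤ k := by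
  obtain ⟨⟨-, h1⟩, h2⟩ := mem_allocsKU.1 h
  rw [← h1, ← h2, Finset.card_eq_sum_ones, Finset.sum_filter]
  refine Finset.sum_le_sum fun j _ => ?_
  split_ifs with h
  · omega
  · omega

lemma card_inter_bucket_alloc (T : Finset (Fin n)) :
    (fun j => (T ∩ bucket b j).card) ∈ allocs b T.card := by
  refine mem_allocs.2 ⟨fun j => Finset.card_le_card Finset.inter_subset_right, ?_⟩
  have := Finset.card_eq_sum_card_fiberwise (f := b) (s := T) (t := Finset.univ)
      (fun _ _ => Finset.mem_coe.2 (Finset.mem_univ _))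
  rw [this]
  refine Finset.sum_congr rfl fun j _ => ?_
  congr 1
  ext i
  simp [bucket]

lemma sum_inter_bucket (T : Finset (Fin n)) (f : Fin n → ℝ) :
    ∑ j, ∑ i ∈ T ∩ bucket b j, f i = ∑ i ∈ T, f i := by
  rw [← Finset.sum_fiberwise T b]
  refine Finset.sum_congr rfl fun j _ => Finset.sum_congr ?_ fun _ _ => rfl
  ext i
  simp [bucket]

/-- Splitting the removals among the buckets cannot increase the sum of the largest entries. -/
lemma sum_topSum_bucket_le {κ : Fin m → ℕ} (hκ : κ ∈ allocs b k) (f : Fin n → ℝ) :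
    ∑ j, topSum (bucket b j) (κ j) f ≤ topSum Finset.univ k f := by
  classical
  obtain ⟨h1, h2⟩ := mem_allocs.1 hκ
  choose T hT hc hs using fun j => exists_eq_topSum (f := f) (h1 j)
  have hdisj : ∀ j ∈ (Finset.univ : Finset (Fin m)), ∀ j' ∈ (Finset.univ : Finset (Fin m)), j ≠ j' →
      Disjoint (T j) (T j') := by
    intro j _ j' _ hne
    rw [Finset.disjoint_left]
    intro i hi hi'
    have e1 := mem_bucket.1 (hT j hi)
    have e2 := mem_bucket.1 (hT j' hi')
    exact hne (e1.symm.trans e2)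
  have hcard : (Finset.univ.biUnion T).card = k := by
    rw [Finset.card_biUnion hdisj, ← h2]
    exact Finset.sum_congr rfl fun j _ => hc j
  calc ∑ j, topSum (bucket b j) (κ j) f = ∑ j, ∑ i ∈ T j, f i := Finset.sum_congr rfl fun j _ => hs j
    _ = ∑ i ∈ Finset.univ.biUnion T, f i := by
        rw [Finset.sum_biUnion]
        intro j _ j' _ hne
        exact hdisj j (Finset.mem_univ _) j' (Finset.mem_univ _) hne
    _ ≤ topSum Finset.univ (Finset.univ.biUnion T).card f := sum_le_topSum (Finset.subset_univ _)
    _ = _ := by rw [hcard]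

/-- The larger of l and N - l is at least N/2. The factor N - l on the right cancels the number of
remaining samples in the reaveraging denominators. -/
lemma min_mul_le {l N : ℕ} (h : l ≤ N) :
    ((min l (N - l) : ℕ) : ℝ) * N ≤ 2 * l * (N - l) := by
  have hN : ((N - l : ℕ) : ℝ) = N - l := Nat.cast_sub h
  have hl : (0 : ℝ) ≤ l := by positivity
  have hlN : (l : ℝ) ≤ N := by exact_mod_cast h
  rw [Nat.cast_min, hN]
  rcases le_total (l : ℝ) (N - l) with h1 | h1
  · rw [min_eq_left h1]; nlinarith
  · rw [min_eq_right h1]; nlinarith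

end Ku


/-! ### The output of the algorithm on typical data -/

section Typical

variable {n d m : ℕ}

/-- Data on which residuals, projections and Gram matrix entries have typical sizes. Here `r` and `z`
are the scales of the residuals and of the projections. -/
structure Typical (P t r z s N₀ : ℝ) (b : Fin n → Fin m) (X : Fin n → Vec d) (Y : Fin n → ℝ)
    (e : Vec d) : Prop where
  resid_le : ∀ i, |resid b X Y i| ≤ P * r
  zproj_le : ∀ i, |Zproj b X e i| ≤ P * z
  sum_resid : ∀ j, ∑ i ∈ bucket b j, resid b X Y i = 0
  sum_zproj : ∀ j, ∑ i ∈ bucket b j, Zproj b X e i = 0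
  resid_count : ∀ j, P ^ 3 * ((bucket b j).filter fun i => t * r < |resid b X Y i|).card
    ≤ (bucket b j).card
  zproj_count : ∀ j, P ^ 3 * ((bucket b j).filter fun i => t * z < |Zproj b X e i|).card
    ≤ (bucket b j).card
  gram_diag : ∀ i, |gram b X i i| ≤ P * d / n
  gram_off : ∀ i i', i ≠ i' → |gram b X i i'| ≤ P * √d / n
  large : ∃ I : Finset (Fin n), N₀ ≤ I.card ∧ ∀ i ∈ I, s * (r * z) ≤ resid b X Y i * Zproj b X e i

variable {P t r z s N₀ : ℝ} {b : Fin n → Fin m} {X : Fin n → Vec d} {Y : Fin n → ℝ} {e : Vec d}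

/-- The first bound treats every entry as large. In the second, at most N/P³ entries exceed t·r and
cost P·r each, for a total of N·r/P². -/
lemma topSum_abs_le {f : Fin n → ℝ} {j : Fin m} (hP : 1 ≤ P) (ht : 1 ≤ t) (hr : 0 < r)
    (hf : ∀ i, |f i| ≤ P * r)
    (hc : P ^ 3 * ((bucket b j).filter fun i => t * r < |f i|).card ≤ (bucket b j).card) (l : ℕ) :
    topSum (bucket b j) l (fun i => |f i|) ≤ r * (P * l) ∧
      P ^ 2 * topSum (bucket b j) l (fun i => |f i|) ≤ r * (P ^ 2 * l * t + (bucket b j).card) := by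
  constructor
  · refine (topSum_le_mul (a := P * r) (by positivity) fun i _ => hf i).trans_eq (by ring)
  · have h1 := topSum_le (s := bucket b j) (k := l) (f := fun i => |f i|) (a := t * r)
      (h := fun i => if t * r < |f i| then P * r else 0) (by positivity)
      (fun i _ => by split_ifs <;> positivity) fun i _ => by
        split_ifs with h
        · have := hf i
          have : 0 ≤ t * r := by positivity
          linarith
        · rw [add_zero]; exact not_lt.1 h
    rw [← Finset.sum_filter, Finset.sum_const, nsmul_eq_mul] at h1
    calc P ^ 2 * topSum (bucket b j) l (fun i => |f i|)
        ≤ P ^ 2 * (l * (t * r) + ((bucket b j).filter fun i => t * r < |f i|).card * (P * r)) := by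
          gcongr
      _ = r * (P ^ 2 * l * t) + r * (P ^ 3 * ((bucket b j).filter fun i => t * r < |f i|).card) := by
          ring
      _ ≤ _ := by rw [mul_add]; gcongr

/-- Let σ = min(l, N-l). If P²σ ≥ N, the second bounds give factors 2σt and the product is 4t²σ²·r·z
with 2σ ≤ N. If P²σ ≤ N, the first bounds give P²σ² ≤ σN. In both cases σN ≤ 2l(N-l) finishes, and
no power of P survives. -/
lemma product_le {N l : ℕ} {P t r z x y : ℝ} (hP : 1 ≤ P) (ht : 1 ≤ t) (hr : 0 < r) (hz : 0 < z)
    (hl : l ≤ N) (hy0 : 0 ≤ y)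
    (hx : x ≤ r * (P * (min l (N - l) : ℕ)) ∧ P ^ 2 * x ≤ r * (P ^ 2 * (min l (N - l) : ℕ) * t + N))
    (hy : y ≤ z * (P * (min l (N - l) : ℕ)) ∧ P ^ 2 * y ≤ z * (P ^ 2 * (min l (N - l) : ℕ) * t + N)) :
    x * y ≤ (4 * t ^ 2 + 2) * (r * z) * l * (N - l) := by
  have h1 := min_mul_le hl
  have h2 : 2 * ((min l (N - l) : ℕ) : ℝ) ≤ N := by
    have : 2 * min l (N - l) ≤ N := by omega
    exact_mod_cast this
  set σ : ℝ := ((min l (N - l) : ℕ) : ℝ)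
  have hσ : 0 ≤ σ := by positivity
  have hlN : (0 : ℝ) ≤ l * (N - l) := mul_nonneg (by positivity) (by
    have : (l : ℝ) ≤ N := by exact_mod_cast hl
    linarith)
  rcases le_total (N : ℝ) (P ^ 2 * σ) with h | h
  · have h3 : x ≤ r * (2 * σ * t) := by
      have h4 : P ^ 2 * x ≤ P ^ 2 * (r * (2 * σ * t)) := by
        refine hx.2.trans ?_
        have : (N : ℝ) ≤ P ^ 2 * σ * t := h.trans (le_mul_of_one_le_right (by positivity) ht)
        calc _ ≤ r * (P ^ 2 * σ * t + P ^ 2 * σ * t) := by gcongr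
          _ = _ := by ring
      exact le_of_mul_le_mul_left h4 (by positivity)
    have h5 : y ≤ z * (2 * σ * t) := by
      have h4 : P ^ 2 * y ≤ P ^ 2 * (z * (2 * σ * t)) := by
        refine hy.2.trans ?_
        have : (N : ℝ) ≤ P ^ 2 * σ * t := h.trans (le_mul_of_one_le_right (by positivity) ht)
        calc _ ≤ z * (P ^ 2 * σ * t + P ^ 2 * σ * t) := by gcongr
          _ = _ := by ring
      exact le_of_mul_le_mul_left h4 (by positivity)
    calc x * y ≤ (r * (2 * σ * t)) * (z * (2 * σ * t)) := by gcongr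
      _ = 2 * t ^ 2 * (r * z) * (σ * (2 * σ)) := by ring
      _ ≤ 2 * t ^ 2 * (r * z) * (σ * N) := by gcongr
      _ ≤ 2 * t ^ 2 * (r * z) * (2 * l * (N - l)) := by gcongr
      _ = (4 * t ^ 2) * (r * z) * (l * (N - l)) := by ring
      _ ≤ (4 * t ^ 2 + 2) * (r * z) * (l * (N - l)) := by gcongr; linarith
      _ = _ := by ring
  · calc x * y ≤ (r * (P * σ)) * (z * (P * σ)) := by
          have := hx.1
          have := hy.1
          gcongr
      _ = (r * z) * (σ * (P ^ 2 * σ)) := by ring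
      _ ≤ (r * z) * (σ * N) := by gcongr
      _ ≤ (r * z) * (2 * l * (N - l)) := by gcongr
      _ = 2 * (r * z) * (l * (N - l)) := by ring
      _ ≤ (4 * t ^ 2 + 2) * (r * z) * (l * (N - l)) := by
          gcongr
          nlinarith
      _ = _ := by ring

/-- The scales are admissible. -/
structure Scales (P t r z : ℝ) (n d m : ℕ) (b : Fin n → Fin m) : Prop where
  one_le_P : 1 ≤ P
  one_le_t : 1 ≤ t
  r_pos : 0 < r
  z_pos : 0 < z
  n_pos : (0 : ℝ) < n
  d_le : 32 * P ^ 3 * d ≤ n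
  bucket_ge : ∀ j, √(d : ℝ) ≤ (bucket b j).card

namespace Typical

variable (hs : Scales P t r z n d m b) (h : Typical P t r z s N₀ b X Y e)
include hs h

lemma corner_le {j : Fin m} {l : ℕ} (hl : l ≤ (bucket b j).card) {x y : ℝ}
    (hx : |x| ≤ topSum (bucket b j) (min l ((bucket b j).card - l)) fun i => |resid b X Y i|)
    (hy : |y| ≤ topSum (bucket b j) (min l ((bucket b j).card - l)) fun i => |Zproj b X e i|) :
    |x * y| ≤ (4 * t ^ 2 + 2) * (r * z) * l * ((bucket b j).card - l) := by
  rw [abs_mul]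
  refine (mul_le_mul hx hy (abs_nonneg _) (topSum_nonneg fun _ _ => abs_nonneg _)).trans ?_
  exact product_le hs.one_le_P hs.one_le_t hs.r_pos hs.z_pos hl
    (topSum_nonneg fun _ _ => abs_nonneg _)
    (topSum_abs_le hs.one_le_P hs.one_le_t hs.r_pos h.resid_le (h.resid_count j) _)
    (topSum_abs_le hs.one_le_P hs.one_le_t hs.z_pos h.zproj_le (h.zproj_count j) _)

lemma cPlus_le {j : Fin m} {l : ℕ} (hl : l ≤ (bucket b j).card) :
    cPlus b X Y e j l ≤ (4 * t ^ 2 + 2) * (r * z) * l * ((bucket b j).card - l) := by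
  classical
  refine max_le ((le_abs_self _).trans ?_) ((le_abs_self _).trans ?_)
  · exact h.corner_le hs hl (abs_topSum_le_min (h.sum_resid j) hl) (abs_topSum_le_min (h.sum_zproj j) hl)
  · exact h.corner_le hs hl (abs_bottomSum_le_min (h.sum_resid j) hl)
      (abs_bottomSum_le_min (h.sum_zproj j) hl)

lemma le_cMinus {j : Fin m} {l : ℕ} (hl : l ≤ (bucket b j).card) :
    -((4 * t ^ 2 + 2) * (r * z) * l * ((bucket b j).card - l)) ≤ cMinus b X Y e j l := by
  classical
  refine le_min ((neg_le_neg ?_).trans (neg_abs_le _)) ((neg_le_neg ?_).trans (neg_abs_le _))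
  · exact h.corner_le hs hl (abs_bottomSum_le_min (h.sum_resid j) hl)
      (abs_topSum_le_min (h.sum_zproj j) hl)
  · exact h.corner_le hs hl (abs_topSum_le_min (h.sum_resid j) hl)
      (abs_bottomSum_le_min (h.sum_zproj j) hl)

omit hs h in
-- r⁺z⁺ + r⁻z⁻ - r⁻z⁺ - r⁺z⁻ = (r⁺ - r⁻)(z⁺ - z⁻) ≥ 0, so the larger of the first two products is at
-- least the smaller of the last two.
lemma cMinus_le_cPlus (j : Fin m) (l : ℕ) : cMinus b X Y e j l ≤ cPlus b X Y e j l := by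
  have h1 : bottomSum (bucket b j) l (resid b X Y) ≤ topSum (bucket b j) l (resid b X Y) :=
    bottomSum_le_topSum
  have h2 : bottomSum (bucket b j) l (Zproj b X e) ≤ topSum (bucket b j) l (Zproj b X e) :=
    bottomSum_le_topSum
  rw [cMinus, cPlus]
  by_contra hcon
  rw [not_le, max_lt_iff, lt_min_iff, lt_min_iff] at hcon
  nlinarith [mul_nonneg (sub_nonneg.2 h1) (sub_nonneg.2 h2)]

lemma bucketBound_plus_le {j : Fin m} {l : ℕ} (hl : l ≤ (bucket b j).card) :
    bucketBound b X Y e (cPlus b X Y e) j l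
      ≤ dTerm b X Y e j l + (4 * t ^ 2 + 2) * (r * z) * l := by
  have := hs.r_pos
  have := hs.z_pos
  rw [bucketBound]
  split_ifs with heq
  · have : 0 ≤ (4 * t ^ 2 + 2) * (r * z) * l := by positivity
    linarith
  · have hpos : (0 : ℝ) < (bucket b j).card - l := by
      have : l < (bucket b j).card := lt_of_le_of_ne hl heq
      rw [sub_pos]; exact_mod_cast this
    gcongr
    rw [div_le_iff₀ hpos]
    exact h.cPlus_le hs hl

lemma le_bucketBound_minus {j : Fin m} {l : ℕ} (hl : l ≤ (bucket b j).card) :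
    dTerm b X Y e j l - (4 * t ^ 2 + 2) * (r * z) * l
      ≤ bucketBound b X Y e (cMinus b X Y e) j l := by
  have := hs.r_pos
  have := hs.z_pos
  rw [bucketBound]
  split_ifs with heq
  · have : 0 ≤ (4 * t ^ 2 + 2) * (r * z) * l := by positivity
    linarith
  · have hpos : (0 : ℝ) < (bucket b j).card - l := by
      have : l < (bucket b j).card := lt_of_le_of_ne hl heq
      rw [sub_pos]; exact_mod_cast this
    rw [sub_eq_add_neg]
    gcongr
    rw [le_div_iff₀ hpos, neg_mul]
    exact h.le_cMinus hs hl

omit hs h in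
lemma influenceMinus_le_influencePlus (k : ℕ) :
    influenceMinus b X Y e k ≤ influencePlus b X Y e k := by
  have hpt : ∀ κ ∈ allocs b k, ∑ j, bucketBound b X Y e (cMinus b X Y e) j (κ j)
      ≤ ∑ j, bucketBound b X Y e (cPlus b X Y e) j (κ j) := by
    intro κ hκ
    refine Finset.sum_le_sum fun j _ => ?_
    have hl := (mem_allocs.1 hκ).1 j
    rw [bucketBound, bucketBound]
    split_ifs
    · exact le_rfl
    · have hpos : (0 : ℝ) ≤ (bucket b j).card - κ j := by
        rw [sub_nonneg]; exact_mod_cast hl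
      gcongr
      exact cMinus_le_cPlus j (κ j)
  rw [influenceMinus, influencePlus, knapsack, knapsack]
  rcases (allocs b k).eq_empty_or_nonempty with h0 | h0
  · simp [finMax, h0]
  · obtain ⟨κ, hκ, h1⟩ := exists_eq_finMax
      (f := fun κ : Fin m → ℕ => ∑ j, bucketBound b X Y e (cMinus b X Y e) j (κ j)) h0
    rw [h1]
    exact (hpt κ hκ).trans
      (le_finMax (f := fun κ : Fin m → ℕ => ∑ j, bucketBound b X Y e (cPlus b X Y e) j (κ j)) hκ)

omit hs h in
lemma allocs_nonempty {k : ℕ} (hk : k ≤ n) : (allocs b k).Nonempty := by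
  obtain ⟨T, -, hT⟩ := Finset.exists_subset_card_eq (s := (Finset.univ : Finset (Fin n))) (n := k)
    (by simpa using hk)
  exact ⟨_, hT ▸ card_inter_bucket_alloc (b := b) T⟩

/-- The direct terms of an allocation are sums over disjoint sets of k samples in total, and the
corrections are linear in k_j. -/
lemma influencePlus_le {k : ℕ} (hk : k ≤ n) :
    influencePlus b X Y e k ≤ topSum Finset.univ k (fun i => resid b X Y i * Zproj b X e i)
      + (4 * t ^ 2 + 2) * (r * z) * k := by
  obtain ⟨κ, hκ, h1⟩ := exists_eq_finMax
    (f := fun κ : Fin m → ℕ => ∑ j, bucketBound b X Y e (cPlus b X Y e) j (κ j))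
    (allocs_nonempty (b := b) hk)
  rw [influencePlus, knapsack, h1]
  have h2 := sum_topSum_bucket_le hκ fun i => resid b X Y i * Zproj b X e i
  obtain ⟨h3, h4⟩ := mem_allocs.1 hκ
  calc _ ≤ ∑ j, (dTerm b X Y e j (κ j) + (4 * t ^ 2 + 2) * (r * z) * κ j) :=
        Finset.sum_le_sum fun j _ => h.bucketBound_plus_le hs (h3 j)
    _ = ∑ j, dTerm b X Y e j (κ j) + (4 * t ^ 2 + 2) * (r * z) * k := by
        rw [Finset.sum_add_distrib, ← Finset.mul_sum, ← Nat.cast_sum, h4]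
    _ ≤ _ := by gcongr; exact h2

/-- Evaluate the knapsack at the allocation induced by a globally optimal k-element set. -/
lemma le_influenceMinus {k : ℕ} (hk : k ≤ n) :
    topSum Finset.univ k (fun i => resid b X Y i * Zproj b X e i)
      - (4 * t ^ 2 + 2) * (r * z) * k ≤ influenceMinus b X Y e k := by
  obtain ⟨T, -, hT, h1⟩ := exists_eq_topSum (s := (Finset.univ : Finset (Fin n))) (k := k)
    (f := fun i => resid b X Y i * Zproj b X e i) (by simpa using hk)
  have hκ := card_inter_bucket_alloc (b := b) T
  rw [hT] at hκ
  obtain ⟨h3, h4⟩ := mem_allocs.1 hκ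
  refine le_trans ?_ (le_finMax
    (f := fun κ : Fin m → ℕ => ∑ j, bucketBound b X Y e (cMinus b X Y e) j (κ j)) hκ)
  calc _ = ∑ j, (∑ i ∈ T ∩ bucket b j, resid b X Y i * Zproj b X e i
          - (4 * t ^ 2 + 2) * (r * z) * (T ∩ bucket b j).card) := by
        rw [Finset.sum_sub_distrib, sum_inter_bucket, h1, ← Finset.mul_sum, ← Nat.cast_sum, h4]
    _ ≤ ∑ j, (dTerm b X Y e j (T ∩ bucket b j).card
          - (4 * t ^ 2 + 2) * (r * z) * (T ∩ bucket b j).card) := by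
        gcongr with j
        exact sum_le_topSum Finset.inter_subset_right
    _ ≤ _ := Finset.sum_le_sum fun j _ => h.le_bucketBound_minus hs (h3 j)

omit hs in
lemma le_topSum_influence {k : ℕ} (hk : (k : ℝ) ≤ N₀) :
    s * (r * z) * k ≤ topSum Finset.univ k (fun i => resid b X Y i * Zproj b X e i) := by
  obtain ⟨I, hI, h1⟩ := h.large
  obtain ⟨T, hT, hTk⟩ := Finset.exists_subset_card_eq (s := I) (n := k)
    (by exact_mod_cast hk.trans hI)
  have h2 := sum_le_topSum (s := Finset.univ) (f := fun i => resid b X Y i * Zproj b X e i)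
    (Finset.subset_univ T)
  rw [hTk] at h2
  refine le_trans ?_ h2
  calc s * (r * z) * k = ∑ _i ∈ T, s * (r * z) := by
        rw [Finset.sum_const, nsmul_eq_mul, hTk]; ring
    _ ≤ _ := Finset.sum_le_sum fun i hi => h1 i (hT hi)

end Typical
end Typical

/-! ### Higher order terms on typical data -/

section HigherOrder

variable {n d m : ℕ} {P t r z s N₀ : ℝ} {b : Fin n → Fin m} {X : Fin n → Vec d} {Y : Fin n → ℝ}
  {e : Vec d}

lemma kuBound_nonneg (G : Matrix (Fin n) (Fin n) ℝ) (k u : ℕ) : 0 ≤ kuBound b G k u :=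
  Real.sqrt_nonneg _

lemma symmetrize_le (j : Fin m) (f : ℕ → ℝ) (l : ℕ) :
    symmetrize b j f l ≤ f (min l ((bucket b j).card - l)) := by
  rw [symmetrize]
  rcases min_choice l ((bucket b j).card - l) with h | h <;> rw [h]
  · exact min_le_left _ _
  · exact min_le_right _ _

lemma Mterm_nonneg (j : Fin m) (l : ℕ) : 0 ≤ Mterm b X j l :=
  le_min (Real.sqrt_nonneg _) (Real.sqrt_nonneg _)

lemma symmetrize_topSum_abs_nonneg (f : Fin n → ℝ) (j : Fin m) (l : ℕ) :
    0 ≤ symmetrize b j (fun l => topSum (bucket b j) l fun i => |f i|) l :=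
  le_min (topSum_nonneg fun _ _ => abs_nonneg _) (topSum_nonneg fun _ _ => abs_nonneg _)

lemma knapsackKU_nonneg {k u : ℕ} {f : Fin m → ℕ → ℝ}
    (hf : ∀ j l, l ≤ (bucket b j).card → 0 ≤ f j l) : 0 ≤ knapsackKU b k u f :=
  finMax_nonneg fun _ hκ => Finset.sum_nonneg fun j _ => hf j _ ((mem_allocsKU.1 hκ).1.1 j)

/-- Scores that grow at most linearly give a knapsack value that grows at most linearly. -/
lemma knapsackKU_le {k u : ℕ} {f : Fin m → ℕ → ℝ} {a : ℝ} (ha : 0 ≤ a)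
    (hf : ∀ j l, l ≤ (bucket b j).card → f j l ≤ a * l) : knapsackKU b k u f ≤ a * k := by
  refine finMax_le (by positivity) fun κ hκ => ?_
  obtain ⟨⟨h1, h2⟩, -⟩ := mem_allocsKU.1 hκ
  calc _ ≤ ∑ j, a * (κ j : ℝ) := Finset.sum_le_sum fun j _ => hf j _ (h1 j)
    _ = _ := by rw [← Finset.mul_sum, ← Nat.cast_sum, h2]

/-- Quotients by the number of remaining samples; the case of an emptied bucket is covered by the
convention for division by zero. -/
lemma div_remaining_le {N l : ℕ} {x a : ℝ} (ha : 0 ≤ a) (hl : l ≤ N)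
    (h : x ≤ a * (l * (N - l))) : x / ((N : ℝ) - l) ≤ a * l := by
  have hlN : (0 : ℝ) ≤ N - l := by rw [sub_nonneg]; exact_mod_cast hl
  rcases hlN.eq_or_lt with h0 | h0
  · rw [← h0, div_zero]; positivity
  · rw [div_le_iff₀ h0]; linarith

lemma div_remaining_nonneg {N l : ℕ} {x : ℝ} (hx : 0 ≤ x) (hl : l ≤ N) : 0 ≤ x / ((N : ℝ) - l) :=
  div_nonneg hx (by rw [sub_nonneg]; exact_mod_cast hl)

lemma indirectXR_nonneg (k u : ℕ) : 0 ≤ indirectXR b X Y k u :=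
  knapsackKU_nonneg fun _ _ hl =>
    div_remaining_nonneg (mul_nonneg (Mterm_nonneg _ _) (symmetrize_topSum_abs_nonneg _ _ _)) hl

lemma indirectXZ_nonneg (k u : ℕ) : 0 ≤ indirectXZ b X e k u :=
  knapsackKU_nonneg fun _ _ hl =>
    div_remaining_nonneg (mul_nonneg (Mterm_nonneg _ _) (symmetrize_topSum_abs_nonneg _ _ _)) hl

namespace Typical

variable (hs : Scales P t r z n d m b) (h : Typical P t r z s N₀ b X Y e)
include hs h

/-- The diagonal contribution d is at most √d·N because N ≥ √d, so it merges with the off-diagonal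
one. -/
lemma Mterm_sq_le (j : Fin m) (l : ℕ) :
    Mterm b X j l ^ 2
      ≤ (min l ((bucket b j).card - l) : ℕ) * (bucket b j).card * (2 * P * √d / n) := by
  have hP := hs.one_le_P
  have hn := hs.n_pos
  have hN := hs.bucket_ge j
  have h1 : Mterm b X j l ≤ √((min l ((bucket b j).card - l) : ℕ) *
      ((min l ((bucket b j).card - l) : ℕ) * (P * √d / n) + P * d / n)) :=
    (symmetrize_le j _ l).trans (rti_le (by positivity) (by positivity)
      (fun i i' hne => (le_abs_self _).trans (h.gram_off i i' hne))
      (fun i => (le_abs_self _).trans (h.gram_diag i)) _)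
  have h2 : ((min l ((bucket b j).card - l) : ℕ) : ℝ) ≤ (bucket b j).card := by
    exact_mod_cast (by omega : min l ((bucket b j).card - l) ≤ (bucket b j).card)
  have hd : (d : ℝ) = √d * √d := (Real.mul_self_sqrt (by positivity)).symm
  refine (pow_le_pow_left₀ (Mterm_nonneg j l) h1 2).trans ?_
  rw [Real.sq_sqrt (by positivity), mul_assoc]
  gcongr
  calc _ ≤ (bucket b j).card * (P * √d / n) + P * (√d * √d) / n := by
        rw [← hd]; gcongr
    _ ≤ (bucket b j).card * (P * √d / n) + P * ((bucket b j).card * √d) / n := by gcongr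
    _ = _ := by ring

lemma indirectCS_le (k u : ℕ) : indirectCS b X k u ≤ 4 * P * √d / n * k := by
  have hP := hs.one_le_P
  have hn := hs.n_pos
  refine knapsackKU_le (by positivity) fun j l hl => div_remaining_le (by positivity) hl ?_
  refine (h.Mterm_sq_le hs j l).trans ?_
  calc _ ≤ 2 * l * ((bucket b j).card - l) * (2 * P * √d / n) :=
        mul_le_mul_of_nonneg_right (min_mul_le hl) (by positivity)
    _ = _ := by ring

omit h in
-- Only one factor needs the small size min(l, N-l): here the sum of |f|, while `Mterm` is bounded
-- through N. Their product is then controlled by `min_mul_le`. Used for residuals and for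
-- projections.
lemma Mterm_mul_le (hM : ∀ j l, Mterm b X j l ^ 2
      ≤ (min l ((bucket b j).card - l) : ℕ) * (bucket b j).card * (2 * P * √d / n))
    {f : Fin n → ℝ} {r : ℝ} (hr : 0 < r) (hf : ∀ i, |f i| ≤ P * r) (k u : ℕ) :
    knapsackKU b k u (fun j l => Mterm b X j l *
      symmetrize b j (fun l => topSum (bucket b j) l fun i => |f i|) l /
        (((bucket b j).card : ℝ) - (l : ℝ))) ≤ 2 * P * r * √(2 * P * √d / n) * k := by
  have hP := hs.one_le_P
  have hn := hs.n_pos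
  refine knapsackKU_le (by positivity) fun j l hl => div_remaining_le (by positivity) hl ?_
  have h2 : ((min l ((bucket b j).card - l) : ℕ) : ℝ) ≤ (bucket b j).card := by
    exact_mod_cast (by omega : min l ((bucket b j).card - l) ≤ (bucket b j).card)
  have h1 : Mterm b X j l ≤ (bucket b j).card * √(2 * P * √d / n) := by
    refine le_of_sq_le_sq ((hM j l).trans ?_) (by positivity)
    rw [mul_pow, Real.sq_sqrt (by positivity), sq]
    gcongr
  have h3 : symmetrize b j (fun l => topSum (bucket b j) l fun i => |f i|) l
      ≤ (min l ((bucket b j).card - l) : ℕ) * (P * r) :=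
    (symmetrize_le j _ l).trans (topSum_le_mul (by positivity) fun i _ => hf i)
  calc _ ≤ ((bucket b j).card * √(2 * P * √d / n)) *
        ((min l ((bucket b j).card - l) : ℕ) * (P * r)) :=
        mul_le_mul h1 h3 (symmetrize_topSum_abs_nonneg _ _ _) (by positivity)
    _ = ((min l ((bucket b j).card - l) : ℕ) * (bucket b j).card) *
        (P * r * √(2 * P * √d / n)) := by ring
    _ ≤ (2 * l * ((bucket b j).card - l)) * (P * r * √(2 * P * √d / n)) :=
        mul_le_mul_of_nonneg_right (min_mul_le hl) (by positivity)
    _ = _ := by ring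

omit h in
lemma direct_le (hG : ∀ i, |gram b X i i| ≤ P * d / n)
    (hG' : ∀ i i', i ≠ i' → |gram b X i i'| ≤ P * √d / n)
    {f : Fin n → ℝ} {r : ℝ} (hr : 0 < r) (hf : ∀ i, |f i| ≤ P * r) {k u : ℕ} (hu : u ≤ k) :
    kuBound b (Matrix.of fun i i' => f i * gram b X i i' * f i') k u
      ≤ r * √(P ^ 3 * (k * (k * √d + d)) / n) := by
  have hP := hs.one_le_P
  have hn := hs.n_pos
  have key : ∀ i i' : Fin n, ∀ g a : ℝ, |g| ≤ P * a / n → 0 ≤ a →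
      f i * g * f i' ≤ P ^ 3 * r ^ 2 * a / n := by
    intro i i' g a hg ha
    refine (le_abs_self _).trans ?_
    rw [abs_mul, abs_mul]
    have h1 := hf i
    have h2 := hf i'
    calc _ ≤ (P * r) * (P * a / n) * (P * r) := by gcongr
      _ = _ := by ring
  refine (kuBound_le hu (a := P ^ 3 * r ^ 2 * √d / n) (D := P ^ 3 * r ^ 2 * d / n) (by positivity)
    (by positivity) (fun i i' hne => key i i' _ _ (hG' i i' hne) (by positivity))
    (fun i => key i i _ _ (hG i) (by positivity))).trans_eq ?_
  rw [← Real.sqrt_sq hr.le, ← Real.sqrt_mul (by positivity), Real.sqrt_sq hr.le]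
  congr 1
  ring

lemma directCS_le {k u : ℕ} (hu : u ≤ k) :
    directCS b X k u ≤ √((P * k * √d / n) ^ 2 + P ^ 2 * k * d ^ 2 / n ^ 2) := by
  have hP := hs.one_le_P
  have hn := hs.n_pos
  refine (kuBound_le hu (a := (P * √d / n) ^ 2) (D := (P * d / n) ^ 2) (by positivity)
    (by positivity) (fun i i' hne => ?_) (fun i => ?_)).trans_eq ?_
  · exact sq_le_sq' (by linarith [abs_le.1 (h.gram_off i i' hne)])
      ((le_abs_self _).trans (h.gram_off i i' hne))
  · exact sq_le_sq' (by linarith [abs_le.1 (h.gram_diag i)])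
      ((le_abs_self _).trans (h.gram_diag i))
  · congr 1
    ring

omit h in
/-- A bound for both factors in the numerator of the higher order terms, relative to their scale. -/
lemma factor_sq_le (k : ℕ) (hk : 300 * P ^ 3 * k * √d ≤ n) :
    (√(P ^ 3 * (k * (k * √d + d)) / n) + 2 * P * √(2 * P * √d / n) * k) ^ 2 ≤ k / 2 := by
  have hP := hs.one_le_P
  have hn := hs.n_pos
  have hd := hs.d_le
  set x := √(P ^ 3 * (k * (k * √d + d)) / n) with hx
  set y := √(2 * P * √d / n) with hy
  have hx2 : x ^ 2 = P ^ 3 * (k * (k * √d + d)) / n := Real.sq_sqrt (by positivity)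
  have hy2 : y ^ 2 = 2 * P * √d / n := Real.sq_sqrt (by positivity)
  have h1 : (x + 2 * P * y * k) ^ 2 ≤ 2 * x ^ 2 + 8 * P ^ 2 * k ^ 2 * y ^ 2 := by
    nlinarith [sq_nonneg (x - 2 * P * y * k)]
  refine h1.trans ?_
  rw [hx2, hy2]
  have h2 : P ^ 3 * k * √d / n ≤ 1 / 300 := by
    rw [div_le_iff₀ hn]; linarith
  have h3 : P ^ 3 * d / n ≤ 1 / 32 := by
    rw [div_le_iff₀ hn]; linarith
  -- The coefficient 18 is 2 from the direct and 16 from the indirect off-diagonal part; the last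
  -- summand is the direct diagonal part.
  calc _ = k * (18 * (P ^ 3 * k * √d / n) + 2 * (P ^ 3 * d / n)) := by ring
    _ ≤ k * (18 * (1 / 300) + 2 * (1 / 32)) := by gcongr
    _ ≤ k * (1 / 2) := by gcongr; norm_num
    _ = _ := by ring

/-- The condition on k√d controls the off-diagonal part of the squared Gram entries and the indirect
part; the condition on kd² controls the diagonal part. -/
lemma covariance_shift_le {k u : ℕ} (hu : u ≤ k) (hk : 300 * P ^ 3 * k * √d ≤ n)
    (hk' : 32 * P ^ 2 * k * d ^ 2 ≤ n ^ 2) : directCS b X k u + indirectCS b X k u ≤ 1 / 2 := by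
  have hP := hs.one_le_P
  have hn := hs.n_pos
  have h1 : P * k * √d / n ≤ 1 / 300 := by
    rw [div_le_iff₀ hn]
    have : P * (k * √d) ≤ P ^ 3 * (k * √d) := by
      gcongr
      exact le_self_pow₀ hP (by norm_num)
    linarith
  have h2 : P ^ 2 * k * d ^ 2 / n ^ 2 ≤ 1 / 32 := by
    rw [div_le_iff₀ (by positivity)]; linarith
  have h3 : directCS b X k u ≤ 1 / 4 := by
    refine (h.directCS_le hs hu).trans ?_
    rw [Real.sqrt_le_left (by norm_num)]
    have : (P * k * √d / n) ^ 2 ≤ (1 / 300) ^ 2 := pow_le_pow_left₀ (by positivity) h1 2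
    linarith
  have h4 := h.indirectCS_le hs k u
  have h5 : 4 * P * √d / n * k = 4 * (P * k * √d / n) := by ring
  linarith

/-- The numerator is at most r·z·q² ≤ r·z·k/2 and the denominator at least 1/2; in particular the
finite branch applies. -/
lemma highOrderKU_eq {k u : ℕ} (hu : u ≤ k) (hk : 300 * P ^ 3 * k * √d ≤ n)
    (hk' : 32 * P ^ 2 * k * d ^ 2 ≤ n ^ 2) :
    ∃ H : ℝ, 0 ≤ H ∧ H ≤ r * z * k ∧ highOrderKU b X Y e k u = H := by
  have hr := hs.r_pos
  have hz := hs.z_pos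
  have hcs := h.covariance_shift_le hs hu hk hk'
  refine ⟨_, ?_, ?_, if_pos (by linarith)⟩
  · exact div_nonneg (by positivity) (by linarith)
  set q := √(P ^ 3 * (k * (k * √d + d)) / n) + 2 * P * √(2 * P * √d / n) * k with hq
  have hq2 : q ^ 2 ≤ k / 2 := factor_sq_le hs k hk
  have h1 : |directXR b X Y k u + indirectXR b X Y k u| ≤ r * q := by
    rw [abs_of_nonneg (add_nonneg (by exact kuBound_nonneg _ k u) (indirectXR_nonneg k u))]
    have e1 : directXR b X Y k u ≤ r * √(P ^ 3 * (k * (k * √d + d)) / n) :=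
      direct_le hs h.gram_diag h.gram_off hr h.resid_le hu
    have e2 : indirectXR b X Y k u ≤ 2 * P * r * √(2 * P * √d / n) * k :=
      Mterm_mul_le hs (h.Mterm_sq_le hs) hr h.resid_le k u
    calc _ ≤ _ := add_le_add e1 e2
      _ = r * q := by rw [hq]; ring
  have h2 : |directXZ b X e k u + indirectXZ b X e k u| ≤ z * q := by
    rw [abs_of_nonneg (add_nonneg (by exact kuBound_nonneg _ k u) (indirectXZ_nonneg k u))]
    have e1 : directXZ b X e k u ≤ z * √(P ^ 3 * (k * (k * √d + d)) / n) :=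
      direct_le hs h.gram_diag h.gram_off hz h.zproj_le hu
    have e2 : indirectXZ b X e k u ≤ 2 * P * z * √(2 * P * √d / n) * k :=
      Mterm_mul_le hs (h.Mterm_sq_le hs) hz h.zproj_le k u
    calc _ ≤ _ := add_le_add e1 e2
      _ = z * q := by rw [hq]; ring
  rw [div_le_iff₀ (by linarith)]
  calc _ ≤ (r * q) * (z * q) := mul_le_mul h1 h2 (abs_nonneg _) ((abs_nonneg _).trans h1)
    _ = r * z * q ^ 2 := by ring
    _ ≤ r * z * (k / 2) := by gcongr
    _ = r * z * k * (1 / 2) := by ring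
    _ ≤ _ := by gcongr; linarith

lemma highOrder_eq {k : ℕ} (hkn : k ≤ n) (hk : 300 * P ^ 3 * k * √d ≤ n)
    (hk' : 32 * P ^ 2 * k * d ^ 2 ≤ n ^ 2) :
    ∃ H : ℝ, 0 ≤ H ∧ H ≤ r * z * k ∧ highOrder b X Y e k = H := by
  set S := (Finset.range (m + 1)).filter fun u => (allocsKU b k u).Nonempty with hS
  -- An empty supremum in `EReal` would be ⊥, and the value would not be a real number.
  have hne : S.Nonempty := by
    obtain ⟨κ, hκ⟩ := allocs_nonempty (b := b) hkn
    refine ⟨(Finset.univ.filter fun j => κ j ≠ 0).card, ?_⟩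
    rw [hS, Finset.mem_filter, Finset.mem_range]
    refine ⟨Nat.lt_succ_of_le ((Finset.card_le_univ _).trans_eq (by simp)), κ, ?_⟩
    rw [allocsKU, Finset.mem_filter]
    exact ⟨hκ, rfl⟩
  obtain ⟨u, hu, h1⟩ := Finset.exists_mem_eq_sup S hne (highOrderKU b X Y e k)
  obtain ⟨κ, hκ⟩ := (Finset.mem_filter.1 hu).2
  obtain ⟨H, h2, h3, h4⟩ := h.highOrderKU_eq hs (le_of_mem_allocsKU hκ) hk hk'
  exact ⟨H, h2, h3, h1.trans h4⟩

/-- On typical data the two bounds are positive and agree up to a factor close to one. -/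
theorem bounds_ratio (hst : 2 * (4 * t ^ 2 + 3) ≤ s) {k : ℕ} (hk1 : 1 ≤ k) (hkn : k ≤ n)
    (hkN : (k : ℝ) ≤ N₀) (hk : 300 * P ^ 3 * k * √d ≤ n) (hk' : 32 * P ^ 2 * k * d ^ 2 ≤ n ^ 2) :
    0 < lower b X Y e k ∧ 1 ≤ upper b X Y e k / lower b X Y e k ∧
      upper b X Y e k / lower b X Y e k ≤ ((1 + 4 * (4 * t ^ 2 + 3) / s : ℝ) : EReal) := by
  obtain ⟨H, hH0, hH, hHeq⟩ := h.highOrder_eq hs hkn hk hk'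
  have hr := hs.r_pos
  have hz := hs.z_pos
  have ht := hs.one_le_t
  have h1 := h.influencePlus_le hs hkn
  have h2 := h.le_influenceMinus hs hkn
  have h3 := h.le_topSum_influence hkN
  have h4 := influenceMinus_le_influencePlus (b := b) (X := X) (Y := Y) (e := e) k
  rw [upper, lower, hHeq, ← EReal.coe_add, ← EReal.coe_sub, ← EReal.coe_div]
  set S := topSum Finset.univ k (fun i => resid b X Y i * Zproj b X e i)
  set U := influencePlus b X Y e k
  set L := influenceMinus b X Y e k
  have hk0 : (0 : ℝ) < k := by exact_mod_cast hk1
  have hw : 0 < r * z * k := by positivity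
  set w := r * z * k with hwdef
  have hspos : 0 < s := by nlinarith
  have e1 : (4 * t ^ 2 + 2) * (r * z) * k = (4 * t ^ 2 + 2) * w := by rw [hwdef]; ring
  have e2 : s * (r * z) * k = s * w := by rw [hwdef]; ring
  rw [e1] at h1 h2
  rw [e2] at h3
  have h5 : 2 * ((4 * t ^ 2 + 3) * w) ≤ s * w := by nlinarith
  -- L - H loses at most (4t²+2)w from the corners and w from higher order terms, together at most
  -- half of s·w ≤ S.
  have h6 : S / 2 ≤ L - H := by nlinarith
  have hS : 0 < S := lt_of_lt_of_le (by positivity) h3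
  have hL : 0 < L - H := by linarith
  refine ⟨by exact_mod_cast hL, ?_, ?_⟩
  · rw [← EReal.coe_one, EReal.coe_le_coe_iff, one_le_div hL]
    linarith
  · rw [EReal.coe_le_coe_iff, div_le_iff₀ hL]
    -- The width does not contain S, which cancels between the two first order values.
    have h7 : U + H - (L - H) ≤ 2 * ((4 * t ^ 2 + 3) * w) := by nlinarith
    have h8 : 2 * ((4 * t ^ 2 + 3) * w) ≤ 4 * (4 * t ^ 2 + 3) / s * (L - H) := by
      calc 2 * ((4 * t ^ 2 + 3) * w) = 4 * (4 * t ^ 2 + 3) / s * (s * w / 2) := by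
            field_simp
            ring
        _ ≤ _ := by gcongr; linarith
    linarith

end Typical
end HigherOrder

/-! ### The reaveraged regression -/

section Regression

variable {n d m : ℕ} (b : Fin n → Fin m) (X : Fin n → Vec d) (e : Vec d)

lemma Xt_apply (i : Fin n) (a : Fin d) : Xt b X i a = centered b Finset.univ X i a := by
  simp only [Xt, Matrix.of_apply, reaverage, centered, center, bucket, PiLp.sub_apply,
    PiLp.smul_apply, WithLp.ofLp_sum, Finset.sum_apply, smul_eq_mul]
  rw [div_eq_inv_mul]

lemma Sigmat_eq : Sigmat b X = scatterMatrix b Finset.univ X := by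
  ext a a'
  simp [Sigmat, scatterMatrix, Matrix.mul_apply, Xt_apply]

lemma Zproj_eq (i : Fin n) : Zproj b X e i = Regular.coeff b X e i := by
  simp [Zproj, Regular.coeff, Matrix.mulVec, dotProduct, Xt_apply, Sigmat_eq, inner_eq_sum,
    scatterInv, Matrix.toLpLin_apply]

lemma gram_eq (i i' : Fin n) :
    gram b X i i' = Regular.coeff b X (centered b Finset.univ X i') i := by
  rw [gram, Matrix.mul_assoc]
  simp [Matrix.mul_apply, Regular.coeff, Matrix.mulVec, dotProduct, Xt_apply, Sigmat_eq, inner_eq_sum,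
    scatterInv, Matrix.toLpLin_apply]

/-- Features transformed by a linear map. -/
def transform (Q : Matrix (Fin d) (Fin d) ℝ) (x : Vec d) : Vec d :=
  WithLp.toLp 2 (Matrix.mulVec Q x.ofLp)

variable (Q : Matrix (Fin d) (Fin d) ℝ)

lemma Xt_transform : Xt b (fun i => transform Q (X i)) = Xt b X * Q.transpose := by
  ext i a
  simp only [Xt, Matrix.of_apply, reaverage, transform, Matrix.mul_apply, Matrix.transpose_apply,
    Matrix.mulVec, dotProduct]
  rw [Finset.sum_comm, Finset.sum_div, ← Finset.sum_sub_distrib]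
  refine Finset.sum_congr rfl fun c _ => ?_
  rw [← Finset.mul_sum]
  ring

lemma Sigmat_transform :
    Sigmat b (fun i => transform Q (X i)) = Q * Sigmat b X * Q.transpose := by
  rw [Sigmat, Xt_transform, Matrix.transpose_mul, Matrix.transpose_transpose, Sigmat]
  simp only [Matrix.mul_assoc]

variable {Q}

/-- Qᵀ(QΣQᵀ)⁻¹Q = Σ⁻¹; only Q has to be invertible. -/
lemma gram_transform (hQ : IsUnit Q.det) : gram b (fun i => transform Q (X i)) = gram b X := by
  have hQ' : IsUnit Q.transpose.det := by rwa [Matrix.det_transpose]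
  rw [gram, Sigmat_transform, Xt_transform, Matrix.mul_inv_rev, Matrix.mul_inv_rev,
    Matrix.transpose_mul, Matrix.transpose_transpose, gram]
  calc _ = Xt b X * (Q.transpose * Q.transpose⁻¹) * (Sigmat b X)⁻¹ * (Q⁻¹ * Q)
        * (Xt b X).transpose := by simp only [Matrix.mul_assoc]
    _ = _ := by rw [Matrix.mul_nonsing_inv _ hQ', Matrix.nonsing_inv_mul _ hQ, Matrix.mul_one,
        Matrix.mul_one]

lemma Zproj_transform (hQ : IsUnit Q.det) :
    Zproj b (fun i => transform Q (X i)) (transform Q e) = Zproj b X e := by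
  have hQ' : IsUnit Q.transpose.det := by rwa [Matrix.det_transpose]
  rw [Zproj, Sigmat_transform, Xt_transform, Matrix.mul_inv_rev, Matrix.mul_inv_rev, Zproj, transform]
  simp only [Matrix.mulVec_mulVec]
  congr 1
  calc _ = Xt b X * (Q.transpose * Q.transpose⁻¹) * (Sigmat b X)⁻¹ * (Q⁻¹ * Q) := by
        simp only [Matrix.mul_assoc]
    _ = _ := by rw [Matrix.mul_nonsing_inv _ hQ', Matrix.nonsing_inv_mul _ hQ, Matrix.mul_one,
        Matrix.mul_one]

lemma Zproj_smul (c : ℝ) (i : Fin n) : Zproj b X (c • e) i = c * Zproj b X e i := by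
  rw [Zproj, Zproj, WithLp.ofLp_smul, Matrix.mulVec_smul, Matrix.mulVec_smul, Pi.smul_apply,
    smul_eq_mul]

lemma sum_reaverage (f : Fin n → ℝ) (j : Fin m) : ∑ i ∈ bucket b j, reaverage b f i = 0 := by
  have : ∀ i ∈ bucket b j, reaverage b f i
      = f i - (∑ i' ∈ bucket b j, f i') / ((bucket b j).card : ℝ) := by
    intro i hi
    rw [reaverage, mem_bucket.1 hi]
  rw [Finset.sum_congr rfl this, Finset.sum_sub_distrib, Finset.sum_const, nsmul_eq_mul]
  rcases (bucket b j).eq_empty_or_nonempty with h | h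
  · simp [h]
  · rw [mul_div_cancel₀ _ (by exact_mod_cast h.card_pos.ne'), sub_self]

lemma sum_Xt_mulVec (v : Fin d → ℝ) (j : Fin m) :
    ∑ i ∈ bucket b j, Matrix.mulVec (Xt b X) v i = 0 := by
  simp only [Matrix.mulVec, dotProduct]
  rw [Finset.sum_comm]
  refine Finset.sum_eq_zero fun a _ => ?_
  rw [← Finset.sum_mul]
  simp only [Xt, Matrix.of_apply]
  rw [sum_reaverage, zero_mul]

lemma sum_Zproj (j : Fin m) : ∑ i ∈ bucket b j, Zproj b X e i = 0 := sum_Xt_mulVec b X _ j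

lemma sum_resid (Y : Fin n → ℝ) (j : Fin m) : ∑ i ∈ bucket b j, resid b X Y i = 0 := by
  simp only [resid, Finset.sum_sub_distrib]
  rw [sum_reaverage, sum_Xt_mulVec, sub_zero]

/-- Reaveraging subtracts a function that is constant on buckets, and such functions are orthogonal
to `g`. -/
lemma sum_mul_reaverage {g : Fin n → ℝ} (hg : ∀ j, ∑ i ∈ bucket b j, g i = 0) (f : Fin n → ℝ) :
    ∑ i, g i * reaverage b f i = ∑ i, g i * f i := by
  have h : ∀ i, g i * reaverage b f i = g i * f i
      - g i * ((∑ i' ∈ bucket b (b i), f i') / ((bucket b (b i)).card : ℝ)) := fun i => by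
    rw [reaverage]; ring
  rw [Finset.sum_congr rfl fun i _ => h i, Finset.sum_sub_distrib, sub_eq_self,
    ← Finset.sum_fiberwise Finset.univ b]
  refine Finset.sum_eq_zero fun j _ => ?_
  have h2 : ∀ i ∈ Finset.univ.filter (fun i => b i = j),
      g i * ((∑ i' ∈ bucket b (b i), f i') / ((bucket b (b i)).card : ℝ))
        = g i * ((∑ i' ∈ bucket b j, f i') / ((bucket b j).card : ℝ)) := by
    intro i hi
    rw [(Finset.mem_filter.1 hi).2]
  rw [Finset.sum_congr rfl h2, ← Finset.sum_mul]
  change (∑ i ∈ bucket b j, g i) * _ = 0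
  rw [hg j, zero_mul]

lemma sum_gram_row (i : Fin n) (j : Fin m) : ∑ i' ∈ bucket b j, gram b X i i' = 0 := by
  simp only [gram, Matrix.mul_apply (M := Xt b X * (Sigmat b X)⁻¹)]
  rw [Finset.sum_comm]
  refine Finset.sum_eq_zero fun a _ => ?_
  rw [← Finset.mul_sum]
  simp only [Matrix.transpose_apply, Xt, Matrix.of_apply]
  rw [sum_reaverage, mul_zero]

lemma resid_eq (Y : Fin n → ℝ) (i : Fin n) :
    resid b X Y i = reaverage b Y i - ∑ i', gram b X i i' * reaverage b Y i' := by
  rw [resid, betaHat, Matrix.mulVec_mulVec, Matrix.mulVec_mulVec, gram]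
  rfl

/-- The residuals are a linear function of the noise alone. -/
lemma resid_labels (h : IsUnit (Sigmat b X).det) (hb : ∀ j, (bucket b j).Nonempty)
    (μ : Fin m → ℝ) (β : Vec d) (ζ : Fin n → ℝ) (i : Fin n) :
    resid b X (labels b μ β X ζ) i = ζ i
      - (∑ i' ∈ bucket b (b i), ζ i') / ((bucket b (b i)).card : ℝ) - ∑ i', gram b X i i' * ζ i' := by
  have h1 : ∀ i, reaverage b (labels b μ β X ζ) i = reaverage b ζ i + ∑ a, Xt b X i a * β a := by
    intro i
    have h3 : ∑ i' ∈ bucket b (b i), labels b μ β X ζ i' = (bucket b (b i)).card * μ (b i)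
        + ∑ a, (∑ i' ∈ bucket b (b i), X i' a) * β a + ∑ i' ∈ bucket b (b i), ζ i' := by
      simp only [labels, Finset.sum_add_distrib]
      congr 2
      · rw [← nsmul_eq_mul, ← Finset.sum_const]
        exact Finset.sum_congr rfl fun i' hi' => by rw [mem_bucket.1 hi']
      · simp only [inner_eq_sum, Finset.sum_mul]
        rw [Finset.sum_comm]
    have hc : ((bucket b (b i)).card : ℝ) ≠ 0 := by exact_mod_cast (hb (b i)).card_pos.ne'
    have h4 : ∑ a, Xt b X i a * β a = inner ℝ (X i) β
        - (∑ a, (∑ i' ∈ bucket b (b i), X i' a) * β a) / ((bucket b (b i)).card : ℝ) := by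
      rw [inner_eq_sum, Finset.sum_div, ← Finset.sum_sub_distrib]
      refine Finset.sum_congr rfl fun a _ => ?_
      simp only [Xt, Matrix.of_apply, reaverage]
      ring
    rw [reaverage, h3, h4, reaverage, labels]
    field_simp
    ring
  -- The projection fixes the columns of `Xt`, which removes β from the residuals; μ has already
  -- gone in the reaveraging.
  have h2 : ∀ a, ∑ i', gram b X i i' * Xt b X i' a = Xt b X i a := by
    intro a
    rw [← Matrix.mul_apply, gram, Matrix.mul_assoc]
    change (Xt b X * (Sigmat b X)⁻¹ * Sigmat b X) i a = _
    rw [Matrix.mul_assoc, Matrix.nonsing_inv_mul _ h, Matrix.mul_one]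
  rw [resid_eq]
  simp only [h1, mul_add, Finset.sum_add_distrib]
  rw [sum_mul_reaverage b (sum_gram_row b X i), reaverage]
  have h5 : ∑ i', gram b X i i' * ∑ a, Xt b X i' a * β a = ∑ a, Xt b X i a * β a := by
    simp only [Finset.mul_sum]
    rw [Finset.sum_comm]
    refine Finset.sum_congr rfl fun a _ => ?_
    rw [← h2 a, Finset.sum_mul]
    exact Finset.sum_congr rfl fun i' _ => by ring
  rw [h5]
  ring

/-- The rows of the projection matrix `gram` have squared length equal to its diagonal entries. -/
lemma sum_gram_sq (h : IsUnit (Sigmat b X).det) (i : Fin n) :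
    ∑ i', gram b X i i' ^ 2 = gram b X i i := by
  have hS : (Sigmat b X).transpose = Sigmat b X := by
    rw [Sigmat, Matrix.transpose_mul, Matrix.transpose_transpose]
  have hsymm : (gram b X).transpose = gram b X := by
    rw [gram, Matrix.transpose_mul, Matrix.transpose_mul, Matrix.transpose_transpose,
      Matrix.transpose_nonsing_inv, hS, Matrix.mul_assoc]
  have hidem : gram b X * gram b X = gram b X := by
    have e1 : gram b X * gram b X = Xt b X * ((Sigmat b X)⁻¹ * Sigmat b X) * (Sigmat b X)⁻¹
        * (Xt b X).transpose := by
      simp only [gram, Sigmat, Matrix.mul_assoc]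
    rw [e1, Matrix.nonsing_inv_mul _ h, Matrix.mul_one, gram]
  have e2 := congrFun (congrFun hidem i) i
  rw [Matrix.mul_apply] at e2
  rw [← e2]
  refine Finset.sum_congr rfl fun i' _ => ?_
  have e3 : gram b X i i' = gram b X i' i := congrFun (congrFun hsymm i') i
  rw [sq, ← e3]

end Regression

/-! ### Gaussian noise and counting -/

section Noise

lemma hasSubgaussianMGF_gaussianReal (v : ℝ≥0) :
    HasSubgaussianMGF (fun x : ℝ => x) v (gaussianReal 0 v) where
  integrable_exp_mul t := integrable_exp_mul_gaussianReal t
  mgf_le t := by rw [mgf_fun_id_gaussianReal]; simp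

lemma measure_abs_gt_le {Ω : Type*} [MeasurableSpace Ω] {μ : Measure Ω} [IsFiniteMeasure μ]
    {Z : Ω → ℝ} {c : ℝ≥0} (h : HasSubgaussianMGF Z c μ) {s : ℝ} (hs : 0 ≤ s) :
    μ {ω | s < |Z ω|} ≤ ENNReal.ofReal (2 * Real.exp (-s ^ 2 / (2 * c))) := by
  have h1 := h.measure_ge_le hs
  have h2 := h.neg.measure_ge_le hs
  rw [two_mul, ENNReal.ofReal_add (by positivity) (by positivity)]
  refine (measure_mono (t := {ω | s ≤ Z ω} ∪ {ω | s ≤ (-Z) ω}) fun ω hω => ?_).trans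
    ((measure_union_le _ _).trans (add_le_add ?_ ?_))
  · rcases lt_abs.1 (show s < |Z ω| from hω) with h | h
    · exact Or.inl h.le
    · exact Or.inr h.le
  · rw [← ofReal_measureReal]; exact ENNReal.ofReal_le_ofReal h1
  · rw [← ofReal_measureReal]; exact ENNReal.ofReal_le_ofReal h2

/-- Tails of a single error. -/
lemma gaussianReal_tail {σ : ℝ≥0} (hσ : 0 < σ) {s : ℝ} (hs : 0 ≤ s) :
    gaussianReal 0 (σ ^ 2) {x | s * σ < |x|} ≤ ENNReal.ofReal (2 * Real.exp (-s ^ 2 / 2)) := by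
  have hσ' : (0 : ℝ) < σ := hσ
  refine (measure_abs_gt_le (hasSubgaussianMGF_gaussianReal (σ ^ 2)) (by positivity)).trans_eq ?_
  congr 3
  push_cast
  field_simp

/-- Tails of linear combinations of the errors. -/
lemma measure_linear_noise_le {n : ℕ} (σ : ℝ≥0) (a : Fin n → ℝ) {s : ℝ} (hs : 0 ≤ s) :
    (Measure.pi fun _ : Fin n => gaussianReal 0 (σ ^ 2))
      {ζ | s * (σ * √(∑ i, a i ^ 2)) < |∑ i, a i * ζ i|}
      ≤ ENNReal.ofReal (2 * Real.exp (-s ^ 2 / 2)) := by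
  set γ := Measure.pi fun _ : Fin n => gaussianReal 0 (σ ^ 2)
  have hind : iIndepFun (fun i (ζ : Fin n → ℝ) => a i * ζ i) γ :=
    iIndepFun_pi (X := fun i x => a i * x) fun i => by fun_prop
  have hsub : ∀ i ∈ Finset.univ, HasSubgaussianMGF (fun ζ : Fin n → ℝ => a i * ζ i)
      (NNReal.mk (a i ^ 2) (sq_nonneg _) * σ ^ 2) γ := by
    intro i _
    refine HasSubgaussianMGF.const_mul ?_ (a i)
    have hmp := measurePreserving_eval (fun _ : Fin n => gaussianReal 0 (σ ^ 2)) i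
    have h := hasSubgaussianMGF_gaussianReal (σ ^ 2)
    rw [← hmp.map_eq] at h
    exact HasSubgaussianMGF.of_map (μ := γ) (X := fun x : ℝ => x) (Y := fun ζ : Fin n → ℝ => ζ i)
      (measurable_pi_apply i).aemeasurable h
  have hsum := HasSubgaussianMGF.sum_of_iIndepFun hind hsub
  -- The Gaussian quotient is meaningless at variance zero; there the sum vanishes almost surely,
  -- and the strict inequality makes the event null.
  by_cases h0 : σ * √(∑ i, a i ^ 2) = 0
  · have hvan : ∀ᵐ ζ ∂γ, ∑ i, a i * ζ i = 0 := by
      have hc : ∑ i, (NNReal.mk (a i ^ 2) (sq_nonneg _) * σ ^ 2) = 0 := by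
        apply NNReal.coe_injective
        push_cast
        rw [← Finset.sum_mul]
        have : (∑ i, a i ^ 2) * (σ : ℝ) ^ 2 = (σ * √(∑ i, a i ^ 2)) ^ 2 := by
          rw [mul_pow, Real.sq_sqrt (Finset.sum_nonneg fun i _ => sq_nonneg _)]; ring
        exact this.trans (by rw [h0]; simp)
      rw [hc] at hsum
      exact hsum.ae_eq_zero_of_hasSubgaussianMGF_zero
    have : γ {ζ | s * (σ * √(∑ i, a i ^ 2)) < |∑ i, a i * ζ i|} = 0 := by
      rw [h0, mul_zero]
      refine measure_mono_null (fun ζ hζ => ?_) hvan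
      exact abs_pos.1 hζ
    rw [this]
    exact zero_le
  · have hpos : 0 < σ * √(∑ i, a i ^ 2) := lt_of_le_of_ne (by positivity) (Ne.symm h0)
    refine (measure_abs_gt_le hsum (by positivity)).trans_eq ?_
    congr 3
    push_cast
    change -(s * (σ * √(∑ i, a i ^ 2))) ^ 2 / (2 * ∑ i, a i ^ 2 * (σ : ℝ) ^ 2) = _
    rw [← Finset.sum_mul]
    have : (∑ i, a i ^ 2) * (σ : ℝ) ^ 2 = (σ * √(∑ i, a i ^ 2)) ^ 2 := by
      rw [mul_pow, Real.sq_sqrt (Finset.sum_nonneg fun i _ => sq_nonneg _)]; ring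
    rw [this]
    generalize σ * √(∑ i, a i ^ 2) = q at hpos
    field_simp

/-- Errors of either sign are large with not too small probability. -/
lemma le_gaussianReal_real {σ : ℝ≥0} (hσ : 0 < σ) {s : ℝ} (hs : 0 ≤ s) (c : ℝ) (hc : |c| = 1) :
    Real.exp (-(s + 1) ^ 2 / 2) / 3 ≤ (gaussianReal 0 (σ ^ 2)).real {x | s * σ ≤ c * x} := by
  have hσ' : (0 : ℝ) < σ := hσ
  have hc2 : c * c = 1 := by rw [← abs_mul_abs_self, hc, one_mul]
  -- On an interval of length σ just beyond sσ the density is at least exp(-(s+1)²/2)/(3σ), using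
  -- √(2π) ≤ 3.
  have key : ∃ a : ℝ, Set.Icc a (a + σ) ⊆ {x | s * σ ≤ c * x} ∧
      ∀ x ∈ Set.Icc a (a + σ), x ^ 2 ≤ ((s + 1) * σ) ^ 2 := by
    rcases (abs_eq zero_le_one).1 hc with rfl | rfl
    · refine ⟨s * σ, fun x hx => ?_, fun x hx => ?_⟩
      · simpa using hx.1
      · have : 0 ≤ s * σ := by positivity
        exact pow_le_pow_left₀ (this.trans hx.1) (by linarith [hx.2]) 2
    · refine ⟨-((s + 1) * σ), fun x hx => ?_, fun x hx => ?_⟩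
      · change s * σ ≤ -1 * x
        linarith [hx.2]
      · have : 0 ≤ s * σ := by positivity
        rw [← neg_sq x]
        exact pow_le_pow_left₀ (by linarith [hx.2]) (by linarith [hx.1]) 2
  obtain ⟨a, ha1, ha2⟩ := key
  have hv : σ ^ 2 ≠ 0 := by positivity
  refine le_trans ?_ (measureReal_mono ha1 (measure_ne_top _ _))
  rw [measureReal_def]
  refine (ENNReal.ofReal_le_iff_le_toReal (measure_ne_top _ _)).1 ?_
  rw [gaussianReal_apply _ hv]
  have hpt : ∀ x ∈ Set.Icc a (a + σ),
      ENNReal.ofReal ((3 * (σ : ℝ))⁻¹ * Real.exp (-(s + 1) ^ 2 / 2)) ≤ gaussianPDF 0 (σ ^ 2) x := by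
    intro x hx
    rw [gaussianPDF, gaussianPDFReal]
    refine ENNReal.ofReal_le_ofReal ?_
    have h1 : √(2 * Real.pi * ((σ ^ 2 : ℝ≥0) : ℝ)) ≤ 3 * σ := by
      rw [Real.sqrt_le_left (by positivity)]
      push_cast
      have := Real.pi_lt_d2
      have : 2 * Real.pi * (σ : ℝ) ^ 2 ≤ 9 * (σ : ℝ) ^ 2 := by gcongr; linarith
      linarith
    refine mul_le_mul ?_ (Real.exp_le_exp.2 ?_) (by positivity) (by positivity)
    · refine inv_anti₀ (Real.sqrt_pos.2 ?_) h1
      have := Real.pi_pos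
      positivity
    · push_cast
      rw [sub_zero, neg_div, neg_div, neg_le_neg_iff, div_le_div_iff₀ (by positivity) (by positivity)]
      have := ha2 x hx
      nlinarith
  calc ENNReal.ofReal (Real.exp (-(s + 1) ^ 2 / 2) / 3)
      = ENNReal.ofReal ((3 * (σ : ℝ))⁻¹ * Real.exp (-(s + 1) ^ 2 / 2)) * volume (Set.Icc a (a + σ)) := by
        rw [Real.volume_Icc, ← ENNReal.ofReal_mul (by positivity)]
        congr 1
        rw [add_sub_cancel_left]
        field_simp
    _ = ∫⁻ _ in Set.Icc a (a + σ), ENNReal.ofReal ((3 * (σ : ℝ))⁻¹ * Real.exp (-(s + 1) ^ 2 / 2)) := by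
        rw [setLIntegral_const]
    _ ≤ _ := setLIntegral_mono' measurableSet_Icc hpt

end Noise

section Counting

variable {α : Type*} [MeasurableSpace α] (P : Measure α) [IsProbabilityMeasure P] {n : ℕ}

/-- A rare property holds for few of the samples. -/
lemma whp_count_le {S : Set α} (hS : MeasurableSet S) {Λ : ℝ} (hΛ : 0 < Λ)
    (hP : P.real S ≤ 1 / (2 * Λ)) (A : Finset (Fin n)) [DecidablePred (· ∈ S)] :
    Whp (Measure.pi fun _ : Fin n => P) (Real.exp (-(A.card / (8 * Λ ^ 2)))) fun ω =>
      Λ * (A.filter fun i => ω i ∈ S).card ≤ A.card := by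
  rcases A.eq_empty_or_nonempty with rfl | hA
  · simp [Whp]
  have hc : (0 : ℝ) < A.card := by exact_mod_cast hA.card_pos
  have h := measure_pi_sum_ge_le P A (f := fun _ => S.indicator 1) (B := 1)
    (fun _ => measurable_one.indicator hS)
    (fun _ x => by by_cases hx : x ∈ S <;> simp [hx]) (s := A.card / (2 * Λ)) (by positivity)
  refine (measure_mono fun ω hω => ?_).trans (h.trans_eq ?_)
  · have hω' : ¬ Λ * ((A.filter fun i => ω i ∈ S).card : ℝ) ≤ A.card := hω
    rw [not_le] at hω'
    change (A.card : ℝ) / (2 * Λ) ≤ ∑ i ∈ A, (S.indicator 1 (ω i) - ∫ x, S.indicator 1 x ∂P)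
    rw [Finset.sum_sub_distrib, Finset.sum_const, nsmul_eq_mul, integral_indicator_one hS]
    have h1 : ∑ i ∈ A, S.indicator (1 : α → ℝ) (ω i) = (A.filter fun i => ω i ∈ S).card := by
      rw [Finset.card_eq_sum_ones, Nat.cast_sum, Finset.sum_filter]
      exact Finset.sum_congr rfl fun i _ => by by_cases hx : ω i ∈ S <;> simp [hx]
    rw [h1]
    have h2 : (A.card : ℝ) * P.real S ≤ A.card * (1 / (2 * Λ)) := by gcongr
    have h3 : (A.card : ℝ) / Λ ≤ (A.filter fun i => ω i ∈ S).card := by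
      rw [div_le_iff₀ hΛ]; linarith
    have h4 : (A.card : ℝ) / Λ = A.card / (2 * Λ) + A.card * (1 / (2 * Λ)) := by field_simp; norm_num
    linarith
  · congr 2
    field_simp
    ring

/-- Properties that are not too rare hold for many of the samples. -/
lemma whp_le_count {S : Fin n → Set α} (hS : ∀ i, MeasurableSet (S i)) {p : ℝ} (hp : 0 ≤ p)
    (A : Finset (Fin n)) (hP : ∀ i ∈ A, p ≤ P.real (S i)) [∀ i, DecidablePred (· ∈ S i)] :
    Whp (Measure.pi fun _ : Fin n => P) (Real.exp (-(A.card * p ^ 2 / 8))) fun ω =>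
      A.card * (p / 2) ≤ (A.filter fun i => ω i ∈ S i).card := by
  rcases A.eq_empty_or_nonempty with rfl | hA
  · simp [Whp]
  have hc : (0 : ℝ) < A.card := by exact_mod_cast hA.card_pos
  have h := measure_pi_sum_ge_le P A (f := fun i x => -(S i).indicator 1 x) (B := 1)
    (fun i => (measurable_one.indicator (hS i)).neg)
    (fun i x => by by_cases hx : x ∈ S i <;> simp [hx]) (s := A.card * (p / 2)) (by positivity)
  refine (measure_mono fun ω hω => ?_).trans (h.trans_eq ?_)
  · have hω' : ¬ A.card * (p / 2) ≤ ((A.filter fun i => ω i ∈ S i).card : ℝ) := hω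
    rw [not_le] at hω'
    change A.card * (p / 2) ≤ ∑ i ∈ A, (-(S i).indicator 1 (ω i) - ∫ x, -(S i).indicator 1 x ∂P)
    simp only [integral_neg, integral_indicator_one (hS _), sub_neg_eq_add, Finset.sum_add_distrib,
      Finset.sum_neg_distrib]
    have h1 : ∑ i ∈ A, (S i).indicator (1 : α → ℝ) (ω i) = (A.filter fun i => ω i ∈ S i).card := by
      rw [Finset.card_eq_sum_ones, Nat.cast_sum, Finset.sum_filter]
      exact Finset.sum_congr rfl fun i _ => by by_cases hx : ω i ∈ S i <;> simp [hx]
    rw [h1]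
    have h2 : A.card * p ≤ ∑ i ∈ A, P.real (S i) := by
      rw [← nsmul_eq_mul, ← Finset.sum_const]
      exact Finset.sum_le_sum hP
    linarith
  · congr 2
    field_simp
    ring

end Counting

/-! ### Regular features and regular noise give typical data -/

section RegularNoise

variable {n d m : ℕ}

/-- Noise that behaves like a typical Gaussian sample. -/
structure RegularNoise (T l t s N₀ σ : ℝ) (b : Fin n → Fin m) (e : Vec d) (w : Fin n → Vec d)
    (ζ : Fin n → ℝ) : Prop where
  noise_le : ∀ i, |ζ i| ≤ l * σ
  bucket_noise_le : ∀ j, |∑ i ∈ bucket b j, ζ i| ≤ l * (σ * √(bucket b j).card)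
  gram_noise_le : ∀ i, |∑ i', gram b w i i' * ζ i'| ≤ l * (σ * √(∑ i', gram b w i i' ^ 2))
  noise_count : ∀ j, T ^ 18 * ((bucket b j).filter fun i => t * σ < |ζ i|).card
    ≤ (bucket b j).card
  feature_count : ∀ j, T ^ 18 * ((bucket b j).filter fun i => t < |(inner ℝ e (w i) : ℝ)|).card
    ≤ (bucket b j).card
  large : ∃ I : Finset (Fin n), N₀ ≤ I.card ∧ ∀ i ∈ I, ∃ c : ℝ, |c| = 1 ∧
    1 / 3 ≤ c * inner ℝ e (w i) ∧ s * σ ≤ c * ζ i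

variable {T l t s N₀ σ : ℝ} {b : Fin n → Fin m} {e : Vec d} {w : Fin n → Vec d} {ζ : Fin n → ℝ}

lemma Regular.isUnit_det (hs : Sizes T n d m b) (hr : Regular T b e w) (i : Fin n) :
    IsUnit (Sigmat b w).det := by
  rw [Sigmat_eq, ← Matrix.isUnit_iff_isUnit_det]
  exact scatterMatrix_isUnit (Regular.lower_pos hs) (hr.lower hs (j := b i) (Finset.subset_univ _))

/-- The bucket mean of the noise is of order σ/√N, and its projection of order σ times the square
root of the diagonal Gram entry, by `sum_gram_sq`. Each is at most σ/2. -/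
lemma RegularNoise.abs_resid_sub_le (hs : Sizes T n d m b) (hr : Regular T b e w)
    (h : RegularNoise T l t s N₀ σ b e w ζ) (hl0 : 0 ≤ l) (hl : l ≤ T) (hσ : 0 ≤ σ) (i : Fin n) :
    |(∑ i' ∈ bucket b (b i), ζ i') / ((bucket b (b i)).card : ℝ)| + |∑ i', gram b w i i' * ζ i'|
      ≤ σ := by
  have hT := hs.T_pos
  have h4 := hs.four_le
  have hN := hs.bucket_pos (b i)
  have hn := hs.n_pos
  have h1 : |(∑ i' ∈ bucket b (b i), ζ i') / ((bucket b (b i)).card : ℝ)| ≤ σ / 2 := by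
    rw [abs_div, Nat.abs_cast, div_le_iff₀ hN]
    refine (h.bucket_noise_le (b i)).trans ?_
    have e1 : T ^ 2 ≤ √((bucket b (b i)).card : ℝ) := by
      refine Real.le_sqrt_of_sq_le (le_trans ?_ (hs.bucket_ge' (b i)))
      rw [← pow_mul]
      exact pow_le_pow_right₀ (by linarith) (by norm_num)
    have e2 : 2 * T ≤ √((bucket b (b i)).card : ℝ) := by nlinarith
    calc l * (σ * √(bucket b (b i)).card) ≤ T * (σ * √(bucket b (b i)).card) := by gcongr
      _ = σ / 2 * (2 * T * √(bucket b (b i)).card) := by ring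
      _ ≤ σ / 2 * (√(bucket b (b i)).card * √(bucket b (b i)).card) := by gcongr
      _ = _ := by rw [Real.mul_self_sqrt hN.le]
  have h2 : |∑ i', gram b w i i' * ζ i'| ≤ σ / 2 := by
    refine (h.gram_noise_le i).trans ?_
    rw [sum_gram_sq b w (hr.isUnit_det hs i), gram_eq]
    have e1 := (le_abs_self _).trans (hr.abs_coeff_diag_le hs i)
    have hρ := hs.sqrt_ratio_le
    have e2 : √(Regular.coeff b w (centered b Finset.univ w i) i) ≤ T ^ 2 * √((d : ℝ) / n) := by
      rw [← Real.sqrt_sq (pow_nonneg hT.le 2), ← Real.sqrt_mul (by positivity)]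
      refine Real.sqrt_le_sqrt (e1.trans ?_)
      gcongr
      nlinarith [pow_pos hT 3]
    have e3 : 2 * T ^ 3 ≤ T ^ 10 := by
      have : T ^ 4 ≤ T ^ 10 := pow_le_pow_right₀ (by linarith) (by norm_num)
      nlinarith [pow_pos hT 3]
    calc _ ≤ T * (σ * (T ^ 2 * √((d : ℝ) / n))) := by gcongr
      _ = σ / 2 * (√((d : ℝ) / n) * (2 * T ^ 3)) := by ring
      _ ≤ σ / 2 * (√((d : ℝ) / n) * T ^ 10) := by gcongr
      _ ≤ σ / 2 * 1 := by gcongr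
      _ = _ := mul_one _
  linarith

/-- Residuals are within σ of the noise, and n/η times the projections within 1/4 of ⟨e, w_i⟩, so
the threshold t grows to t + 1. Lower bounds drop from s to s/2, as s ≥ 2, and from 1/3 to 1/12,
which gives s/24. Choosing P = T⁶ makes P³ match the T¹⁸ of the counts. -/
theorem RegularNoise.typical (hs : Sizes T n d m b) (hr : Regular T b e w) (he : ‖e‖ = 1)
    (h : RegularNoise T l t s N₀ σ b e w ζ) (hl0 : 0 ≤ l) (hl : l ≤ T) (hσ : 0 < σ)
    (hs2 : 2 ≤ s) {Q : Matrix (Fin d) (Fin d) ℝ} (hQ : IsUnit Q.det) {X : Fin n → Vec d}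
    (hX : ∀ i, transform Q (X i) = w i) {η : ℝ} (hη : 0 < η) {v : Vec d} (hv : transform Q v = η • e)
    (μ : Fin m → ℝ) (β : Vec d) :
    Typical (T ^ 6) (t + 1) σ (η / n) (s / 24) N₀ b X (labels b μ β X ζ) v := by
  have hT := hs.T_pos
  have h4 := hs.four_le
  have hn := hs.n_pos
  have hXw : (fun i => transform Q (X i)) = w := funext hX
  have hG : gram b X = gram b w := by rw [← hXw, gram_transform b X hQ]
  have hZ : ∀ i, Zproj b X v i = η / n * (n * Regular.coeff b w e i) := by
    intro i
    rw [← Zproj_transform b X v hQ, hXw, hv, Zproj_smul, Zproj_eq]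
    field_simp
  have hunit : 0 < n → IsUnit (Sigmat b X).det := by
    intro hn'
    have h1 := hr.isUnit_det hs ⟨0, hn'⟩
    rw [← hXw, Sigmat_transform, Matrix.det_mul, Matrix.det_mul, IsUnit.mul_iff, IsUnit.mul_iff] at h1
    exact h1.1.2
  have hR : ∀ i, |resid b X (labels b μ β X ζ) i - ζ i| ≤ σ := by
    intro i
    rw [resid_labels b X (hunit (Nat.pos_of_ne_zero fun h0 => by simp [h0] at hn))
      (fun j => Finset.card_pos.1 (by exact_mod_cast hs.bucket_pos j)), hG]
    have h1 := h.abs_resid_sub_le hs hr hl0 hl hσ.le i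
    have e1 : ∀ x y z : ℝ, |x - y - z - x| ≤ |y| + |z| := fun x y z => by
      rw [show x - y - z - x = -(y + z) by ring, abs_neg]; exact abs_add_le y z
    exact (e1 _ _ _).trans h1
  have hc : ∀ i, |n * Regular.coeff b w e i - inner ℝ e (w i)| ≤ 1 / 4 := by
    intro i
    rw [real_inner_comm]
    refine (hr.abs_coeff_dir_sub_le hs he i).trans ?_
    exact one_div_le_one_div_of_le (by norm_num) h4
  have hT6 : ∀ k, k ≤ 5 → 4 * T ^ k ≤ T ^ 6 := by
    intro k hk
    have : T ^ (k + 1) ≤ T ^ 6 := pow_le_pow_right₀ (by linarith) (by omega)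
    rw [pow_succ] at this
    nlinarith [pow_pos hT k]
  have hz : 0 < η / n := by positivity
  refine ⟨fun i => ?_, fun i => ?_, sum_resid b X _, sum_Zproj b X v, fun j => ?_, fun j => ?_,
    fun i => ?_, fun i i' hne => ?_, ?_⟩
  · have h1 := abs_sub_abs_le_abs_sub (resid b X (labels b μ β X ζ) i) (ζ i)
    have h2 := h.noise_le i
    have h3 : l * σ ≤ T * σ := by gcongr
    have h5 := hT6 1 (by norm_num)
    rw [pow_one] at h5
    have h6 : (T + 1) * σ ≤ T ^ 6 * σ := by gcongr; linarith
    linarith [hR i]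
  · rw [hZ, abs_mul, abs_of_pos hz, mul_comm (T ^ 6)]
    gcongr
    rw [abs_mul, abs_of_pos hn]
    calc (n : ℝ) * |Regular.coeff b w e i| ≤ n * (4 * T ^ 2 / n) := by
          gcongr; exact hr.abs_coeff_dir_le hs he i
      _ = 4 * T ^ 2 := by field_simp
      _ ≤ T ^ 6 := hT6 2 (by norm_num)
  · refine le_trans ?_ (h.noise_count j)
    rw [← pow_mul]
    refine mul_le_mul_of_nonneg_left (Nat.cast_le.2 (Finset.card_le_card fun i hi => ?_))
      (by positivity)
    rw [Finset.mem_filter] at hi ⊢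
    refine ⟨hi.1, ?_⟩
    have h1 := hi.2
    have h2 := abs_sub_abs_le_abs_sub (resid b X (labels b μ β X ζ) i) (ζ i)
    linarith [hR i]
  · refine le_trans ?_ (h.feature_count j)
    rw [← pow_mul]
    refine mul_le_mul_of_nonneg_left (Nat.cast_le.2 (Finset.card_le_card fun i hi => ?_))
      (by positivity)
    rw [Finset.mem_filter] at hi ⊢
    refine ⟨hi.1, ?_⟩
    have h1 := hi.2
    rw [hZ, abs_mul, abs_of_pos hz, mul_comm, mul_lt_mul_iff_right₀ hz] at h1
    have h2 := abs_sub_abs_le_abs_sub (n * Regular.coeff b w e i) (inner ℝ e (w i) : ℝ)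
    linarith [hc i]
  · rw [hG, gram_eq, mul_div_assoc]
    refine (hr.abs_coeff_diag_le hs i).trans ?_
    gcongr
    exact hT6 3 (by norm_num)
  · rw [hG, gram_eq]
    refine (hr.abs_coeff_offdiag_le hs hne).trans ?_
    gcongr
    have h5 := hT6 5 (by norm_num)
    have h6 : 16 * T ^ 3 ≤ T ^ 5 := by
      rw [show T ^ 5 = T ^ 2 * T ^ 3 by ring]
      gcongr
      nlinarith
    nlinarith [pow_pos hT 3]
  · obtain ⟨I, hI, h1⟩ := h.large
    refine ⟨I, hI, fun i hi => ?_⟩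
    obtain ⟨c, hc1, hcx, hcζ⟩ := h1 i hi
    have hcc : c * c = 1 := by rw [← abs_mul_abs_self, hc1, one_mul]
    have e1 : ∀ x y δ : ℝ, |x - y| ≤ δ → c * y - δ ≤ c * x := by
      intro x y δ hxy
      have : |c * (y - x)| ≤ δ := by rw [abs_mul, hc1, one_mul, abs_sub_comm]; exact hxy
      linarith [(abs_le.1 this).2]
    have h2 := e1 _ _ _ (hR i)
    have h3 := e1 _ _ _ (hc i)
    have h5 : s * σ / 2 ≤ c * resid b X (labels b μ β X ζ) i := by nlinarith
    have h6 : η / n / 12 ≤ c * Zproj b X v i := by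
      rw [hZ, show c * (η / n * (n * Regular.coeff b w e i))
        = η / n * (c * (n * Regular.coeff b w e i)) by ring, div_eq_mul_one_div (η / n) 12]
      gcongr
      linarith
    calc s / 24 * (σ * (η / n)) = s * σ / 2 * (η / n / 12) := by ring
      _ ≤ (c * resid b X (labels b μ β X ζ) i) * (c * Zproj b X v i) :=
          mul_le_mul h5 h6 (by positivity) (le_trans (by positivity) h5)
      _ = (c * c) * (resid b X (labels b μ β X ζ) i * Zproj b X v i) := by ring
      _ = _ := by rw [hcc, one_mul]

end RegularNoise

/-! ### Whitening -/

section Whitening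

variable {C c K : ℝ} {d : ℕ} {D : Measure (Vec d)}

open scoped MatrixOrder in
lemma exists_posDef_sqrt_inv {S : Matrix (Fin d) (Fin d) ℝ} (hS : S.PosDef) :
    ∃ Q : Matrix (Fin d) (Fin d) ℝ, Q.PosDef ∧ Q * Q = S⁻¹ := by
  have h0 : (0 : Matrix (Fin d) (Fin d) ℝ) ≤ S⁻¹ := hS.inv.posSemidef.nonneg
  have h1 : CFC.sqrt S⁻¹ * CFC.sqrt S⁻¹ = S⁻¹ := CFC.sqrt_mul_sqrt_self _ h0
  refine ⟨CFC.sqrt S⁻¹, ?_, h1⟩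
  rw [(Matrix.nonneg_iff_posSemidef.1 (CFC.sqrt_nonneg S⁻¹)).posDef_iff_isUnit,
    Matrix.isUnit_iff_isUnit_det]
  have h2 : IsUnit (S⁻¹).det := hS.inv.det_pos.ne'.isUnit
  rw [← h1, Matrix.det_mul] at h2
  exact isUnit_of_mul_isUnit_left h2

lemma measurable_transform (Q : Matrix (Fin d) (Fin d) ℝ) : Measurable (transform Q) := by
  have : transform Q = Matrix.toEuclideanLin Q := by ext x; rfl
  rw [this]
  exact (LinearMap.continuous_of_finiteDimensional _).measurable

lemma inner_transform (Q : Matrix (Fin d) (Fin d) ℝ) (u x : Vec d) :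
    inner ℝ u (transform Q x) = ∑ a, Matrix.vecMul u.ofLp Q a * x a := by
  rw [inner_eq_sum, transform]
  exact (Matrix.dotProduct_mulVec u.ofLp Q x.ofLp)

lemma WellBehaved.integrable_coord (h : WellBehaved C c K D) (a : Fin d) :
    Integrable (fun x : Vec d => x a) D := by
  have := h.isProbabilityMeasure
  exact ((EuclideanSpace.proj (𝕜 := ℝ) a).integrable_comp (h.memLp_two.integrable (by norm_num)))

lemma WellBehaved.integrable_coord_mul (h : WellBehaved C c K D) (a a' : Fin d) :
    Integrable (fun x : Vec d => x a * x a') D := by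
  have h1 : ∀ a, MemLp (fun x : Vec d => x a) 2 D := fun a =>
    (EuclideanSpace.proj (𝕜 := ℝ) a).comp_memLp' h.memLp_two
  exact (h1 a).integrable_mul (h1 a')

/-- Whitening a well-behaved law gives an isotropic one. -/
lemma WellBehaved.isotropic (h : WellBehaved C c K D) {Q : Matrix (Fin d) (Fin d) ℝ}
    (hQ : Q.PosDef) (hQS : Q * Q = (covMatrix D)⁻¹) : Isotropic C c K (D.map (transform Q)) := by
  have := h.isProbabilityMeasure
  have hm := measurable_transform Q
  have hdet : IsUnit (covMatrix D).det := h.cov_posDef.det_pos.ne'.isUnit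
  have hone : Q * covMatrix D * Q = 1 := by
    rw [Matrix.mul_assoc]
    refine mul_eq_one_comm.1 ?_
    rw [Matrix.mul_assoc, hQS, Matrix.mul_nonsing_inv _ hdet]
  have hsymm : Q.transpose = Q := by
    have := hQ.isHermitian.eq
    rwa [Matrix.conjTranspose_eq_transpose_of_trivial] at this
  refine ⟨Measure.isProbabilityMeasure_map hm.aemeasurable, fun u => ?_, fun u v => ?_, fun v hv t ht => ?_⟩
  · rw [integral_map hm.aemeasurable (by fun_prop)]
    simp only [inner_transform]
    rw [integral_finsetSum _ fun a _ => (h.integrable_coord a).const_mul _]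
    refine Finset.sum_eq_zero fun a _ => ?_
    rw [integral_const_mul, h.mean_zero, mul_zero]
  · rw [integral_map hm.aemeasurable (by fun_prop)]
    simp only [inner_transform, Finset.sum_mul_sum]
    have hi : ∀ a a', Integrable (fun x : Vec d =>
        Matrix.vecMul u.ofLp Q a * x a * (Matrix.vecMul v.ofLp Q a' * x a')) D := fun a a' => by
      have := (h.integrable_coord_mul a a').const_mul
        (Matrix.vecMul u.ofLp Q a * Matrix.vecMul v.ofLp Q a')
      refine this.congr (Filter.Eventually.of_forall fun x => ?_)
      simp only
      ring
    rw [integral_finsetSum _ fun a _ => integrable_finsetSum _ fun a' _ => hi a a']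
    simp only [integral_finsetSum Finset.univ fun a' _ => hi _ a']
    have he : ∀ a a', ∫ x : Vec d, Matrix.vecMul u.ofLp Q a * x a * (Matrix.vecMul v.ofLp Q a' * x a') ∂D
        = Matrix.vecMul u.ofLp Q a * (covMatrix D a a' * Matrix.vecMul v.ofLp Q a') := fun a a' => by
      rw [covMatrix, Matrix.of_apply, ← integral_mul_const, ← integral_const_mul]
      congr 1
      ext x
      ring
    simp only [he, ← Finset.mul_sum]
    change dotProduct (Matrix.vecMul u.ofLp Q)
      (Matrix.mulVec (covMatrix D) (Matrix.vecMul v.ofLp Q)) = _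
    have hv : Matrix.vecMul v.ofLp Q = Matrix.mulVec Q v.ofLp := by
      rw [← Matrix.mulVec_transpose, hsymm]
    rw [hv, ← Matrix.dotProduct_mulVec, Matrix.mulVec_mulVec, Matrix.mulVec_mulVec,
      hone, Matrix.one_mulVec, inner_eq_sum]
    rfl
  · rw [Measure.map_apply hm (measurableSet_lt measurable_const (by fun_prop))]
    exact h.tail Q hQ hQS v hv t ht

/-- Transforming the features by a measurable map transforms their law. -/
lemma regressionLaw_le {n : ℕ} [IsProbabilityMeasure D] (σ : ℝ≥0) {f : Vec d → Vec d}
    (hf : Measurable f) (S : Set ((Fin n → Vec d) × (Fin n → ℝ))) :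
    regressionLaw n D σ {ω | ((fun i => f (ω.1 i)), ω.2) ∈ S} ≤ regressionLaw n (D.map f) σ S := by
  have : IsProbabilityMeasure (D.map f) := Measure.isProbabilityMeasure_map hf.aemeasurable
  have hm : Measurable fun X : Fin n → Vec d => fun i => f (X i) := by fun_prop
  have h1 : (Measure.pi fun _ : Fin n => D.map f)
      = (Measure.pi fun _ : Fin n => D).map fun X i => f (X i) :=
    (Measure.pi_map_pi fun _ => hf.aemeasurable).symm
  have h2 : regressionLaw n (D.map f) σ
      = (regressionLaw n D σ).map (Prod.map (fun X i => f (X i)) id) := by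
    rw [regressionLaw, regressionLaw, h1, ← Measure.map_prod_map _ _ hm measurable_id,
      Measure.map_id]
  rw [h2]
  -- `S` need not be measurable; the outer measure still gives the direction required.
  exact Measure.le_map_apply (hm.prodMap measurable_id).aemeasurable S

end Whitening

/-! ### Regularity of the noise holds with high probability -/

section NoiseWhp

open Filter

section Prod

variable {Ω Ω' : Type*} [MeasurableSpace Ω] [MeasurableSpace Ω'] {P : Measure Ω} {γ : Measure Ω'}
  [IsProbabilityMeasure P] [IsProbabilityMeasure γ] {η : ℝ}

omit [IsProbabilityMeasure P] in
lemma Whp.prod_fst {Q : Ω → Prop} (h : Whp P η Q) : Whp (P.prod γ) η fun ω => Q ω.1 := by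
  refine (Measure.le_map_apply (f := Prod.fst) measurable_fst.aemeasurable {x | ¬ Q x}).trans ?_
  rw [Measure.map_fst_prod, measure_univ, one_smul]
  exact h


lemma Whp.prod_snd {Q : Ω' → Prop} (h : Whp γ η Q) : Whp (P.prod γ) η fun ω => Q ω.2 := by
  refine (Measure.le_map_apply (f := Prod.snd) measurable_snd.aemeasurable {x | ¬ Q x}).trans ?_
  rw [Measure.map_snd_prod, measure_univ, one_smul]
  exact h

/-- Conditioning on the first factor. Fubini needs the event to be measurable, unlike the two
marginal statements. -/
lemma whp_prod {Q : Ω × Ω' → Prop} (hQ : MeasurableSet {ω | Q ω})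
    (h : ∀ x, Whp γ η fun y => Q (x, y)) : Whp (P.prod γ) η Q :=
  measure_prod_le_of_forall P γ hQ.compl h

end Prod

lemma eventually_mul_log_pow_le_atTop (c : ℝ) (k : ℕ) {r : ℝ} (hr : 0 < r) :
    ∀ᶠ x : ℝ in atTop, c * Real.log x ^ k ≤ x ^ r := by
  have h := (isLittleO_log_rpow_rpow_atTop (k : ℝ) hr).bound (c := (|c| + 1)⁻¹) (by positivity)
  filter_upwards [h, Real.tendsto_log_atTop.eventually_ge_atTop 0, eventually_ge_atTop 0]
    with x hx h0 hx0
  rw [Real.rpow_natCast, Real.norm_of_nonneg (by positivity), Real.norm_of_nonneg (by positivity),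
    ← div_eq_inv_mul, le_div_iff₀ (by positivity)] at hx
  have h1 : c ≤ |c| + 1 := by linarith [le_abs_self c]
  calc c * Real.log x ^ k ≤ (|c| + 1) * Real.log x ^ k := by gcongr
    _ ≤ _ := by linarith

lemma eventually_mul_log_pow_le (c : ℝ) (k : ℕ) {r : ℝ} (hr : 0 < r) :
    ∀ᶠ n : ℕ in atTop, c * Real.log n ^ k ≤ (n : ℝ) ^ r :=
  tendsto_natCast_atTop_atTop.eventually (eventually_mul_log_pow_le_atTop c k hr)

variable {n d m : ℕ}

/-- All linear statistics of the noise that are used have the expected size. -/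
lemma eventually_linear_noise (q : ℕ) :
    ∀ᶠ n : ℕ in atTop, ∀ (σ : ℝ≥0) (a : Fin n → ℝ),
      Whp (Measure.pi fun _ : Fin n => gaussianReal 0 (σ ^ 2)) ((n : ℝ) ^ q)⁻¹
        fun ζ => |∑ i, a i * ζ i| ≤ Real.log n * (σ * √(∑ i, a i ^ 2)) := by
  filter_upwards [eventually_tail_le (C := 2) (c := 1 / 2) 2 (by norm_num) (a := 1) (by norm_num) q,
    eventually_le_log 0] with n h1 h0 σ a
  refine (measure_mono fun ζ hζ => ?_).trans
    ((measure_linear_noise_le σ a h0).trans (ENNReal.ofReal_le_ofReal (le_trans (le_of_eq ?_) h1)))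
  · exact not_le.1 hζ
  · rw [pow_one, Real.rpow_two]
    congr 2
    ring

/-- Few samples in a bucket have a rare property. -/
lemma eventually_count_le (κ q : ℕ) {ε : ℝ} (hε : 0 < ε) :
    ∀ᶠ n : ℕ in atTop, ∀ {α : Type} [MeasurableSpace α] (P : Measure α) [IsProbabilityMeasure P]
      (S : Set α) [DecidablePred (· ∈ S)] (A : Finset (Fin n)), MeasurableSet S →
      P S ≤ ENNReal.ofReal (Real.log n ^ (κ + 1))⁻¹ → (n : ℝ) ^ ε ≤ A.card →
      Whp (Measure.pi fun _ : Fin n => P) ((n : ℝ) ^ q)⁻¹ fun ω =>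
        Real.log n ^ κ * (A.filter fun i => ω i ∈ S).card ≤ A.card := by
  filter_upwards [eventually_mul_log_pow_le (8 * q) (2 * κ + 1) hε, eventually_le_log 2,
    eventually_gt_atTop 0] with n h1 h2 hn α _ P _ S _ A hS hP hA
  have hl : 0 < Real.log n := by linarith
  refine (whp_count_le P hS (Λ := Real.log n ^ κ) (by positivity) ?_ A).mono ?_ fun _ h => h
  · rw [measureReal_def]
    refine (ENNReal.toReal_le_of_le_ofReal (by positivity) hP).trans ?_
    rw [one_div, pow_succ']
    gcongr
  · rw [inv_pow_eq_exp hn]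
    apply Real.exp_le_exp.2
    rw [neg_le_neg_iff, le_div_iff₀ (by positivity)]
    refine le_trans (le_of_eq ?_) (h1.trans hA)
    ring

/-- Many samples have both a large feature and a large error of the same sign. -/
lemma eventually_large {C c : ℝ} (K : ℝ) (hC : 0 < C) (hc : 0 < c) {ε : ℝ} (hε : 0 < ε) (hε1 : ε < 1)
    (q : ℕ) :
    ∀ᶠ n : ℕ in atTop, ∀ {d : ℕ} (D : Measure (Vec d)) (σ : ℝ≥0), 0 < σ → Isotropic C c K D →
      ∀ e : Vec d, ‖e‖ = 1 →
      Whp ((Measure.pi fun _ : Fin n => D).prod (Measure.pi fun _ : Fin n => gaussianReal 0 (σ ^ 2)))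
        (2 * ((n : ℝ) ^ q)⁻¹) fun ω => ∃ I : Finset (Fin n), (n : ℝ) ^ (1 - ε) ≤ I.card ∧
          ∀ i ∈ I, 1 / 3 ≤ |(inner ℝ e (ω.1 i) : ℝ)| ∧
            √(ε * Real.log n) / 2 * σ * |(inner ℝ e (ω.1 i) : ℝ)| ≤ inner ℝ e (ω.1 i) * ω.2 i := by
  obtain ⟨M, hM1, hM⟩ := exists_fourthMoment K hC hc
  filter_upwards [eventually_mul_log_pow_le (8 * (32 * M) ^ 2 * q) 1 (r := 1) (by norm_num),
    eventually_mul_log_pow_le (1152 * M) 0 (r := 3 * ε / 4) (by linarith),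
    eventually_mul_log_pow_le (64 * 81 * 8 * M * q) 1 (r := 1 - ε / 2) (by linarith),
    eventually_le_log 1, eventually_gt_atTop 0] with n h1 h2 h3 h4 hn d D σ hσ hD e he
  have := hD.isProbabilityMeasure
  have hn0 : (0 : ℝ) < n := by exact_mod_cast hn
  set γ := Measure.pi fun _ : Fin n => gaussianReal 0 (σ ^ 2)
  set l := Real.log n
  set s := √(ε * l) / 2 with hs
  have hs0 : 0 ≤ s := by positivity
  set p : ℝ := (n : ℝ) ^ (-(ε / 4)) / 9 with hp
  have hp0 : 0 < p := by positivity
  -- With s = √(ε log n)/2 one has exp(-s²) = n^(-ε/4), and (s+1)²/2 ≤ s² + 1 costs a factor e ≤ 3,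
  -- whence the 9 in p.
  have hps : p ≤ Real.exp (-(s + 1) ^ 2 / 2) / 3 := by
    have e1 : s ^ 2 = ε * l / 4 := by rw [hs, div_pow, Real.sq_sqrt (by positivity)]; norm_num
    have e2 : (n : ℝ) ^ (-(ε / 4)) = Real.exp (-s ^ 2) := by
      rw [Real.rpow_def_of_pos hn0, e1]; congr 1; ring
    have e3 : Real.exp (-s ^ 2) / 3 ≤ Real.exp (-(s + 1) ^ 2 / 2) := by
      have e4 : Real.exp 1 ≤ 3 := Real.exp_one_lt_three.le
      calc Real.exp (-s ^ 2) / 3 ≤ Real.exp (-s ^ 2) / Real.exp 1 := by gcongr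
        _ = Real.exp (-s ^ 2 - 1) := (Real.exp_sub _ _).symm
        _ ≤ _ := Real.exp_le_exp.2 (by nlinarith [sq_nonneg (s - 1)])
    rw [hp, e2]
    linarith
  have hfeat : Whp (Measure.pi fun _ : Fin n => D) ((n : ℝ) ^ q)⁻¹ fun w =>
      ∃ I : Finset (Fin n), n / (64 * M) ≤ (I.card : ℝ) ∧ ∀ i ∈ I, 1 / 3 ≤ |(inner ℝ e (w i) : ℝ)| := by
    classical
    have hm : MeasurableSet {x : Vec d | 1 / 3 ≤ |(inner ℝ e x : ℝ)|} :=
      measurableSet_le measurable_const (by fun_prop)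
    refine (whp_le_count D (S := fun _ => {x : Vec d | 1 / 3 ≤ |(inner ℝ e x : ℝ)|}) (fun _ => hm)
      (p := 1 / (32 * M)) (by positivity) Finset.univ fun i _ => ?_).mono ?_ fun w hw => ?_
    · simpa using small_ball hD hM1 (hM D hD) (u := e) (by rw [he]; norm_num) 0
    · rw [inv_pow_eq_exp hn]
      apply Real.exp_le_exp.2
      rw [neg_le_neg_iff, le_div_iff₀ (by norm_num), Finset.card_univ, Fintype.card_fin, div_pow,
        mul_div_assoc', le_div_iff₀ (by positivity)]
      rw [pow_one, Real.rpow_one] at h1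
      change q * l * 8 * (32 * M) ^ 2 ≤ _
      linarith
    · refine ⟨_, le_trans (le_of_eq ?_) hw, fun i hi => (Finset.mem_filter.1 hi).2⟩
      rw [Finset.card_univ, Fintype.card_fin]
      field_simp
      norm_num
  have hnoise : Whp ((Measure.pi fun _ : Fin n => D).prod γ) ((n : ℝ) ^ q)⁻¹ fun ω =>
      (∃ I : Finset (Fin n), n / (64 * M) ≤ (I.card : ℝ) ∧
        ∀ i ∈ I, 1 / 3 ≤ |(inner ℝ e (ω.1 i) : ℝ)|) →
      ∃ I : Finset (Fin n), (n : ℝ) ^ (1 - ε) ≤ I.card ∧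
          ∀ i ∈ I, 1 / 3 ≤ |(inner ℝ e (ω.1 i) : ℝ)| ∧
            s * σ * |(inner ℝ e (ω.1 i) : ℝ)| ≤ inner ℝ e (ω.1 i) * ω.2 i := by
    refine whp_prod ?_ fun w => ?_
    · have m1 : ∀ i : Fin n, Measurable fun ω : (Fin n → Vec d) × (Fin n → ℝ) =>
          1 / 3 ≤ |(inner ℝ e (ω.1 i) : ℝ)| := fun i =>
        measurableSet_setOfPred.1 (measurableSet_le measurable_const (by fun_prop))
      have m2 : ∀ i : Fin n, Measurable fun ω : (Fin n → Vec d) × (Fin n → ℝ) =>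
          s * σ * |(inner ℝ e (ω.1 i) : ℝ)| ≤ inner ℝ e (ω.1 i) * ω.2 i := fun i =>
        measurableSet_setOfPred.1 (measurableSet_le (by fun_prop) (by fun_prop))
      refine measurableSet_setOfPred.2 (Measurable.imp (Measurable.exists fun I => ?_)
        (Measurable.exists fun I => ?_))
      · exact measurable_const.and (Measurable.forall fun i => measurable_const.imp (m1 i))
      · exact measurable_const.and
          (Measurable.forall fun i => measurable_const.imp ((m1 i).and (m2 i)))
    · by_cases hw : ∃ I : Finset (Fin n), n / (64 * M) ≤ (I.card : ℝ) ∧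
        ∀ i ∈ I, 1 / 3 ≤ |(inner ℝ e (w i) : ℝ)|
      swap
      · have : {ζ : Fin n → ℝ | ¬ ((∃ I : Finset (Fin n), n / (64 * M) ≤ (I.card : ℝ) ∧
            ∀ i ∈ I, 1 / 3 ≤ |(inner ℝ e (w i) : ℝ)|) →
            ∃ I : Finset (Fin n), (n : ℝ) ^ (1 - ε) ≤ I.card ∧
              ∀ i ∈ I, 1 / 3 ≤ |(inner ℝ e (w i) : ℝ)| ∧
                s * σ * |(inner ℝ e (w i) : ℝ)| ≤ inner ℝ e (w i) * ζ i)} = ∅ :=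
          Set.eq_empty_of_forall_notMem fun ζ hζ => hζ fun h => absurd h hw
        change γ _ ≤ _
        rw [this, measure_empty]
        exact zero_le
      obtain ⟨I, hI, hI3⟩ := hw
      classical
      set x : Fin n → ℝ := fun i => inner ℝ e (w i)
      have hx : ∀ i ∈ I, 0 < |x i| := fun i hi => lt_of_lt_of_le (by norm_num) (hI3 i hi)
      -- Given the features, the errors are independent, and the sign of each feature selects the
      -- tail to be used. The expected number of successes is of order n^(1-ε/4), well above
      -- n^(1-ε).
      refine (whp_le_count (gaussianReal 0 (σ ^ 2)) (S := fun i => {y | s * σ ≤ x i / |x i| * y})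
        (fun i => measurableSet_le measurable_const (by fun_prop)) hp0.le I fun i hi => ?_).mono ?_
        fun ζ hζ _ => ?_
      · refine hps.trans (le_gaussianReal_real hσ hs0 _ ?_)
        rw [abs_div, abs_abs, div_self (hx i hi).ne']
      · rw [inv_pow_eq_exp hn]
        apply Real.exp_le_exp.2
        rw [neg_le_neg_iff]
        have e1 : p ^ 2 = (n : ℝ) ^ (-(ε / 2)) / 81 := by
          rw [hp, div_pow, ← Real.rpow_natCast, ← Real.rpow_mul hn0.le]
          norm_num
          congr 1
          ring
        have e2 : (n : ℝ) ^ (1 - ε / 2) = n * (n : ℝ) ^ (-(ε / 2)) := by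
          rw [sub_eq_add_neg, Real.rpow_add hn0, Real.rpow_one]
        rw [e2, pow_one] at h3
        calc q * l = (64 * 81 * 8 * M * q * l) / (64 * 81 * 8 * M) := by field_simp
          _ ≤ (n * (n : ℝ) ^ (-(ε / 2))) / (64 * 81 * 8 * M) := by gcongr
          _ = n / (64 * M) * p ^ 2 / 8 := by rw [e1]; field_simp
          _ ≤ _ := by gcongr
      · refine ⟨_, le_trans ?_ hζ, fun i hi => ?_⟩
        · have e2 : (n : ℝ) ^ (1 - ε) * (n : ℝ) ^ (3 * ε / 4) = n * (n : ℝ) ^ (-(ε / 4)) := by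
            rw [← Real.rpow_add hn0]
            nth_rewrite 2 [← Real.rpow_one (n : ℝ)]
            rw [← Real.rpow_add hn0]
            congr 1
            ring
          rw [pow_zero, mul_one] at h2
          have h5 : (n : ℝ) ^ (1 - ε) * (1152 * M) ≤ n * (n : ℝ) ^ (-(ε / 4)) := by
            rw [← e2]; gcongr
          calc (n : ℝ) ^ (1 - ε) = (n : ℝ) ^ (1 - ε) * (1152 * M) / (1152 * M) := by field_simp
            _ ≤ n * (n : ℝ) ^ (-(ε / 4)) / (1152 * M) := by gcongr
            _ = n / (64 * M) * (p / 2) := by rw [hp]; field_simp; norm_num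
            _ ≤ _ := by gcongr
        · obtain ⟨hi, hi2⟩ := Finset.mem_filter.1 hi
          refine ⟨hI3 i hi, ?_⟩
          have hi2 : s * σ ≤ x i / |x i| * ζ i := hi2
          have h6 := mul_le_mul_of_nonneg_right hi2 (hx i hi).le
          have e3 : x i / |x i| * ζ i * |x i| = x i * ζ i := by
            have := (hx i hi).ne'
            field_simp
          rwa [e3] at h6
  refine (hfeat.prod_fst.and hnoise (by positivity) (by positivity)).mono (by linarith) ?_
  exact fun ω hω => hω.2 hω.1

end NoiseWhp

section RegularNoiseWhp

open Filter

variable {n d m : ℕ}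

lemma measurable_gram (b : Fin n → Fin m) (i i' : Fin n) :
    Measurable fun w : Fin n → Vec d => gram b w i i' := by
  simp only [gram_eq, Regular.coeff]
  exact (measurable_centered b Finset.univ i).inner
    (measurable_scatterInv b Finset.univ (measurable_centered b Finset.univ i'))

/-- Regularity of the noise, with polylogarithmic scales. -/
lemma eventually_regularNoise {C c : ℝ} (K : ℝ) (hC : 0 < C) (hc : 0 < c) {a : ℕ} (ha : 2 ≤ a * C)
    (ha1 : 1 ≤ a) {ε : ℝ} (hε : 0 < ε) (hε1 : ε < 1) (κ q : ℕ) :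
    ∀ᶠ n : ℕ in atTop, ∀ {d m : ℕ} (b : Fin n → Fin m) (D : Measure (Vec d)) (σ : ℝ≥0), 0 < σ →
      Isotropic C c K D → m ≤ n → (∀ j, (n : ℝ) ^ ε ≤ (bucket b j).card) → ∀ e : Vec d, ‖e‖ = 1 →
      Whp ((Measure.pi fun _ : Fin n => D).prod (Measure.pi fun _ : Fin n => gaussianReal 0 (σ ^ 2)))
        (7 * ((n : ℝ) ^ q)⁻¹) fun ω => RegularNoise (Real.log n ^ κ) (Real.log n)
          (Real.log (Real.log n) ^ a) (√(ε * Real.log n) / 2) ((n : ℝ) ^ (1 - ε)) σ b e ω.1 ω.2 := by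
  filter_upwards [eventually_linear_noise (q + 1), eventually_count_le (κ * 18) (q + 1) hε,
    eventually_large K hC hc hε hε1 q,
    tendsto_log_natCast.eventually (eventually_tail_le_atTop K hc ha (κ * 18 + 1)),
    tendsto_log_natCast.eventually (eventually_tail_le_atTop (C := 2) (c := 1 / 2) 2 (by norm_num)
      (a := a) (by have : (1 : ℝ) ≤ a := by exact_mod_cast ha1
                   linarith) (κ * 18 + 1)),
    eventually_le_log 2, eventually_gt_atTop 0, tendsto_log_natCast.eventually
      (Real.tendsto_log_atTop.eventually_ge_atTop 1)]
    with n hlin hcount hlarge htail htail2 h2 hn hll d m b D σ hσ hD hmn hb e he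
  have := hD.isProbabilityMeasure
  have hn0 : (0 : ℝ) < n := by exact_mod_cast hn
  set γ := Measure.pi fun _ : Fin n => gaussianReal 0 (σ ^ 2)
  set l := Real.log n
  -- The tail bounds are applied at log n instead of n: exceeding t has probability at most (log
  -- n)^(-(18κ+1)), which is all the counts require.
  set t := Real.log l ^ a
  have ht : 0 < t := by positivity
  have hη : 0 ≤ ((n : ℝ) ^ (q + 1))⁻¹ := by positivity
  have hηn : (n : ℝ) * ((n : ℝ) ^ (q + 1))⁻¹ = ((n : ℝ) ^ q)⁻¹ := by field_simp; ring
  have hη0 : 0 ≤ ((n : ℝ) ^ q)⁻¹ := by positivity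
  have hcn : (Fintype.card (Fin n) : ℝ) ≤ n := by simp
  have hcm : (Fintype.card (Fin m) : ℝ) ≤ n := by simpa using hmn
  have hσ' : (0 : ℝ) < σ := hσ
  have w1 : Whp γ ((n : ℝ) ^ q)⁻¹ fun ζ => ∀ i, |ζ i| ≤ l * σ := by
    rw [← hηn]
    refine Whp.forall (fun i => (hlin σ (Pi.single i 1)).mono le_rfl fun ζ hζ => ?_) hη hcn
    simpa [Pi.single_apply] using hζ
  have w2 : Whp γ ((n : ℝ) ^ q)⁻¹ fun ζ => ∀ j, |∑ i ∈ bucket b j, ζ i|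
      ≤ l * (σ * √(bucket b j).card) := by
    rw [← hηn]
    refine Whp.forall (fun j => (hlin σ fun i => if i ∈ bucket b j then 1 else 0).mono le_rfl
      fun ζ hζ => ?_) hη hcm
    simpa using hζ
  have w3 : Whp ((Measure.pi fun _ : Fin n => D).prod γ) ((n : ℝ) ^ q)⁻¹ fun ω => ∀ i,
      |∑ i', gram b ω.1 i i' * ω.2 i'| ≤ l * (σ * √(∑ i', gram b ω.1 i i' ^ 2)) := by
    rw [← hηn]
    have hg : ∀ i i', Measurable fun ω : (Fin n → Vec d) × (Fin n → ℝ) => gram b ω.1 i i' :=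
      fun i i' => (measurable_gram b i i').comp measurable_fst
    -- For fixed features a row of the Gram matrix is a fixed coefficient vector, so the linear
    -- noise bound applies conditionally.
    refine Whp.forall (fun i => whp_prod (measurableSet_le ?_ ?_) fun w => hlin σ (gram b w i)) hη hcn
    · exact (Finset.measurable_fun_sum _ fun i' _ => (hg i i').mul
        ((measurable_pi_apply i').comp measurable_snd)).abs
    · exact (((Finset.measurable_fun_sum _ fun i' _ => (hg i i').pow_const 2).sqrt).const_mul
        _).const_mul _
  have w4 : Whp γ ((n : ℝ) ^ q)⁻¹ fun ζ => ∀ j,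
      (l ^ κ) ^ 18 * (((bucket b j).filter fun i => t * σ < |ζ i|).card : ℝ) ≤ (bucket b j).card := by
    rw [← hηn, ← pow_mul]
    refine Whp.forall (fun j => hcount (gaussianReal 0 (σ ^ 2)) {x | t * σ < |x|} (bucket b j)
      (measurableSet_lt measurable_const (by fun_prop)) ?_ (hb j)) hη hcm
    refine (gaussianReal_tail hσ ht.le).trans (ENNReal.ofReal_le_ofReal (le_trans (le_of_eq ?_) htail2))
    rw [Real.rpow_two]
    congr 2
    ring
  have w5 : Whp (Measure.pi fun _ : Fin n => D) ((n : ℝ) ^ q)⁻¹ fun w => ∀ j,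
      (l ^ κ) ^ 18 * (((bucket b j).filter fun i => t < |(inner ℝ e (w i) : ℝ)|).card : ℝ)
        ≤ (bucket b j).card := by
    rw [← hηn, ← pow_mul]
    exact Whp.forall (fun j => hcount D {x | t < |(inner ℝ e x : ℝ)|} (bucket b j)
      (measurableSet_lt measurable_const (by fun_prop))
      ((hD.tail e he t ht).trans (ENNReal.ofReal_le_ofReal htail)) (hb j)) hη hcm
  have w6 := hlarge D σ hσ hD e he
  refine (((w1.and w2 hη0 hη0).and w4 (by positivity) hη0).prod_snd.and
    (((w3.and w5.prod_fst hη0 hη0).and w6 (by positivity) (by positivity))) (by positivity)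
      (by positivity)).mono (by linarith) ?_
  rintro ω ⟨⟨⟨h1, h2⟩, h4⟩, ⟨h3, h5⟩, I, hI, h6⟩
  refine ⟨h1, h2, h3, h4, h5, I, hI, fun i hi => ?_⟩
  obtain ⟨h7, h8⟩ := h6 i hi
  set x : ℝ := inner ℝ e (ω.1 i)
  have hx : 0 < |x| := lt_of_lt_of_le (by norm_num) h7
  refine ⟨x / |x|, by rw [abs_div, abs_abs, div_self hx.ne'], ?_, ?_⟩
  · rw [div_mul_eq_mul_div, ← abs_mul_abs_self, mul_div_assoc, div_self hx.ne', mul_one]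
    exact h7
  · rw [div_mul_eq_mul_div x, le_div_iff₀ hx]
    exact h8

end RegularNoiseWhp

/-! ### Assembly: whitening, choice of scales and final rates. -/

section Main

open Filter

/-- With high probability, the data are typical. -/
lemma eventually_typical {C c : ℝ} (K : ℝ) (hC : 0 < C) (hc : 0 < c) {a : ℕ} (ha : 2 ≤ a * C)
    (ha1 : 1 ≤ a) {ε : ℝ} (hε : 0 < ε) (hε1 : ε < 1) (q : ℕ) :
    ∀ᶠ n : ℕ in atTop, ∀ {d m : ℕ} (b : Fin n → Fin m) (D : Measure (Vec d)) (σ : ℝ≥0), 0 < σ →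
      WellBehaved C c K D → Sizes (Real.log n ^ (2 * a + 2)) n d m b →
      (∀ j, 2 * ((bucket b j).card : ℝ) ≤ n) → (∀ j, (n : ℝ) ^ ε ≤ (bucket b j).card) →
      ∀ (μ : Fin m → ℝ) (β e : Vec d), ‖e‖ = 1 → ∃ z : ℝ, 0 < z ∧
      Whp (regressionLaw n D σ) (8 * ((n : ℝ) ^ q)⁻¹) fun ω =>
        Typical ((Real.log n ^ (2 * a + 2)) ^ 6) (Real.log (Real.log n) ^ a + 1) σ z
          (√(ε * Real.log n) / 2 / 24) ((n : ℝ) ^ (1 - ε)) b ω.1 (labels b μ β ω.1 ω.2) e := by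
  filter_upwards [eventually_regular K hC hc ha q,
    eventually_regularNoise K hC hc ha ha1 hε hε1 (2 * a + 2) q, eventually_le_log 1,
    eventually_le_log (16 / ε)] with n hreg hnoise hl1 hlε d m b D σ hσ hD hs hb2 hbε μ β e he
  have := hD.isProbabilityMeasure
  obtain ⟨Q, hQ, hQS⟩ := exists_posDef_sqrt_inv hD.cov_posDef
  have hdet : IsUnit Q.det := hQ.det_pos.ne'.isUnit
  have hiso := hD.isotropic hQ hQS
  have := hiso.isProbabilityMeasure
  have hv : transform Q e ≠ 0 := by
    intro h0
    have h1 : Matrix.mulVec Q e.ofLp = 0 := congrArg WithLp.ofLp h0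
    have h2 : e = 0 := by
      ext i
      have h3 := (Matrix.mulVec_injective_iff_isUnit.2 ((Matrix.isUnit_iff_isUnit_det _).2 hdet))
        (h1.trans (Matrix.mulVec_zero Q).symm)
      exact congrFun h3 i
    rw [h2, norm_zero] at he
    exact zero_ne_one he
  set η := ‖transform Q e‖ with hη
  have hη0 : 0 < η := norm_pos_iff.2 hv
  set e' := η⁻¹ • transform Q e with he'
  have he'1 : ‖e'‖ = 1 := by
    rw [he', norm_smul, norm_inv, Real.norm_of_nonneg hη0.le, inv_mul_cancel₀ hη0.ne']
  have hve : transform Q e = η • e' := by rw [he', smul_smul, mul_inv_cancel₀ hη0.ne', one_smul]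
  refine ⟨η / n, div_pos hη0 hs.n_pos, ?_⟩
  have hmn : m ≤ n := by
    have h1 := Regular.m_mul_le hs
    have h2 : 1 ≤ (Real.log n ^ (2 * a + 2)) ^ 20 * √(d : ℝ) := one_le_mul_of_one_le_of_one_le
      (hs.one_le_pow 20) hs.one_le_sqrt
    have h3 : (m : ℝ) ≤ n := le_trans (le_mul_of_one_le_right (by positivity) h2) h1
    exact_mod_cast h3
  have h1 : Whp (regressionLaw n (D.map (transform Q)) σ) ((n : ℝ) ^ q)⁻¹ fun ω =>
      Regular (Real.log n ^ (2 * a + 2)) b e' ω.1 :=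
    (hreg b (D.map (transform Q)) hiso hs hb2 e' he'1).prod_fst
  have h2 := hnoise b (D.map (transform Q)) σ hσ hiso hmn hbε e' he'1
  have h3 := h1.and h2 (by positivity) (by positivity)
  -- Failure for the original features is failure for the whitened ones, in the direction Qe
  -- normalised; its length enters only the scale z.
  refine (measure_mono fun ω hω => ?_).trans ((regressionLaw_le σ (measurable_transform Q) _).trans
    (h3.trans (ENNReal.ofReal_le_ofReal (by linarith))))
  intro hgood
  refine hω (hgood.2.typical hs hgood.1 he'1 (by linarith) (le_self_pow₀ hl1 (by omega)) hσ ?_ hdet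
    (fun i => rfl) hη0 hve μ β)
  -- The bound log n ≥ 16/ε is exactly what makes √(ε log n)/2 ≥ 2.
  rw [div_le_iff₀ hε] at hlε
  rw [le_div_iff₀ (by norm_num)]
  exact Real.le_sqrt_of_sq_le (by linarith)

/-- For x ≥ 1, 4(x+1)² + 3 ≤ 19x², and 3648 = 4·19·48. Powers of log log n are eventually below
√(log n). -/
lemma eventually_log_log_le {ε : ℝ} (hε : 0 < ε) (a : ℕ) :
    ∀ᶠ n : ℕ in atTop, 2 * (4 * (Real.log (Real.log n) ^ a + 1) ^ 2 + 3)
        ≤ √(ε * Real.log n) / 2 / 24 ∧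
      4 * (4 * (Real.log (Real.log n) ^ a + 1) ^ 2 + 3) / (√(ε * Real.log n) / 2 / 24)
        ≤ 3648 / √ε * Real.log (Real.log n) ^ (2 * a) / √(Real.log n) := by
  filter_upwards [tendsto_log_natCast.eventually (eventually_mul_log_pow_le_atTop (1824 / √ε) (2 * a)
    (r := 1 / 2) (by norm_num)), eventually_le_log 1,
    tendsto_log_natCast.eventually (Real.tendsto_log_atTop.eventually_ge_atTop 1)] with n h1 h2 h3
  set L := Real.log (Real.log n)
  have hε' : 0 < √ε := Real.sqrt_pos.2 hε
  have hl' : 0 < √(Real.log n) := Real.sqrt_pos.2 (by linarith)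
  have h4 : 4 * (L ^ a + 1) ^ 2 + 3 ≤ 19 * L ^ (2 * a) := by
    have : 1 ≤ L ^ a := one_le_pow₀ h3
    rw [mul_comm 2 a, pow_mul]
    nlinarith
  rw [Real.sqrt_mul hε.le]
  rw [← Real.sqrt_eq_rpow, div_mul_eq_mul_div, div_le_iff₀ hε'] at h1
  refine ⟨by linarith, ?_⟩
  calc _ ≤ 4 * (19 * L ^ (2 * a)) / (√ε * √(Real.log n) / 2 / 24) := by gcongr
    _ = _ := by field_simp; norm_num

end Main
end Ohare
end

theorem mainTheorem3 (ε C c K : ℝ) (hε : 0 < ε) (hC : 0 < C) (hc : 0 < c) (hK : 0 < K) :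
    ∃ (A A' B : ℕ) (M : ℝ), 0 < M ∧ ∀ p : ℕ, ∃ n₀ : ℕ, ∀ n : ℕ, n₀ ≤ n →
      ∀ (d m : ℕ) (b : Fin n → Fin m),
        (∀ j : Fin m,
          (n : ℝ) ^ ε + Real.log n ^ A * √(d : ℝ) < ((Ohare.bucket b j).card : ℝ) ∧
            ((Ohare.bucket b j).card : ℝ) < 0.49 * n) →
        (d : ℝ) ≤ (n : ℝ) ^ (4 / 5 : ℝ) / Real.log n ^ A →
        ∀ (D : Measure (EuclideanSpace ℝ (Fin d))), Ohare.WellBehaved C c K D →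
        ∀ (σ : ℝ≥0), 0 < σ →
        ∀ (μ : Fin m → ℝ) (β e : EuclideanSpace ℝ (Fin d)), ‖e‖ = 1 →
          Ohare.regressionLaw n D σ
            {ω | ¬ ∀ k : ℕ, 1 ≤ k →
              (k : ℝ) < min (min ((n : ℝ) / √(d : ℝ)) ((n : ℝ) ^ 2 / (d : ℝ) ^ 2))
                  ((n : ℝ) ^ (1 - ε)) / Real.log n ^ A' →
              0 < Ohare.lower b ω.1 (Ohare.labels b μ β ω.1 ω.2) e k ∧
              1 ≤ Ohare.upper b ω.1 (Ohare.labels b μ β ω.1 ω.2) e k /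
                  Ohare.lower b ω.1 (Ohare.labels b μ β ω.1 ω.2) e k ∧
              Ohare.upper b ω.1 (Ohare.labels b μ β ω.1 ω.2) e k /
                  Ohare.lower b ω.1 (Ohare.labels b μ β ω.1 ω.2) e k ≤
                ((1 + M * Real.log (Real.log n) ^ B / √(Real.log n) : ℝ) : EReal)}
            ≤ ENNReal.ofReal ((n : ℝ) ^ (-(p : ℝ))) := by
  -- For ε ≥ 1 the size conditions contradict each other: a bucket would have more than n^ε ≥ n and
  -- fewer than 0.49n samples.
  rcases le_or_gt 1 ε with hε1 | hε1
  · refine ⟨0, 0, 0, 1, one_pos, fun p => ⟨1, fun n hn d m b hb => ?_⟩⟩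
    have hn1 : (1 : ℝ) ≤ n := by exact_mod_cast hn
    obtain ⟨h1, h2⟩ := hb (b ⟨0, hn⟩)
    have h3 : (n : ℝ) ^ (1 : ℝ) ≤ (n : ℝ) ^ ε := Real.rpow_le_rpow_of_exponent_le hn1 hε1
    rw [Real.rpow_one] at h3
    have h4 : 0 ≤ Real.log n ^ 0 * √(d : ℝ) := by positivity
    linarith
  obtain ⟨a, ha1, ha⟩ : ∃ a : ℕ, 1 ≤ a ∧ 2 ≤ a * C := by
    refine ⟨max 1 ⌈2 / C⌉₊, le_max_left _ _, ?_⟩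
    have h1 : 2 / C ≤ (⌈2 / C⌉₊ : ℝ) := Nat.le_ceil _
    rw [div_le_iff₀ hC] at h1
    refine h1.trans ?_
    gcongr
    exact le_max_right _ _
  set κ := 2 * a + 2 with hκ
  -- With T = (log n)^κ, A supplies the T²⁰ of `Sizes` and A' the P³ = T¹⁸ of the higher order
  -- terms. Each has one spare logarithm to absorb numerical constants. B = 2a comes from t².
  refine ⟨20 * κ + 1, 18 * κ + 1, 2 * a, 3648 / √ε, by positivity, fun p => ?_⟩
  refine Filter.eventually_atTop.1 ?_
  filter_upwards [Ohare.eventually_typical K hC hc ha ha1 hε hε1 (p + 1),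
    Ohare.eventually_log_log_le hε a, Ohare.eventually_le_log 300, Filter.eventually_ge_atTop 8,
    Ohare.tendsto_log_natCast.eventually (Real.tendsto_log_atTop.eventually_ge_atTop 1)]
    with n htyp hlog hl hn hll d m b hb hd D hD σ hσ μ β e he
  have hn8 : (8 : ℝ) ≤ n := by exact_mod_cast hn
  have hn0 : (0 : ℝ) < n := by linarith
  set l := Real.log n with hldef
  have hl0 : 0 < l := by linarith
  set T := l ^ κ with hT
  have hlT : l ≤ T := le_self_pow₀ (by linarith) (by omega)
  have hT1 : 1 ≤ T := by linarith
  have hA : l ^ (20 * κ + 1) = l * T ^ 20 := by rw [hT, ← pow_mul, pow_succ']; ring_nf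
  have hA' : l ^ (18 * κ + 1) = l * T ^ 18 := by rw [hT, ← pow_mul, pow_succ']; ring_nf
  have hd1 : 1 ≤ d := by
    rcases Nat.eq_zero_or_pos d with rfl | h
    · exact absurd he (by rw [Subsingleton.elim e 0, norm_zero]; exact zero_ne_one)
    · exact h
  have hdn : d * (l * T ^ 20) ≤ n := by
    rw [hA, le_div_iff₀ (by positivity)] at hd
    refine hd.trans ?_
    nth_rewrite 2 [← Real.rpow_one (n : ℝ)]
    exact Real.rpow_le_rpow_of_exponent_le (by linarith) (by norm_num)
  have hnε : ∀ j, (n : ℝ) ^ ε ≤ ((Ohare.bucket b j).card : ℝ) := fun j => by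
    have h1 := (hb j).1
    have h2 : 0 ≤ l ^ (20 * κ + 1) * √(d : ℝ) := by positivity
    linarith
  have hs : Ohare.Sizes T n d m b := by
    refine ⟨by linarith, hd1, ?_, fun j => ?_⟩
    · refine le_trans ?_ hdn
      gcongr
      exact le_mul_of_one_le_left (by positivity) (by linarith)
    · have h1 := (hb j).1
      rw [hA] at h1
      have h2 : 0 ≤ (n : ℝ) ^ ε := by positivity
      have h3 : T ^ 20 * √(d : ℝ) ≤ l * T ^ 20 * √(d : ℝ) := by
        gcongr
        exact le_mul_of_one_le_left (by positivity) (by linarith)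
      linarith
  obtain ⟨z, hz, hwhp⟩ := htyp b D σ hσ hD hs (fun j => by linarith [(hb j).2]) hnε μ β e he
  -- Typicality was requested at exponent p + 1, so that n ≥ 8 absorbs the number of failure events.
  have hprob : 8 * ((n : ℝ) ^ (p + 1))⁻¹ ≤ (n : ℝ) ^ (-(p : ℝ)) := by
    rw [Real.rpow_neg hn0.le, Real.rpow_natCast, pow_succ, mul_inv, ← mul_assoc, mul_comm (8 : ℝ),
      mul_assoc]
    refine mul_le_of_le_one_right (by positivity) ?_
    rw [← div_eq_mul_inv, div_le_one hn0]
    exact hn8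
  refine hwhp.mono hprob fun ω hω k hk1 hk => ?_
  have hscales : Ohare.Scales (T ^ 6) (Real.log l ^ a + 1) σ z n d m b := by
    refine ⟨one_le_pow₀ hT1, ?_, hσ, hz, hn0, ?_, fun j => hs.sqrt_le_bucket j⟩
    · have : 0 ≤ Real.log l ^ a := by positivity
      linarith
    · refine le_trans ?_ hdn
      have h1 : T ^ 18 ≤ T ^ 20 := pow_le_pow_right₀ hT1 (by norm_num)
      calc 32 * (T ^ 6) ^ 3 * d = d * (32 * T ^ 18) := by ring
        _ ≤ d * (l * T ^ 20) := by gcongr; linarith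
  have hd0 : (0 : ℝ) < d := by linarith [hs.one_le_d']
  rw [hA', lt_div_iff₀ (by positivity), lt_min_iff, lt_min_iff, lt_div_iff₀ (by positivity),
    lt_div_iff₀ (by positivity)] at hk
  obtain ⟨⟨hk2, hk3⟩, hk4⟩ := hk
  have hlT18 : 1 ≤ l * T ^ 18 := one_le_mul_of_one_le_of_one_le (by linarith) (one_le_pow₀ hT1)
  have hkN : (k : ℝ) ≤ (n : ℝ) ^ (1 - ε) :=
    le_trans (le_mul_of_one_le_right (by positivity) hlT18) hk4.le
  have hkn : k ≤ n := by
    have h1 : (n : ℝ) ^ (1 - ε) ≤ (n : ℝ) ^ (1 : ℝ) :=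
      Real.rpow_le_rpow_of_exponent_le (by linarith) (by linarith)
    rw [Real.rpow_one] at h1
    exact_mod_cast hkN.trans h1
  have hK1 : 300 * (T ^ 6) ^ 3 * k * √(d : ℝ) ≤ n := by
    refine le_trans ?_ hk2.le
    calc 300 * (T ^ 6) ^ 3 * k * √(d : ℝ) = k * (300 * T ^ 18) * √(d : ℝ) := by ring
      _ ≤ k * (l * T ^ 18) * √(d : ℝ) := by gcongr
  have hK2 : 32 * (T ^ 6) ^ 2 * k * (d : ℝ) ^ 2 ≤ (n : ℝ) ^ 2 := by
    refine le_trans ?_ hk3.le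
    have h1 : T ^ 12 ≤ T ^ 18 := pow_le_pow_right₀ hT1 (by norm_num)
    calc 32 * (T ^ 6) ^ 2 * k * (d : ℝ) ^ 2 = k * (32 * T ^ 12) * (d : ℝ) ^ 2 := by ring
      _ ≤ k * (l * T ^ 18) * (d : ℝ) ^ 2 := by gcongr; linarith
  obtain ⟨h1, h2, h3⟩ := hω.bounds_ratio hscales hlog.1 hk1 hkn hkN hK1 hK2
  refine ⟨h1, h2, h3.trans ?_⟩
  rw [EReal.coe_le_coe_iff]
  linarith [hlog.2]
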